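/- Let $n\ge 1$, and let $g$ be a fixed positive definite symmetric bilinear form on an $n$-dimensional real vector space (a tangent space $T_xM$ with a reference Riemannian metric). In a fixed basis, identify symmetric $(0,2)$-tensors with symmetric real $n\times n$ matrices. Let $\mathcal M_x$ be the open cone of positive definite symmetric tensors, with the Riemannian metric $$\langle b,c\rangle_a=\operatorname{tr}(a^{-1}b\,a^{-1}c)\,\sqrt{\det (g^{-1}a)}\qquad(a\in\mathcal M_x,\ b,c \text{ symmetric}),$$ let $d_x$ be its Riemannian distance (the infimum of the lengths of piecewise $C^1$ curves in $\mathcal M_x$), and let $\overline{\mathcal M_x}$ be the metric completion of $(\mathcal M_x,d_x)$. For $a\in\mathcal M_x$ and $b$ symmetric write $\operatorname{tr}_a b=\operatorname{tr}(a^{-1}b)$, $\operatorname{tr}_a(b^2)=\operatorname{tr}(a^{-1}b\,a^{-1}b)$ and $b_T=b-\frac1n(\operatorname{tr}_{a}b)\,a$ (with $a=a_0$ below). A minimal path is a continuous path, parametrized on $[0,1]$, whose length between any two of its points equals their distance. A minimal path $\gamma$ is unique up to reparametrization if every minimal path with the same initial and terminal points is $\gamma\circ\varphi$ for some continuous nondecreasing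 $\varphi:[0,1]\to[0,1]$ with $\varphi(0)=0$, $\varphi(1)=1$. Then $\mathcal M_x$ embeds in $\overline{\mathcal M_x}$ and $\overline{\mathcal M_x}=\mathcal M_x\sqcup\{[0]\}$ for a single further point $[0]$, and any two points $a_0,a_1\in\overline{\mathcal M_x}$ are joined by a minimal path that is unique up to reparametrization. Moreover: 1. Suppose $a_0,a_1\in\mathcal M_x$ and $a_1=a_0\exp(a_0^{-1}b)$ with $b$ symmetric. * If $\operatorname{tr}_{a_0}(b_T^2)<(4\pi)^2/n$, there is exactly one Riemannian geodesic $\sigma:[0,1]\to\mathcal M_x$ of $\langle\cdot,\cdot\rangle$ with $\sigma(0)=a_0$, $\sigma(1)=a_1$, and it is the minimal path. Explicitly, let $$v=\tfrac4n\Big(e^{\operatorname{tr}_{a_0}(b)/4}\cos\tfrac{\rho}{4}-1\Big)a_0+\tfrac4{\rho}\,e^{\operatorname{tr}_{a_0}(b)/4}\sin\tfrac{\rho}{4}\;b_T,\qquad \rho=\sqrt{n\operatorname{tr}_{a_0}(b_T^2)},$$ if $b_T\ne0$, and $v=\frac4n(e^{\operatorname{tr}_{a_0}(b)/4}-1)a_0$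 if $b_T=0$. With $v_T$ the traceless part of $v$, $q(t)=1+\frac t4\operatorname{tr}_{a_0}v$ and $r(t)=\frac t4\sqrt{n\operatorname{tr}_{a_0}(v_T^2)}$, $$\sigma(t)=(q^2+r^2)^{2/n}\,a_0\exp\Big(\tfrac{4}{\sqrt{n\operatorname{tr}_{a_0}(v_T^2)}}\,\arg(q+ir)\;a_0^{-1}v_T\Big)\ \text{ if } v_T\neq0,\qquad \sigma(t)=q^{4/n}a_0\ \text{ if } v_T=0.$$ * If $\operatorname{tr}_{a_0}(b_T^2)\ge(4\pi)^2/n$, the minimal path is the concatenation of the straight segment $s\mapsto (1-s)a_0$ from $a_0$ to $[0]$ and the straight segment $s\mapsto s\,a_1$ from $[0]$ to $a_1$ ($0\le s\le 1$), where the zero tensor is read as $[0]$. 2. If there is no such $b$, then $a_0=[0]$ or $a_1=[0]$, and the minimal path is the straight segment between the two points: $s\mapsto(1-s)a_0$ if $a_1=[0]\neq a_0$, $s\mapsto s\,a_1$ if $a_0=[0]\ne a_1$, and constant if both are $[0]$. -/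

import Mathlib

open Set

/-! In a basis of an `n`-dimensional tangent space, symmetric `(0,2)`-tensors are symmetric real
`n × n` matrices. `G` is the (positive definite) value of the reference metric; for a tensor `a`
the endomorphism `A` obtained by raising an index is `G⁻¹ * a`. -/

noncomputable section

namespace MetricFiber

variable {n : ℕ}

/-- The fiber: positive definite symmetric tensors at the given point. It is
indexed by the reference metric `G`, on which the Riemannian metric of the fiber depends. -/
structure Fiber (G : Matrix (Fin n) (Fin n) ℝ) where
  val : Matrix (Fin n) (Fin n) ℝ
  posDef : val.PosDef

/-- `tr_a b = tr (a⁻¹ b)`. -/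
def tr₁ (a b : Matrix (Fin n) (Fin n) ℝ) : ℝ := (a⁻¹ * b).trace

/-- `tr_a (b c) = tr (a⁻¹ b a⁻¹ c)`. -/
def tr₂ (a b c : Matrix (Fin n) (Fin n) ℝ) : ℝ := (a⁻¹ * b * a⁻¹ * c).trace

/-- The Riemannian metric `⟨b, c⟩_a = tr_a (b c) √(det A)` with `A = G⁻¹ a`. -/
def metric (G a b c : Matrix (Fin n) (Fin n) ℝ) : ℝ :=
  tr₂ a b c * Real.sqrt (G⁻¹ * a).det

/-- The `a`-traceless part `b_T = b - (1/n) (tr_a b) a`. -/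
def traceless (a b : Matrix (Fin n) (Fin n) ℝ) : Matrix (Fin n) (Fin n) ℝ :=
  b - ((1 / (n : ℝ)) * tr₁ a b) • a

/-- The derivative of a matrix-valued curve on `[0,1]`, one-sided at the end points. -/
def velocity (γ : ℝ → Matrix (Fin n) (Fin n) ℝ) (t : ℝ) : Matrix (Fin n) (Fin n) ℝ :=
  Matrix.of fun i j => derivWithin (fun s => γ s i j) (Icc 0 1) t

/-- A curve of class `C^k` on `[0,1]` in the positive definite tensors. -/
structure IsCurve (k : ℕ) (γ : ℝ → Matrix (Fin n) (Fin n) ℝ) : Prop where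
  contDiffOn : ∀ i j, ContDiffOn ℝ k (fun t => γ t i j) (Icc 0 1)
  posDef : ∀ t ∈ Icc (0 : ℝ) 1, (γ t).PosDef

/-- The Riemannian length of a `C^1` curve on `[0,1]`. -/
def length (G : Matrix (Fin n) (Fin n) ℝ) (γ : ℝ → Matrix (Fin n) (Fin n) ℝ) : ℝ :=
  ∫ t in (0 : ℝ)..1, Real.sqrt (metric G (γ t) (velocity γ t) (velocity γ t))

/-- `Joins G a b L`: some piecewise `C^1` curve in the fiber (a finite concatenation of
`C^1` curves) runs from `a` to `b` and has length `L`. -/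
inductive Joins (G : Matrix (Fin n) (Fin n) ℝ) : Fiber G → Fiber G → ℝ → Prop
  | refl (a : Fiber G) : Joins G a a 0
  | cons (γ : ℝ → Matrix (Fin n) (Fin n) ℝ) (hγ : IsCurve 1 γ) (a b c : Fiber G)
      (h₀ : γ 0 = a.val) (h₁ : γ 1 = b.val) (L : ℝ) (h : Joins G b c L) :
      Joins G a c (length G γ + L)

variable {G : Matrix (Fin n) (Fin n) ℝ}

theorem length_nonneg (γ : ℝ → Matrix (Fin n) (Fin n) ℝ) : 0 ≤ length G γ :=
  intervalIntegral.integral_nonneg zero_le_one fun _ _ => Real.sqrt_nonneg _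

theorem Joins.nonneg {a b : Fiber G} {L : ℝ} (h : Joins G a b L) : 0 ≤ L := by
  induction h with
  | refl => exact le_rfl
  | cons γ hγ a b c h₀ h₁ L h ih => exact add_nonneg (length_nonneg γ) ih

theorem Joins.trans {a b c : Fiber G} {L L' : ℝ} (h : Joins G a b L) (h' : Joins G b c L') :
    Joins G a c (L + L') := by
  induction h with
  | refl => simpa using h'
  | cons γ hγ a b d h₀ h₁ L h ih =>
    rw [add_assoc]
    exact Joins.cons γ hγ a b c h₀ h₁ _ (ih h')

theorem velocity_reverse (γ : ℝ → Matrix (Fin n) (Fin n) ℝ) (t : ℝ) :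
    velocity (fun s => γ (1 - s)) t = -velocity γ (1 - t) := by
  ext i j
  simp only [velocity, Matrix.of_apply, Matrix.neg_apply]
  rw [derivWithin_comp_const_sub (f := fun s => γ s i j)]
  simp

theorem IsCurve.reverse {k : ℕ} {γ : ℝ → Matrix (Fin n) (Fin n) ℝ} (h : IsCurve k γ) :
    IsCurve k (fun s => γ (1 - s)) where
  contDiffOn i j := (h.contDiffOn i j).comp (t := Icc (0 : ℝ) 1) (s := Icc (0 : ℝ) 1)
    (f := fun s : ℝ => 1 - s) (contDiff_const.sub contDiff_id).contDiffOn
    fun s hs => ⟨by linarith [hs.2], by linarith [hs.1]⟩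
  posDef t ht := h.posDef _ ⟨by linarith [ht.2], by linarith [ht.1]⟩

theorem length_reverse (γ : ℝ → Matrix (Fin n) (Fin n) ℝ) :
    length G (fun s => γ (1 - s)) = length G γ := by
  have h := intervalIntegral.integral_comp_sub_left (a := (0 : ℝ)) (b := 1)
    (fun t => Real.sqrt (metric G (γ t) (velocity γ t) (velocity γ t))) 1
  simp only [sub_self, sub_zero] at h
  rw [length, length, ← h]
  simp only [velocity_reverse, metric, tr₂, mul_neg, neg_mul, neg_neg]

theorem Joins.symm {a b : Fiber G} {L : ℝ} (h : Joins G a b L) : Joins G b a L := by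
  induction h with
  | refl a => exact Joins.refl a
  | cons γ hγ a b c h₀ h₁ L h ih =>
    have h2 := Joins.cons (G := G) (fun s => γ (1 - s)) hγ.reverse b a a (by simpa using h₁)
      (by simpa using h₀) 0 (Joins.refl a)
    rw [length_reverse, add_zero] at h2
    rw [add_comm]
    exact ih.trans h2

theorem exists_joins (a b : Fiber G) : ∃ L, Joins G a b L := by
  refine ⟨_, Joins.cons (fun t => (1 - t) • a.val + t • b.val) ⟨?_, ?_⟩ a b b (by simp) (by simp)
    0 (Joins.refl b)⟩
  · intro i j
    simp only [Matrix.add_apply, Matrix.smul_apply, smul_eq_mul]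
    fun_prop
  · rintro t ⟨h₀, h₁⟩
    rcases h₀.eq_or_lt with rfl | h₀
    · simpa using a.posDef
    · exact Matrix.PosDef.posSemidef_add (a.posDef.posSemidef.smul (by linarith : 0 ≤ 1 - t))
        (b.posDef.smul h₀)

/-- The fiber with the Riemannian distance `d_x`: the infimum of the lengths of
piecewise `C^1` curves. -/
instance : PseudoMetricSpace (Fiber G) where
  dist a b := sInf {L | Joins G a b L}
  dist_self a := le_antisymm (csInf_le ⟨0, fun _ h => h.nonneg⟩ (Joins.refl a))
    (Real.sInf_nonneg fun _ h => h.nonneg)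
  dist_comm a b := congrArg sInf (Set.ext fun _ => ⟨Joins.symm, Joins.symm⟩)
  dist_triangle a b c := by
    refine le_of_forall_pos_lt_add fun ε hε => ?_
    obtain ⟨L, hL, h1⟩ := exists_lt_of_csInf_lt (s := {L | Joins G a b L}) (exists_joins a b)
      (lt_add_of_pos_right _ (half_pos hε))
    obtain ⟨L', hL', h2⟩ := exists_lt_of_csInf_lt (s := {L | Joins G b c L}) (exists_joins b c)
      (lt_add_of_pos_right _ (half_pos hε))
    have h3 : sInf {L | Joins G a c L} ≤ L + L' :=
      csInf_le ⟨0, fun _ h => h.nonneg⟩ (Joins.trans hL hL')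
    linarith

/-- The completed fiber: the metric completion of the fiber with respect to `d_x`. -/
abbrev CompletedFiber (G : Matrix (Fin n) (Fin n) ℝ) : Type :=
  UniformSpace.Completion (Fiber G)

/-- A minimal path: between any two of its points its length (supremum of the lengths
of inscribed polygons) is the distance of the two points. -/
def IsMinimal {X : Type*} [MetricSpace X] {p q : X} (γ : Path p q) : Prop :=
  ∀ s t : unitInterval, s ≤ t → eVariationOn γ (Icc s t) = edist (γ s) (γ t)

/-- `γ` is minimal, and every minimal path with the same end points is obtained from it by
a continuous monotone change of parameter. -/
def IsUniqueMinimal {X : Type*} [MetricSpace X] {p q : X} (γ : Path p q) : Prop :=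
  IsMinimal γ ∧ ∀ γ' : Path p q, IsMinimal γ' →
    ∃ φ : unitInterval → unitInterval, Continuous φ ∧ Monotone φ ∧ φ 0 = 0 ∧ φ 1 = 1 ∧
      ∀ t, γ' t = γ (φ t)

/-- Riemannian geodesics on `[0,1]`: `C^2` curves satisfying the geodesic equation
`d/dt ⟨γ', c⟩_γ = (1/2) ∂_c ⟨γ', γ'⟩` for every constant symmetric tensor `c`; the right-hand side
is the derivative of the metric in the direction `c` with the vectors `γ'` held fixed. -/
structure IsRiemannianGeodesic (G : Matrix (Fin n) (Fin n) ℝ)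
    (γ : ℝ → Matrix (Fin n) (Fin n) ℝ) : Prop where
  isCurve : IsCurve 2 γ
  equation : ∀ t ∈ Icc (0 : ℝ) 1, ∀ c : Matrix (Fin n) (Fin n) ℝ, c.IsSymm →
    derivWithin (fun s => metric G (γ s) (velocity γ s) c) (Icc 0 1) t =
      (1 / 2) * deriv (fun ε : ℝ => metric G (γ t + ε • c) (velocity γ t) (velocity γ t)) 0

/-- The explicit curve with initial point `a` and initial velocity `v`. The branch of
`arctan (r/q)` is the one with values in `[0, π)`, i.e. the argument of `q + i r`, for `r ≥ 0`. -/
def geodesicFrom (a v : Matrix (Fin n) (Fin n) ℝ) (t : ℝ) : Matrix (Fin n) (Fin n) ℝ :=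
  let τ : ℝ := tr₂ a (traceless a v) (traceless a v)
  let q : ℝ := 1 + t / 4 * tr₁ a v
  let r : ℝ := t / 4 * Real.sqrt (n * τ)
  open Classical in
  if traceless a v = 0 then (q ^ (4 / (n : ℝ)) : ℝ) • a
  else ((q ^ 2 + r ^ 2) ^ (2 / (n : ℝ)) : ℝ) •
    (a * NormedSpace.exp ((4 / Real.sqrt (n * τ) * Complex.arg ⟨q, r⟩) • (a⁻¹ * traceless a v)))

/-- The inverse `ψ` of the Riemannian exponential map at `a`, in the coordinate `b` of the point
`a exp (a⁻¹ b)`. -/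
def invExp (a b : Matrix (Fin n) (Fin n) ℝ) : Matrix (Fin n) (Fin n) ℝ :=
  let ρ : ℝ := Real.sqrt (n * tr₂ a (traceless a b) (traceless a b))
  let E : ℝ := Real.exp (tr₁ a b / 4)
  open Classical in
  if traceless a b = 0 then (4 / (n : ℝ) * (E - 1)) • a
  else (4 / (n : ℝ) * (E * Real.cos (ρ / 4) - 1)) • a +
    (4 / ρ * E * Real.sin (ρ / 4)) • traceless a b

/-- The point `s a` (`s ≥ 0`) of the straight ray from the singular point `z` through `a`:
it is `z` for `s = 0`. -/
def rayPoint (z : CompletedFiber G) (a : Fiber G) (s : ℝ) : CompletedFiber G :=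
  if h : 0 < s then ((⟨s • a.val, a.posDef.smul h⟩ : Fiber G) : CompletedFiber G) else z

end MetricFiber

end

noncomputable section

namespace MetricFiber

open Matrix NormedSpace Filter Topology

variable {n : ℕ} {G : Matrix (Fin n) (Fin n) ℝ}

/-! Put r = (4/√n)(det A)^{1/4} (`radius`). Splitting a tangent vector b into its trace and
traceless parts turns the metric into dr² + r²·(n/16)·tr_a(b_T²). The fiber is thus a cone: r is the
distance from the apex [0], and the cross-section is the space of tensors of fixed determinant with
a scaled nonpositively curved symmetric metric. The angle between the rays through a₀ and a₀
exp(a₀⁻¹b) is θ = ρ/4 (`angle`). If θ < π, the two points span a flat planar sector and the minimal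
path is its chord; if θ ≥ π, the minimal path goes through the apex. The bound (4π)²/n on tr(b_T²)
is the condition θ < π.

Lower bounds for the distance avoid curvature theory. The finite inequality `trace_sub_sq_le` says
that the exponential of symmetric matrices does not shorten distances. With it, the map to ℂ with
polar coordinates r and φ(X), where X is the exponential coordinate and φ is short, satisfies a
two-point estimate by `quasi` (`norm_develop_sub_sq_le`). To second order `quasi` is the Riemannian
metric (`tendsto_quasi_div_sq`), so the map is 1-Lipschitz for the Riemannian distance
(`norm_develop_sub_le_dist`). Taking φ to be a clamped linear functional in the direction joining
two points gives the planar law of cosines as a lower bound (`law_of_cosines_le`).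

For the upper bounds, the geodesic equation is integrated explicitly
(`IsRiemannianGeodesic.eq_geodesicFrom`): q + ir runs along a straight line in the plane, and
`invExp` is the initial velocity of the chord with the prescribed end. This gives equality in the
law of cosines for θ < π. In general the distance is at most the sum of the radii, by contracting
both points towards the apex (`dist_le_radius_add_radius`).

Uniqueness comes from rigidity. If m lies between p and q, the development preserves the distances
among the three points, so the image of m lies on the planar segment. For θ < π, `dev_chart_eq`
recovers m from this image; for θ ≥ π, m lies on one of the two rays or is the apex.
`exists_isUniqueMinimal` turns such a description of all intermediate points into uniqueness up to
reparametrization. Finally, a Cauchy sequence whose radii stay away from 0 has convergent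
exponential coordinates, so the completion adds only the apex (`exists_coe_eq`). -/

/-! ### Spectral calculus and the exponential of symmetric matrices. -/

theorem exists_orthogonal_diagonal {X : Matrix (Fin n) (Fin n) ℝ} (hX : X.IsSymm) :
    ∃ (U : Matrix (Fin n) (Fin n) ℝ) (d : Fin n → ℝ), Uᵀ * U = 1 ∧ U * Uᵀ = 1 ∧
      X = U * diagonal d * Uᵀ := by
  have hH : X.IsHermitian := by rwa [IsHermitian, conjTranspose_eq_transpose_of_trivial]
  refine ⟨hH.eigenvectorUnitary, hH.eigenvalues, ?_, ?_, ?_⟩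
  · have := hH.eigenvectorUnitary.2.1
    rwa [star_eq_conjTranspose, conjTranspose_eq_transpose_of_trivial] at this
  · have := hH.eigenvectorUnitary.2.2
    rwa [star_eq_conjTranspose, conjTranspose_eq_transpose_of_trivial] at this
  · have := hH.spectral_theorem
    rw [Unitary.conjStarAlgAut_apply, star_eq_conjTranspose,
      conjTranspose_eq_transpose_of_trivial] at this
    exact this

theorem exp_orthogonal_diagonal {U : Matrix (Fin n) (Fin n) ℝ} (hU : Uᵀ * U = 1)
    (hU' : U * Uᵀ = 1) (d : Fin n → ℝ) :
    exp (U * diagonal d * Uᵀ) = U * diagonal (fun i => Real.exp (d i)) * Uᵀ := by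
  have hi : U⁻¹ = Uᵀ := inv_eq_left_inv hU
  have hu : IsUnit U := ⟨⟨U, Uᵀ, hU', hU⟩, rfl⟩
  have := exp_conj U (diagonal d) hu
  rw [hi, exp_diagonal] at this
  rw [this]
  congr
  ext i
  rw [Real.exp_eq_exp_ℝ, Pi.coe_exp]

/-- The weights are squares and do not depend on f and g, so a trace inequality between functions of
two symmetric matrices reduces to a scalar inequality for each pair of eigenvalues. -/
theorem trace_conj_diagonal_mul (U V : Matrix (Fin n) (Fin n) ℝ) (f g : Fin n → ℝ) :
    (U * diagonal f * Uᵀ * (V * diagonal g * Vᵀ)).trace =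
      ∑ i, ∑ j, f i * g j * (Uᵀ * V) i j ^ 2 := by
  have h : (U * diagonal f * Uᵀ * (V * diagonal g * Vᵀ)).trace =
      (diagonal f * (Uᵀ * V) * diagonal g * (Uᵀ * V)ᵀ).trace := by
    rw [transpose_mul, transpose_transpose]
    rw [show U * diagonal f * Uᵀ * (V * diagonal g * Vᵀ) =
      U * (diagonal f * Uᵀ * V * diagonal g * Vᵀ) by simp only [Matrix.mul_assoc], trace_mul_comm]
    simp only [Matrix.mul_assoc]
  rw [h, trace]
  refine Finset.sum_congr rfl fun i _ => ?_
  rw [diag_apply, mul_apply]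
  refine Finset.sum_congr rfl fun j _ => ?_
  rw [mul_diagonal, diagonal_mul, transpose_apply]
  ring

/-- The right-hand side is (2 sinh(x/2))², and |sinh y| ≥ |y|. -/
theorem sq_le_exp_add_exp_neg (x : ℝ) : x ^ 2 ≤ Real.exp x + Real.exp (-x) - 2 := by
  have h : Real.exp x + Real.exp (-x) - 2 = (2 * Real.sinh (x / 2)) ^ 2 := by
    rw [Real.sinh_eq]
    have h1 : Real.exp x = Real.exp (x / 2) ^ 2 := by rw [← Real.exp_nat_mul]; congr 1; push_cast; ring
    have h2 : Real.exp (-x) = Real.exp (-(x / 2)) ^ 2 := by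
      rw [← Real.exp_nat_mul]; congr 1; push_cast; ring
    have h3 : Real.exp (x / 2) * Real.exp (-(x / 2)) = 1 := by rw [← Real.exp_add]; simp
    rw [h1, h2]
    linear_combination 2 * h3
  rw [h]
  refine sq_le_sq.2 ?_
  rcases le_total 0 x with hx | hx
  · have := Real.self_le_sinh_iff.2 (show 0 ≤ x / 2 by linarith)
    rw [abs_of_nonneg hx, abs_of_nonneg (by linarith)]
    linarith
  · have := Real.sinh_le_self_iff.2 (show x / 2 ≤ 0 by linarith)
    rw [abs_of_nonpos hx, abs_of_nonpos (by linarith)]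
    linarith

/-- The exponential map does not decrease distances, in a finite form. -/
theorem trace_sub_sq_le {X Y : Matrix (Fin n) (Fin n) ℝ} (hX : X.IsSymm) (hY : Y.IsSymm) :
    ((X - Y) * (X - Y)).trace ≤
      (exp (-X) * exp Y).trace + (exp X * exp (-Y)).trace - 2 * n := by
  obtain ⟨U, x, hU, hU', rfl⟩ := exists_orthogonal_diagonal hX
  obtain ⟨V, y, hV, hV', rfl⟩ := exists_orthogonal_diagonal hY
  have neg (W : Matrix (Fin n) (Fin n) ℝ) (d : Fin n → ℝ) :
      -(W * diagonal d * Wᵀ) = W * diagonal (fun i => - d i) * Wᵀ := by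
    have : diagonal (fun i => -d i) = -diagonal d := (diagonal_neg d).symm
    rw [this, Matrix.mul_neg, Matrix.neg_mul]
  have sq (W : Matrix (Fin n) (Fin n) ℝ) (hW : Wᵀ * W = 1) (d : Fin n → ℝ) :
      (W * diagonal d * Wᵀ) * (W * diagonal d * Wᵀ) = W * diagonal (fun i => d i ^ 2) * Wᵀ := by
    rw [show W * diagonal d * Wᵀ * (W * diagonal d * Wᵀ) = W * diagonal d * (Wᵀ * W) * diagonal d * Wᵀ
      by simp only [Matrix.mul_assoc], hW, Matrix.mul_one, Matrix.mul_assoc W, diagonal_mul_diagonal]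
    simp [pow_two]
  have one (W : Matrix (Fin n) (Fin n) ℝ) (hW : W * Wᵀ = 1) :
      W * Matrix.diagonal (fun _ => (1 : ℝ)) * Wᵀ = 1 := by
    rw [diagonal_one, Matrix.mul_one, hW]
  set A := U * diagonal x * Uᵀ
  set B := V * diagonal y * Vᵀ
  have e1 : ((A - B) * (A - B)).trace = (A * A * 1).trace - 2 * (A * B).trace + (1 * (B * B)).trace := by
    simp only [Matrix.sub_mul, Matrix.mul_sub, trace_sub, Matrix.mul_one, Matrix.one_mul]
    rw [trace_mul_comm B A]
    ring
  have e2 : (n : ℝ) = ((1 : Matrix (Fin n) (Fin n) ℝ) * 1).trace := by simp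
  rw [e1, e2]
  conv_lhs => rw [sq U hU, sq V hV]
  rw [neg, neg, exp_orthogonal_diagonal hU hU', exp_orthogonal_diagonal hU hU',
    exp_orthogonal_diagonal hV hV', exp_orthogonal_diagonal hV hV']
  -- Each identity factor is written in the eigenbasis that its trace still lacks, so that all
  -- traces become double sums with the same weights (UᵀV)ᵢⱼ².
  conv_lhs => rw [← one V hV']
  nth_rw 2 [one V hV']
  rw [← one U hU', trace_conj_diagonal_mul, trace_conj_diagonal_mul]
  nth_rw 3 [one U hU']
  rw [← one V hV']
  simp only [trace_conj_diagonal_mul, Finset.mul_sum, ← Finset.sum_add_distrib,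
    ← Finset.sum_sub_distrib]
  refine Finset.sum_le_sum fun i _ => Finset.sum_le_sum fun j _ => ?_
  have h := sq_le_exp_add_exp_neg (x i - y j)
  rw [show -(x i - y j) = -x i + y j by ring, show x i - y j = x i + -y j by ring, Real.exp_add,
    Real.exp_add] at h
  nlinarith [sq_nonneg ((Uᵀ * V) i j)]

theorem trace_transpose_mul_self_nonneg (X : Matrix (Fin n) (Fin n) ℝ) : 0 ≤ (Xᵀ * X).trace := by
  simp only [trace, diag_apply, mul_apply, transpose_apply]
  exact Finset.sum_nonneg fun i _ => Finset.sum_nonneg fun j _ => mul_self_nonneg _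

theorem trace_sq_nonneg {X : Matrix (Fin n) (Fin n) ℝ} (hX : X.IsSymm) : 0 ≤ (X * X).trace := by
  have := trace_transpose_mul_self_nonneg X
  rwa [hX.eq] at this

theorem sq_apply_le_trace_sq {X : Matrix (Fin n) (Fin n) ℝ} (hX : X.IsSymm) (i j : Fin n) :
    X i j ^ 2 ≤ (X * X).trace := by
  have h : (X * X).trace = (Xᵀ * X).trace := by rw [hX.eq]
  rw [h]
  simp only [trace, diag_apply, mul_apply, transpose_apply]
  calc X i j ^ 2 = X i j * X i j := by ring
    _ ≤ ∑ k, X k j * X k j := Finset.single_le_sum (f := fun k => X k j * X k j)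
      (fun k _ => mul_self_nonneg _) (Finset.mem_univ i)
    _ ≤ _ := Finset.single_le_sum (f := fun l => ∑ k, X k l * X k l)
      (fun l _ => Finset.sum_nonneg fun k _ => mul_self_nonneg _) (Finset.mem_univ j)

theorem eq_zero_of_trace_sq {X : Matrix (Fin n) (Fin n) ℝ} (hX : X.IsSymm)
    (h : (X * X).trace ≤ 0) : X = 0 := by
  ext i j
  have := sq_apply_le_trace_sq hX i j
  rw [Matrix.zero_apply]
  nlinarith [sq_nonneg (X i j)]

/-- Equal exponentials make the right-hand side of `trace_sub_sq_le` vanish. -/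
theorem isSymm_exp_injective {X Y : Matrix (Fin n) (Fin n) ℝ} (hX : X.IsSymm) (hY : Y.IsSymm)
    (h : exp X = exp Y) : X = Y := by
  have h1 := trace_sub_sq_le hX hY
  have hu : IsUnit (exp Y).det := (isUnit_iff_isUnit_det _).1 (isUnit_exp Y)
  rw [Matrix.exp_neg, Matrix.exp_neg, h, nonsing_inv_mul _ hu, mul_nonsing_inv _ hu] at h1
  simp only [trace_one, Fintype.card_fin] at h1
  exact sub_eq_zero.1 (eq_zero_of_trace_sq (hX.sub hY) (by linarith))

theorem posDef_exp {X : Matrix (Fin n) (Fin n) ℝ} (hX : X.IsSymm) : (exp X).PosDef := by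
  have h : exp X = (exp ((1 / 2 : ℝ) • X))ᴴ * exp ((1 / 2 : ℝ) • X) := by
    rw [conjTranspose_eq_transpose_of_trivial, (IsSymm.exp (hX.smul _)).eq,
      ← exp_add_of_commute _ _ (Commute.refl _), ← add_smul]
    norm_num
  rw [h]
  exact Matrix.PosDef.conjTranspose_mul_self _
    (mulVec_injective_of_isUnit (isUnit_exp _))

theorem exists_exp_eq {a : Matrix (Fin n) (Fin n) ℝ} (ha : a.PosDef) :
    ∃ X : Matrix (Fin n) (Fin n) ℝ, X.IsSymm ∧ exp X = a := by
  have hs : a.IsSymm := by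
    have := ha.1
    rwa [IsHermitian, conjTranspose_eq_transpose_of_trivial] at this
  obtain ⟨U, d, hU, hU', h⟩ := exists_orthogonal_diagonal hs
  have hd : ∀ i, 0 < d i := by
    intro i
    have hz : U *ᵥ Pi.single i 1 ≠ 0 := by
      intro h0
      have : Uᵀ *ᵥ (U *ᵥ Pi.single i 1) = 0 := by rw [h0, mulVec_zero]
      rw [mulVec_mulVec, hU, one_mulVec] at this
      have := congrFun this i
      simp at this
    have := ha.dotProduct_mulVec_pos hz
    rw [h] at this
    have e : (U * diagonal d * Uᵀ) *ᵥ (U *ᵥ Pi.single i 1) = d i • (U *ᵥ Pi.single i 1) := by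
      rw [mulVec_mulVec, Matrix.mul_assoc, hU, Matrix.mul_one, ← mulVec_mulVec, diagonal_mulVec_single,
        mul_one, ← mulVec_smul, ← Pi.single_smul, smul_eq_mul, mul_one]
    rw [e, dotProduct_smul, smul_eq_mul, star_trivial, dotProduct_mulVec, ← mulVec_transpose,
      mulVec_mulVec, hU, one_mulVec] at this
    simpa using this
  refine ⟨U * diagonal (fun i => Real.log (d i)) * Uᵀ, ?_, ?_⟩
  · rw [IsSymm]; simp [transpose_mul, Matrix.mul_assoc]
  · rw [exp_orthogonal_diagonal hU hU', h]
    simp only [Real.exp_log (hd _)]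

theorem det_exp_of_isSymm {X : Matrix (Fin n) (Fin n) ℝ} (hX : X.IsSymm) :
    (exp X).det = Real.exp X.trace := by
  obtain ⟨U, d, hU, hU', rfl⟩ := exists_orthogonal_diagonal hX
  have h1 : U.det * Uᵀ.det = 1 := by rw [← det_mul, hU', det_one]
  rw [exp_orthogonal_diagonal hU hU', det_mul, det_mul, det_diagonal, trace_mul_comm,
    ← Matrix.mul_assoc, hU, Matrix.one_mul, trace_diagonal, Real.exp_sum]
  linear_combination (∏ i, Real.exp (d i)) * h1

/-! ### Radius and exponential coordinates. -/

/-- Congruence by S moves the base point SᵀS to the identity. Tensors a₀ exp(a₀⁻¹b) then become Sᵀ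
exp(X) S with X symmetric, where the spectral theorem applies. -/
theorem exists_transpose_mul_self {a : Matrix (Fin n) (Fin n) ℝ} (ha : a.PosDef) :
    ∃ S : Matrix (Fin n) (Fin n) ℝ, IsUnit S ∧ a = Sᵀ * S := by
  obtain ⟨X, hX, rfl⟩ := exists_exp_eq ha
  refine ⟨exp ((1 / 2 : ℝ) • X), isUnit_exp _, ?_⟩
  rw [(IsSymm.exp (hX.smul _)).eq, ← exp_add_of_commute _ _ (Commute.refl _), ← add_smul]
  norm_num

/-- The distance of a positive definite tensor from the singular point. -/
def radius (G a : Matrix (Fin n) (Fin n) ℝ) : ℝ := 4 / √n * √(√(G⁻¹ * a).det)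

/-- The exponential coordinate of `a` at the point `Sᵀ S`. -/
def chart (S a : Matrix (Fin n) (Fin n) ℝ) : Matrix (Fin n) (Fin n) ℝ :=
  open Classical in
  if h : ∃ X : Matrix (Fin n) (Fin n) ℝ, X.IsSymm ∧ a = Sᵀ * exp X * S then h.choose else 0

theorem isSymm_chart (S a : Matrix (Fin n) (Fin n) ℝ) : (chart S a).IsSymm := by
  rw [chart]
  split_ifs with h
  · exact h.choose_spec.1
  · exact isSymm_zero

theorem eq_exp_chart {S a : Matrix (Fin n) (Fin n) ℝ} (hS : IsUnit S) (ha : a.PosDef) :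
    a = Sᵀ * exp (chart S a) * S := by
  have h : ∃ X : Matrix (Fin n) (Fin n) ℝ, X.IsSymm ∧ a = Sᵀ * exp X * S := by
    have hS' : IsUnit S⁻¹ := by
      rw [isUnit_iff_isUnit_det] at *; exact isUnit_nonsing_inv_det _ hS
    have hd := (isUnit_iff_isUnit_det _).1 hS
    obtain ⟨X, hX, h⟩ := exists_exp_eq (ha.conjTranspose_mul_mul_same (B := S⁻¹)
      (mulVec_injective_of_isUnit hS'))
    refine ⟨X, hX, ?_⟩
    rw [h, conjTranspose_eq_transpose_of_trivial, transpose_nonsing_inv]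
    have hd' : IsUnit Sᵀ.det := by rwa [det_transpose]
    simp only [Matrix.mul_assoc]
    rw [nonsing_inv_mul _ hd, Matrix.mul_one, ← Matrix.mul_assoc, mul_nonsing_inv _ hd',
      Matrix.one_mul]
  rw [chart, dif_pos h]
  exact h.choose_spec.2

theorem posDef_chartPoint {S X : Matrix (Fin n) (Fin n) ℝ} (hS : IsUnit S) (hX : X.IsSymm) :
    (Sᵀ * exp X * S).PosDef := by
  have := (posDef_exp hX).conjTranspose_mul_mul_same (mulVec_injective_of_isUnit hS)
  rwa [conjTranspose_eq_transpose_of_trivial] at this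

theorem chart_chartPoint {S X : Matrix (Fin n) (Fin n) ℝ} (hS : IsUnit S) (hX : X.IsSymm) :
    chart S (Sᵀ * exp X * S) = X := by
  refine isSymm_exp_injective (isSymm_chart _ _) hX ?_
  have h := eq_exp_chart hS (posDef_chartPoint hS hX)
  have hd := (isUnit_iff_isUnit_det _).1 hS
  have hS' : IsUnit Sᵀ := by rwa [isUnit_iff_isUnit_det, det_transpose]
  exact (hS'.mul_left_cancel (hS.mul_right_cancel h)).symm

theorem chart_self {S : Matrix (Fin n) (Fin n) ℝ} (hS : IsUnit S) : chart S (Sᵀ * S) = 0 := by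
  have := chart_chartPoint hS (isSymm_zero : (0 : Matrix (Fin n) (Fin n) ℝ).IsSymm)
  rwa [exp_zero, Matrix.mul_one] at this

theorem trace_inv_mul_chartPoint {S : Matrix (Fin n) (Fin n) ℝ} (hS : IsUnit S)
    (X Y : Matrix (Fin n) (Fin n) ℝ) :
    ((Sᵀ * exp X * S)⁻¹ * (Sᵀ * exp Y * S)).trace = (exp (-X) * exp Y).trace := by
  have hd := (isUnit_iff_isUnit_det _).1 hS
  have hd' : IsUnit Sᵀ.det := by rwa [det_transpose]
  rw [Matrix.mul_inv_rev, Matrix.mul_inv_rev, ← Matrix.exp_neg, trace_mul_comm]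
  rw [show Sᵀ * exp Y * S * (S⁻¹ * (exp (-X) * Sᵀ⁻¹)) = Sᵀ * (exp Y * (S * S⁻¹) * exp (-X) * Sᵀ⁻¹)
    by simp only [Matrix.mul_assoc], mul_nonsing_inv _ hd, Matrix.mul_one, trace_mul_comm,
    Matrix.mul_assoc, nonsing_inv_mul _ hd', Matrix.mul_one, trace_mul_comm]

/-- The traces of a⁻¹b and b⁻¹a are invariant under congruence, so the bound does not involve the
base point of the coordinates. -/
theorem trace_chart_sub_sq_le {S a b : Matrix (Fin n) (Fin n) ℝ} (hS : IsUnit S) (ha : a.PosDef)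
    (hb : b.PosDef) :
    ((chart S a - chart S b) * (chart S a - chart S b)).trace ≤
      (a⁻¹ * b).trace + (b⁻¹ * a).trace - 2 * n := by
  have h := trace_sub_sq_le (isSymm_chart S a) (isSymm_chart S b)
  conv_rhs => rw [eq_exp_chart hS ha, eq_exp_chart hS hb]
  rw [trace_inv_mul_chartPoint hS, trace_inv_mul_chartPoint hS,
    trace_mul_comm (exp (-chart S b))]
  exact h

theorem det_pos_of_posDef (hG : G.PosDef) {a : Matrix (Fin n) (Fin n) ℝ} (ha : a.PosDef) :
    0 < (G⁻¹ * a).det := by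
  rw [det_mul]
  exact mul_pos hG.inv.det_pos ha.det_pos

theorem radius_pos (hn : 0 < n) (hG : G.PosDef) {a : Matrix (Fin n) (Fin n) ℝ} (ha : a.PosDef) :
    0 < radius G a := by
  have := det_pos_of_posDef hG ha
  have hn' : (0 : ℝ) < n := by exact_mod_cast hn
  rw [radius]
  positivity

theorem radius_sq (a : Matrix (Fin n) (Fin n) ℝ) :
    radius G a ^ 2 = 16 / n * √(G⁻¹ * a).det := by
  rw [radius, mul_pow, div_pow, Real.sq_sqrt (Nat.cast_nonneg n), Real.sq_sqrt (Real.sqrt_nonneg _)]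
  norm_num

theorem radius_chartPoint {S X : Matrix (Fin n) (Fin n) ℝ} (hX : X.IsSymm) :
    radius G (Sᵀ * exp X * S) = radius G (Sᵀ * S) * Real.exp (X.trace / 4) := by
  have h : (G⁻¹ * (Sᵀ * exp X * S)).det = (G⁻¹ * (Sᵀ * S)).det * Real.exp X.trace := by
    simp only [det_mul, det_exp_of_isSymm hX]
    ring
  have e (x : ℝ) : √(Real.exp x) = Real.exp (x / 2) := by
    rw [Real.exp_half]
  rw [radius, radius, h, Real.sqrt_mul' _ (Real.exp_pos _).le, e,
    Real.sqrt_mul' _ (Real.exp_pos _).le, e]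
  ring_nf

/-- Since det exp X = exp tr X and the radius is a multiple of the fourth root of the determinant,
the trace of the coordinate carries only radial information; all angular information is in the
traceless part. -/
theorem trace_chart (hn : 0 < n) (hG : G.PosDef) {S a : Matrix (Fin n) (Fin n) ℝ} (hS : IsUnit S)
    (ha : a.PosDef) :
    (chart S a).trace = 4 * (Real.log (radius G a) - Real.log (radius G (Sᵀ * S))) := by
  have h := radius_chartPoint (G := G) (S := S) (isSymm_chart S a)
  rw [← eq_exp_chart hS ha] at h
  have hp : (Sᵀ * S).PosDef := by
    simpa using posDef_chartPoint hS (isSymm_zero : (0 : Matrix (Fin n) (Fin n) ℝ).IsSymm)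
  rw [h, Real.log_mul (radius_pos hn hG hp).ne' (Real.exp_pos _).ne', Real.log_exp]
  ring

/-! ### Development into the plane. -/

/-- The map of the fiber to the plane, with the radius and the value of `φ` in
exponential coordinates as polar coordinates. -/
def develop (G S : Matrix (Fin n) (Fin n) ℝ) (φ : Matrix (Fin n) (Fin n) ℝ → ℝ)
    (a : Matrix (Fin n) (Fin n) ℝ) : ℂ :=
  radius G a * Complex.exp (φ (chart S a) * Complex.I)

theorem norm_polar_sub_sq (r s x y : ℝ) :
    ‖(r * Complex.exp (x * Complex.I) - s * Complex.exp (y * Complex.I) : ℂ)‖ ^ 2 =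
      r ^ 2 + s ^ 2 - 2 * r * s * Real.cos (x - y) := by
  rw [← Complex.normSq_eq_norm_sq, Complex.normSq_apply, Complex.exp_mul_I, Complex.exp_mul_I,
    ← Complex.ofReal_cos, ← Complex.ofReal_sin, ← Complex.ofReal_cos, ← Complex.ofReal_sin,
    Real.cos_sub]
  simp only [Complex.sub_re, Complex.sub_im, Complex.mul_re, Complex.mul_im, Complex.add_re,
    Complex.add_im, Complex.ofReal_re, Complex.ofReal_im, Complex.I_re, Complex.I_im]
  linear_combination r ^ 2 * Real.sin_sq_add_cos_sq x + s ^ 2 * Real.sin_sq_add_cos_sq y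

/-- The functions of symmetric matrices which do not increase the (scaled) Frobenius distance
of traceless parts. -/
def IsShort (φ : Matrix (Fin n) (Fin n) ℝ → ℝ) : Prop :=
  ∀ X Y : Matrix (Fin n) (Fin n) ℝ, X.IsSymm → Y.IsSymm →
    (φ X - φ Y) ^ 2 ≤ n / 16 * (((X - Y) * (X - Y)).trace - (X.trace - Y.trace) ^ 2 / n)

/-- An upper bound for the squared distance of developed points. -/
def quasi (G a b : Matrix (Fin n) (Fin n) ℝ) : ℝ :=
  (radius G b - radius G a) ^ 2 + radius G a * radius G b * (n / 16) *
    ((a⁻¹ * (b - a) * b⁻¹ * (b - a)).trace -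
      (4 * (Real.log (radius G b) - Real.log (radius G a))) ^ 2 / n)

theorem isUnit_det_of_posDef {a : Matrix (Fin n) (Fin n) ℝ} (ha : a.PosDef) : IsUnit a.det :=
  isUnit_iff_ne_zero.2 ha.det_pos.ne'

/-- `quasi` uses the form quadratic in b − a, which can be divided by the square of the time step,
whereas the comparison of exponentials yields the traces of a⁻¹b and b⁻¹a. This identity links the
two. -/
theorem trace_quadratic {a b : Matrix (Fin n) (Fin n) ℝ} (ha : a.PosDef)
    (hb : b.PosDef) : (a⁻¹ * (b - a) * b⁻¹ * (b - a)).trace =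
      (a⁻¹ * b).trace + (b⁻¹ * a).trace - 2 * n := by
  have h : a⁻¹ * (b - a) * b⁻¹ * (b - a) = a⁻¹ * b - 1 - 1 + b⁻¹ * a := by
    have h1 := nonsing_inv_mul _ (isUnit_det_of_posDef ha)
    have h2 := mul_nonsing_inv _ (isUnit_det_of_posDef hb)
    have h3 := nonsing_inv_mul _ (isUnit_det_of_posDef hb)
    calc _ = a⁻¹ * (b * b⁻¹) * b - a⁻¹ * (b * b⁻¹) * a - a⁻¹ * a * (b⁻¹ * b) +
          a⁻¹ * a * (b⁻¹ * a) := by noncomm_ring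
      _ = _ := by rw [h1, h2, h3, Matrix.mul_one, Matrix.one_mul, Matrix.one_mul, h1]
  rw [h]
  simp only [trace_add, trace_sub, trace_one, Fintype.card_fin]
  ring

/-- In the planar law of cosines, 1 − cos x ≤ x²/2 bounds the angular term by the squared increment
of φ. Shortness of φ and `trace_chart_sub_sq_le` bound that increment in turn. -/
theorem norm_develop_sub_sq_le (hn : 0 < n) (hG : G.PosDef) {S : Matrix (Fin n) (Fin n) ℝ}
    (hS : IsUnit S) {φ : Matrix (Fin n) (Fin n) ℝ → ℝ} (hφ : IsShort φ)
    {a b : Matrix (Fin n) (Fin n) ℝ} (ha : a.PosDef) (hb : b.PosDef) :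
    ‖develop G S φ b - develop G S φ a‖ ^ 2 ≤ quasi G a b := by
  rw [develop, develop, norm_polar_sub_sq, quasi, trace_quadratic ha hb]
  have h1 := trace_chart_sub_sq_le hS ha hb
  have h2 := hφ _ _ (isSymm_chart S a) (isSymm_chart S b)
  rw [trace_chart hn hG hS ha, trace_chart hn hG hS hb] at h2
  have hn' : (0 : ℝ) < n := by exact_mod_cast hn
  have h3 := Real.one_sub_sq_div_two_le_cos (x := φ (chart S b) - φ (chart S a))
  have hr := mul_pos (radius_pos hn hG ha) (radius_pos hn hG hb)
  set T := (a⁻¹ * b).trace + (b⁻¹ * a).trace - 2 * (n : ℝ)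
  set l := Real.log (radius G b) - Real.log (radius G a)
  have h4 : (φ (chart S b) - φ (chart S a)) ^ 2 ≤ n / 16 * (T - (4 * l) ^ 2 / n) := by
    calc _ = (φ (chart S a) - φ (chart S b)) ^ 2 := by ring
      _ ≤ _ := h2
      _ ≤ _ := by
        refine mul_le_mul_of_nonneg_left ?_ (by positivity)
        have : (4 * (Real.log (radius G a) - Real.log (radius G (Sᵀ * S))) -
          4 * (Real.log (radius G b) - Real.log (radius G (Sᵀ * S)))) ^ 2 = (4 * l) ^ 2 := by
          simp only [l]; ring
        rw [this]
        linarith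
  nlinarith [mul_le_mul_of_nonneg_left h3 hr.le, mul_le_mul_of_nonneg_left h4 hr.le]

/-! ### Calculus of matrix curves and the Lipschitz bound for the development. -/

section

open scoped Matrix.Norms.Operator

/-- `velocity` and `IsCurve` are entrywise, while the rules for products, inverses and exponentials
live in the normed algebra of matrices; this passes between the two. -/
theorem hasDerivWithinAt_matrix {γ : ℝ → Matrix (Fin n) (Fin n) ℝ} {V : Matrix (Fin n) (Fin n) ℝ}
    {s : Set ℝ} {t : ℝ} :
    HasDerivWithinAt γ V s t ↔ ∀ i j, HasDerivWithinAt (fun x => γ x i j) (V i j) s t := by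
  constructor
  · intro h i j
    let L : Matrix (Fin n) (Fin n) ℝ →L[ℝ] ℝ :=
      LinearMap.toContinuousLinearMap (Matrix.entryLinearMap ℝ ℝ i j)
    exact L.hasFDerivAt.comp_hasDerivWithinAt t h
  · intro h
    have e : γ = fun x => ∑ i, ∑ j, γ x i j • single i j (1 : ℝ) := by
      funext x
      conv_lhs => rw [matrix_eq_sum_single (γ x)]
      simp
    have e' : V = ∑ i, ∑ j, V i j • single i j (1 : ℝ) := by
      conv_lhs => rw [matrix_eq_sum_single V]
      simp
    rw [e, e']
    exact HasDerivWithinAt.fun_sum fun i _ => HasDerivWithinAt.fun_sum fun j _ =>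
      (h i j).smul_const _

theorem continuousOn_matrix {γ : ℝ → Matrix (Fin n) (Fin n) ℝ} {s : Set ℝ} :
    ContinuousOn γ s ↔ ∀ i j, ContinuousOn (fun x => γ x i j) s := by
  constructor
  · intro h i j
    exact (continuous_id.matrix_elem i j).comp_continuousOn h
  · intro h t ht
    exact tendsto_pi_nhds.2 fun i => tendsto_pi_nhds.2 fun j => h i j t ht

theorem continuousAt_inv {a : Matrix (Fin n) (Fin n) ℝ} (ha : IsUnit a) :
    ContinuousAt (fun x : Matrix (Fin n) (Fin n) ℝ => x⁻¹) a := by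
  obtain ⟨u, rfl⟩ := ha
  simp only [nonsing_inv_eq_ringInverse]
  exact (hasFDerivAt_ringInverse (𝕜 := ℝ) u).continuousAt

theorem hasDerivWithinAt_inv {γ : ℝ → Matrix (Fin n) (Fin n) ℝ} {V : Matrix (Fin n) (Fin n) ℝ}
    {s : Set ℝ} {t : ℝ} (h : HasDerivWithinAt γ V s t) (hu : IsUnit (γ t)) :
    HasDerivWithinAt (fun x => (γ x)⁻¹) (-((γ t)⁻¹ * V * (γ t)⁻¹)) s t := by
  obtain ⟨u, hu⟩ := hu
  simp only [nonsing_inv_eq_ringInverse]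
  have h1 := hasFDerivAt_ringInverse (𝕜 := ℝ) u
  rw [hu] at h1
  have h2 := h1.comp_hasDerivWithinAt t h
  refine h2.congr_deriv ?_
  rw [← hu]
  simp

theorem differentiable_det : Differentiable ℝ (fun a : Matrix (Fin n) (Fin n) ℝ => a.det) := by
  have : ∀ i j, Differentiable ℝ (fun a : Matrix (Fin n) (Fin n) ℝ => a i j) := fun i j =>
    (LinearMap.toContinuousLinearMap (Matrix.entryLinearMap ℝ ℝ i j)).differentiable
  simp only [det_apply]
  fun_prop

theorem IsCurve.velocity_hasDerivWithinAt {k : ℕ} (hk : 1 ≤ k)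
    {γ : ℝ → Matrix (Fin n) (Fin n) ℝ} (h : IsCurve k γ)
    {t : ℝ} (ht : t ∈ Icc (0 : ℝ) 1) : HasDerivWithinAt γ (velocity γ t) (Icc 0 1) t := by
  refine hasDerivWithinAt_matrix.2 fun i j => ?_
  have := ((h.contDiffOn i j).differentiableOn (by exact_mod_cast (by omega : k ≠ 0)) t ht)
  exact this.hasDerivWithinAt

theorem IsCurve.continuousOn {k : ℕ} {γ : ℝ → Matrix (Fin n) (Fin n) ℝ} (h : IsCurve k γ) :
    ContinuousOn γ (Icc 0 1) :=
  continuousOn_matrix.2 fun i j => (h.contDiffOn i j).continuousOn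

theorem IsCurve.continuousOn_velocity {k : ℕ} (hk : 1 ≤ k)
    {γ : ℝ → Matrix (Fin n) (Fin n) ℝ} (h : IsCurve k γ) :
    ContinuousOn (velocity γ) (Icc 0 1) :=
  continuousOn_matrix.2 fun i j => (h.contDiffOn i j).continuousOn_derivWithin
    (uniqueDiffOn_Icc zero_lt_one) (by exact_mod_cast hk)

theorem IsCurve.continuousOn_inv {k : ℕ} {γ : ℝ → Matrix (Fin n) (Fin n) ℝ} (h : IsCurve k γ) :
    ContinuousOn (fun t => (γ t)⁻¹) (Icc 0 1) := fun t ht =>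
  (continuousAt_inv (h.posDef t ht).isUnit).comp_continuousWithinAt (h.continuousOn t ht)

theorem continuous_det_inv_mul (G : Matrix (Fin n) (Fin n) ℝ) :
    Continuous (fun a : Matrix (Fin n) (Fin n) ℝ => (G⁻¹ * a).det) :=
  (continuous_const.mul continuous_id).matrix_det

theorem IsCurve.continuousOn_speed {k : ℕ} (hk : 1 ≤ k) (G : Matrix (Fin n) (Fin n) ℝ)
    {γ : ℝ → Matrix (Fin n) (Fin n) ℝ} (h : IsCurve k γ) :
    ContinuousOn (fun t => √(metric G (γ t) (velocity γ t) (velocity γ t))) (Icc 0 1) := by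
  have h1 := h.continuousOn_inv
  have h2 := h.continuousOn_velocity hk
  have h3 := (continuous_det_inv_mul G).comp_continuousOn h.continuousOn
  refine ContinuousOn.sqrt (ContinuousOn.mul ?_ h3.sqrt)
  exact (continuous_id.matrix_trace).comp_continuousOn (((h1.mul h2).mul h1).mul h2)

theorem continuous_radius : Continuous (radius G) :=
  continuous_const.mul (continuous_det_inv_mul G).sqrt.sqrt

theorem differentiableAt_radius (hG : G.PosDef) {a : Matrix (Fin n) (Fin n) ℝ} (ha : a.PosDef) :
    DifferentiableAt ℝ (radius G) a := by
  have h := det_pos_of_posDef hG ha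
  have h1 : DifferentiableAt ℝ (fun a : Matrix (Fin n) (Fin n) ℝ => (G⁻¹ * a).det) a := by
    refine (differentiable_det (G⁻¹ * a)).comp a ?_
    fun_prop
  exact (differentiableAt_const _).mul ((h1.sqrt h.ne').sqrt (Real.sqrt_pos.2 h).ne')

theorem continuousAt_quasi (hn : 0 < n) (hG : G.PosDef) {a : Matrix (Fin n) (Fin n) ℝ}
    (ha : a.PosDef) : ContinuousAt (quasi G a) a := by
  have h1 : ContinuousAt (radius G) a := continuous_radius.continuousAt
  have h2 := continuousAt_inv ha.isUnit
  have h3 := h1.log (radius_pos hn hG ha).ne'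
  have h4 : ContinuousAt (fun b => (a⁻¹ * (b - a) * b⁻¹ * (b - a)).trace) a := by
    refine (continuous_id.matrix_trace).continuousAt.comp ?_
    exact ((continuousAt_const.mul (continuousAt_id.sub continuousAt_const)).mul h2).mul
      (continuousAt_id.sub continuousAt_const)
  unfold quasi
  fun_prop

theorem quasi_self (a : Matrix (Fin n) (Fin n) ℝ) : quasi G a a = 0 := by
  simp [quasi]

/-- Dividing by (z − t)² turns all differences into slopes, and the limit is the metric in its cone
form dr² + r²·(n/16)·(tr(a⁻¹Va⁻¹V) − (4 dr/r)²/n). -/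
theorem tendsto_quasi_div_sq (hn : 0 < n) (hG : G.PosDef) {γ : ℝ → Matrix (Fin n) (Fin n) ℝ}
    {V : Matrix (Fin n) (Fin n) ℝ} {t : ℝ} (h : HasDerivWithinAt γ V (Ioi t) t)
    (ht : (γ t).PosDef) :
    Tendsto (fun z => quasi G (γ t) (γ z) / (z - t) ^ 2) (𝓝[>] t) (𝓝 (metric G (γ t) V V)) := by
  have hr := ((differentiableAt_radius hG ht).hasFDerivAt.comp_hasDerivWithinAt t h)
  set r' := fderiv ℝ (radius G) (γ t) V
  have hl := hr.log (radius_pos hn hG ht).ne'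
  have hc := h.continuousWithinAt
  have h := (hasDerivWithinAt_iff_tendsto_slope' (by simp)).1 h
  rw [hasDerivWithinAt_iff_tendsto_slope' (by simp)] at hr hl
  have h1 : Tendsto (fun z => (γ z)⁻¹) (𝓝[>] t) (𝓝 (γ t)⁻¹) :=
    (continuousAt_inv ht.isUnit).tendsto.comp hc
  have h2 : Tendsto (fun z => radius G (γ z)) (𝓝[>] t) (𝓝 (radius G (γ t))) :=
    continuous_radius.continuousAt.tendsto.comp hc
  have h3 : Tendsto (fun z => ((γ t)⁻¹ * slope γ t z * (γ z)⁻¹ * slope γ t z).trace) (𝓝[>] t)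
      (𝓝 ((γ t)⁻¹ * V * (γ t)⁻¹ * V).trace) :=
    (continuous_id.matrix_trace).continuousAt.tendsto.comp
      (((tendsto_const_nhds.mul h).mul h1).mul h)
  have h4 := (hr.pow 2).add (((tendsto_const_nhds (x := radius G (γ t))).mul
    (h2.mul_const ((n : ℝ) / 16))).mul
    (h3.sub (((hl.const_mul 4).pow 2).div_const (n : ℝ))))
  have e : metric G (γ t) V V = r' ^ 2 + radius G (γ t) * (radius G (γ t) * (n / 16)) *
      (((γ t)⁻¹ * V * (γ t)⁻¹ * V).trace - (4 * (r' / radius G (γ t))) ^ 2 / n) := by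
    have h5 := radius_sq (G := G) (γ t)
    have h6 := radius_pos hn hG ht
    have hn' : (0 : ℝ) < n := by exact_mod_cast hn
    rw [metric, tr₂]
    set R := radius G (γ t)
    set T := ((γ t)⁻¹ * V * (γ t)⁻¹ * V).trace
    have : √(G⁻¹ * γ t).det = n / 16 * R ^ 2 := by rw [h5]; field_simp
    rw [this]
    field_simp
    ring
  rw [e]
  refine h4.congr' ?_
  filter_upwards [self_mem_nhdsWithin] with z hz
  have hz' : z - t ≠ 0 := sub_ne_zero.2 (ne_of_gt hz)
  have h7 : (γ t)⁻¹ * slope γ t z * (γ z)⁻¹ * slope γ t z =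
      ((z - t) ^ 2)⁻¹ • ((γ t)⁻¹ * (γ z - γ t) * (γ z)⁻¹ * (γ z - γ t)) := by
    simp only [slope_def_module, Matrix.mul_smul, Matrix.smul_mul, smul_smul]
    rw [pow_two, mul_inv]
  rw [h7, trace_smul, quasi, slope_def_field, slope_def_field, smul_eq_mul]
  simp only [Function.comp]
  field_simp

/-- The development need not be differentiable, since φ will be a clamped function. The comparison
is therefore one of right upper slopes, which `quasi` bounds by the speed. -/
theorem norm_develop_sub_le_length (hn : 0 < n) (hG : G.PosDef) {S : Matrix (Fin n) (Fin n) ℝ}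
    (hS : IsUnit S) {φ : Matrix (Fin n) (Fin n) ℝ → ℝ} (hφ : IsShort φ)
    {γ : ℝ → Matrix (Fin n) (Fin n) ℝ} (hγ : IsCurve 1 γ) :
    ‖develop G S φ (γ 1) - develop G S φ (γ 0)‖ ≤ length G γ := by
  set v : ℝ → ℝ := fun t => √(metric G (γ t) (velocity γ t) (velocity γ t)) with hv
  -- The speed is controlled only on [0,1]; its constant extension is continuous on ℝ, so its
  -- primitive is differentiable at the end points as well.
  set w : ℝ → ℝ := IccExtend (zero_le_one (α := ℝ)) ((Icc (0 : ℝ) 1).domRestrict v) with hw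
  have hwv : ∀ t ∈ Icc (0 : ℝ) 1, w t = v t := fun t ht => by
    rw [hw, IccExtend_of_mem _ _ ht, domRestrict_apply]
  have hwc : Continuous w :=
    (continuousOn_iff_continuous_domRestrict.1 (hγ.continuousOn_speed le_rfl G)).Icc_extend'
  have hlen : length G γ = ∫ t in (0 : ℝ)..1, w t := by
    refine intervalIntegral.integral_congr fun t ht => ?_
    rw [uIcc_of_le zero_le_one] at ht
    exact (hwv t ht).symm
  have hstep : ∀ x ∈ Icc (0 : ℝ) 1, ∀ z ∈ Icc (0 : ℝ) 1,
      ‖develop G S φ (γ z) - develop G S φ (γ x)‖ ≤ √(quasi G (γ x) (γ z)) := fun x hx z hz =>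
    Real.le_sqrt_of_sq_le (norm_develop_sub_sq_le hn hG hS hφ (hγ.posDef x hx) (hγ.posDef z hz))
  -- The chart is defined by choice; continuity is read off from the two-point bound, since `quasi`
  -- is continuous and vanishes on the diagonal.
  have hcont : ContinuousOn (fun t => develop G S φ (γ t)) (Icc 0 1) := by
    intro x hx
    have h1 : ContinuousWithinAt (fun z => √(quasi G (γ x) (γ z))) (Icc 0 1) x :=
      ((continuousAt_quasi hn hG (hγ.posDef x hx)).comp_continuousWithinAt
        (hγ.continuousOn x hx)).sqrt
    have h2 : Tendsto (fun z => √(quasi G (γ x) (γ z))) (𝓝[Icc 0 1] x) (𝓝 0) := by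
      have := h1.tendsto
      rwa [quasi_self, Real.sqrt_zero] at this
    refine tendsto_iff_norm_sub_tendsto_zero.2 (squeeze_zero' (Eventually.of_forall fun _ =>
      norm_nonneg _) ?_ h2)
    filter_upwards [self_mem_nhdsWithin] with z hz using hstep x hx z hz
  rw [hlen]
  refine image_le_of_liminf_slope_right_le_deriv_boundary
    (f := fun t => ‖develop G S φ (γ t) - develop G S φ (γ 0)‖)
    (B := fun t => ∫ s in (0 : ℝ)..t, w s) (B' := w) (a := 0) (b := 1)
    (hcont.sub continuousOn_const).norm (by simp) ?_ ?_ ?_ (right_mem_Icc.2 zero_le_one)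
  · exact (intervalIntegral.continuous_primitive (fun _ _ => hwc.intervalIntegrable _ _) 0).continuousOn
  · exact fun x _ => (hwc.integral_hasStrictDerivAt 0 x).hasDerivAt.hasDerivWithinAt
  · intro x hx r hr
    have hx' : x ∈ Icc (0 : ℝ) 1 := Ico_subset_Icc_self hx
    have hd : HasDerivWithinAt γ (velocity γ x) (Ioi x) x :=
      (hγ.velocity_hasDerivWithinAt le_rfl hx').mono_of_mem_nhdsWithin
        (mem_of_superset (Ioc_mem_nhdsGT hx.2) fun y hy => ⟨hx.1.trans hy.1.le, hy.2⟩)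
    have hlim := (tendsto_quasi_div_sq hn hG hd (hγ.posDef x hx')).sqrt
    rw [hwv x hx'] at hr
    refine Eventually.frequently ?_
    filter_upwards [hlim.eventually_lt_const hr, Ioc_mem_nhdsGT hx.2] with z hz hz'
    have hzx : 0 < z - x := sub_pos.2 hz'.1
    refine lt_of_le_of_lt ?_ hz
    rw [Real.sqrt_div' _ (sq_nonneg _), Real.sqrt_sq hzx.le, slope_def_field]
    refine div_le_div_of_nonneg_right ?_ hzx.le
    refine le_trans ?_ (hstep x hx' z ⟨hx.1.trans hz'.1.le, hz'.2⟩)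
    have := norm_sub_norm_le (develop G S φ (γ z) - develop G S φ (γ 0))
      (develop G S φ (γ x) - develop G S φ (γ 0))
    simpa using this

theorem norm_develop_sub_le_dist (hn : 0 < n) (hG : G.PosDef) {S : Matrix (Fin n) (Fin n) ℝ}
    (hS : IsUnit S) {φ : Matrix (Fin n) (Fin n) ℝ → ℝ} (hφ : IsShort φ) (a b : Fiber G) :
    ‖develop G S φ b.val - develop G S φ a.val‖ ≤ dist a b := by
  refine le_csInf (exists_joins a b) fun L hL => ?_
  induction hL with
  | refl => simp
  | cons γ hγ a b c h₀ h₁ L h ih =>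
    have h2 := norm_develop_sub_le_length hn hG hS hφ hγ
    rw [h₀, h₁] at h2
    calc _ = ‖(develop G S φ c.val - develop G S φ b.val) +
          (develop G S φ b.val - develop G S φ a.val)‖ := by congr 1; ring
      _ ≤ _ := norm_add_le _ _
      _ ≤ _ := by linarith

/-! ### The geodesic equation. -/

/-- Factoring out det a leaves det(1 + ε a⁻¹V), a polynomial in ε whose part of order at least two
is ε² times its twofold `divX`. -/
theorem hasDerivAt_det_line (a V : Matrix (Fin n) (Fin n) ℝ) (ha : IsUnit a.det) :
    HasDerivAt (fun ε : ℝ => (a + ε • V).det) (a.det * (a⁻¹ * V).trace) 0 := by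
  have e : (fun ε : ℝ => (a + ε • V).det) = fun ε : ℝ => a.det * (1 + (a⁻¹ * V).trace * ε +
      (det (1 + (Polynomial.X : Polynomial ℝ) • (a⁻¹ * V).map Polynomial.C)).divX.divX.eval ε
        * ε ^ 2) := by
    funext ε
    rw [← det_one_add_smul, ← det_mul]
    congr 1
    rw [Matrix.mul_add, Matrix.mul_one, Matrix.mul_smul, ← Matrix.mul_assoc, mul_nonsing_inv _ ha,
      Matrix.one_mul]
  rw [e]
  refine HasDerivAt.const_mul _ ?_
  have h1 := ((hasDerivAt_id (0 : ℝ)).const_mul (a⁻¹ * V).trace).const_add 1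
  have h2 := (Polynomial.hasDerivAt
    (det (1 + (Polynomial.X : Polynomial ℝ) • (a⁻¹ * V).map Polynomial.C)).divX.divX 0).mul
    ((hasDerivAt_id (0 : ℝ)).pow 2)
  exact (h1.add h2).congr_deriv (by simp)

theorem hasDerivAt_line (a V : Matrix (Fin n) (Fin n) ℝ) :
    HasDerivAt (fun ε : ℝ => a + ε • V) V 0 :=
  HasDerivAt.congr_deriv (((hasDerivAt_id (0 : ℝ)).smul_const V).const_add a) (one_smul ℝ V)

/-- The determinant is already known to be differentiable, so its derivative may be computed along
the straight line with direction V. -/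
theorem hasDerivWithinAt_det {γ : ℝ → Matrix (Fin n) (Fin n) ℝ} {V : Matrix (Fin n) (Fin n) ℝ}
    {s : Set ℝ} {t : ℝ} (h : HasDerivWithinAt γ V s t) (hu : IsUnit (γ t).det) :
    HasDerivWithinAt (fun x => (γ x).det) ((γ t).det * ((γ t)⁻¹ * V).trace) s t := by
  have h1 := (differentiable_det (γ t)).hasFDerivAt
  refine (h1.comp_hasDerivWithinAt t h).congr_deriv ?_
  have h2 := hasDerivAt_line (γ t) V
  have h3 : HasFDerivAt (fun a : Matrix (Fin n) (Fin n) ℝ => a.det)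
      (fderiv ℝ (fun a : Matrix (Fin n) (Fin n) ℝ => a.det) (γ t)) (γ t + (0 : ℝ) • V) := by
    rwa [zero_smul, add_zero]
  exact (h3.comp_hasDerivAt (0 : ℝ) h2).unique (hasDerivAt_det_line (γ t) V hu)

theorem hasDerivWithinAt_density (hG : G.PosDef) {γ : ℝ → Matrix (Fin n) (Fin n) ℝ}
    {V : Matrix (Fin n) (Fin n) ℝ}
    {s : Set ℝ} {t : ℝ} (h : HasDerivWithinAt γ V s t) (ht : (γ t).PosDef) :
    HasDerivWithinAt (fun x => √(G⁻¹ * γ x).det)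
      (√(G⁻¹ * γ t).det * (((γ t)⁻¹ * V).trace / 2)) s t := by
  have h1 := (hasDerivWithinAt_det h (isUnit_det_of_posDef ht)).const_mul (G⁻¹).det
  simp only [det_mul]
  refine (h1.sqrt (mul_pos hG.inv.det_pos ht.det_pos).ne').congr_deriv ?_
  have h2 := Real.sqrt_pos.2 (mul_pos hG.inv.det_pos ht.det_pos)
  have h3 := Real.mul_self_sqrt (mul_pos hG.inv.det_pos ht.det_pos).le
  field_simp
  rw [pow_two, h3]
  ring

theorem IsSymm_of_posDef {a : Matrix (Fin n) (Fin n) ℝ} (ha : a.PosDef) : a.IsSymm := by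
  have := ha.1
  rwa [IsHermitian, conjTranspose_eq_transpose_of_trivial] at this

theorem hasDerivWithinAt_trace {γ : ℝ → Matrix (Fin n) (Fin n) ℝ} {V : Matrix (Fin n) (Fin n) ℝ}
    {s : Set ℝ} {t : ℝ} (h : HasDerivWithinAt γ V s t) :
    HasDerivWithinAt (fun x => (γ x).trace) V.trace s t :=
  (LinearMap.toContinuousLinearMap (Matrix.traceLinearMap (Fin n) ℝ ℝ)).hasFDerivAt.comp_hasDerivWithinAt
    t h

theorem isSymm_of_hasDerivWithinAt {γ : ℝ → Matrix (Fin n) (Fin n) ℝ}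
    {V : Matrix (Fin n) (Fin n) ℝ} {t : ℝ} (h : HasDerivWithinAt γ V (Icc 0 1) t)
    (ht : t ∈ Icc (0 : ℝ) 1) (hs : ∀ x ∈ Icc (0 : ℝ) 1, (γ x).IsSymm) : V.IsSymm := by
  ext i j
  rw [transpose_apply]
  have h1 := hasDerivWithinAt_matrix.1 h j i
  have h2 := hasDerivWithinAt_matrix.1 h i j
  have h3 := h2.congr (f₁ := fun x => γ x j i) (fun x hx => (hs x hx).apply i j)
    ((hs t ht).apply i j)
  exact (uniqueDiffOn_Icc zero_lt_one t ht).eq_deriv _ h1 h3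

theorem IsCurve.isSymm_velocity {k : ℕ} (hk : 1 ≤ k) {γ : ℝ → Matrix (Fin n) (Fin n) ℝ}
    (h : IsCurve k γ) {t : ℝ} (ht : t ∈ Icc (0 : ℝ) 1) : (velocity γ t).IsSymm :=
  isSymm_of_hasDerivWithinAt (h.velocity_hasDerivWithinAt hk ht) ht
    fun x hx => IsSymm_of_posDef (h.posDef x hx)

theorem IsCurve.exists_acceleration {γ : ℝ → Matrix (Fin n) (Fin n) ℝ}
    (h : IsCurve 2 γ) {t : ℝ} (ht : t ∈ Icc (0 : ℝ) 1) :
    ∃ W : Matrix (Fin n) (Fin n) ℝ, W.IsSymm ∧ HasDerivWithinAt (velocity γ) W (Icc 0 1) t := by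
  have h1 : HasDerivWithinAt (velocity γ)
      (Matrix.of fun i j => derivWithin (fun s => velocity γ s i j) (Icc 0 1) t) (Icc 0 1) t := by
    refine hasDerivWithinAt_matrix.2 fun i j => ?_
    have := (h.contDiffOn i j).derivWithin (m := 1) (uniqueDiffOn_Icc zero_lt_one) (by norm_num)
    exact (this.differentiableOn one_ne_zero t ht).hasDerivWithinAt
  exact ⟨_, isSymm_of_hasDerivWithinAt h1 ht fun x hx => h.isSymm_velocity (by norm_num) hx, h1⟩

/-- The defect of the geodesic equation at one parameter. -/
theorem geodesic_defect (hG : G.PosDef) {γ : ℝ → Matrix (Fin n) (Fin n) ℝ}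
    (h : IsCurve 2 γ) {t : ℝ} (ht : t ∈ Icc (0 : ℝ) 1) {W : Matrix (Fin n) (Fin n) ℝ}
    (hW : HasDerivWithinAt (velocity γ) W (Icc 0 1) t) (c : Matrix (Fin n) (Fin n) ℝ) :
    derivWithin (fun s => metric G (γ s) (velocity γ s) c) (Icc 0 1) t -
      (1 / 2) * deriv (fun ε : ℝ => metric G (γ t + ε • c) (velocity γ t) (velocity γ t)) 0 =
    √(G⁻¹ * γ t).det * ((-((γ t)⁻¹ * velocity γ t * (γ t)⁻¹) * velocity γ t + (γ t)⁻¹ * W +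
      ((1 / 2) * ((γ t)⁻¹ * velocity γ t).trace) • ((γ t)⁻¹ * velocity γ t) -
      ((1 / 4) * ((γ t)⁻¹ * velocity γ t * ((γ t)⁻¹ * velocity γ t)).trace) • 1) *
        (γ t)⁻¹ * c).trace := by
  have hV := h.velocity_hasDerivWithinAt (by norm_num) ht
  have hp := h.posDef t ht
  have hi := hasDerivWithinAt_inv hV hp.isUnit
  have hl : HasDerivWithinAt (fun s => metric G (γ s) (velocity γ s) c) _ (Icc 0 1) t :=
    (hasDerivWithinAt_trace (((hi.mul hW).mul hi).mul_const c)).mul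
      (hasDerivWithinAt_density hG hV hp)
  have hc : HasDerivWithinAt (fun ε : ℝ => γ t + ε • c) c univ 0 :=
    (hasDerivAt_line (γ t) c).hasDerivWithinAt
  have e0 : γ t + (0 : ℝ) • c = γ t := by simp
  have hci := hasDerivWithinAt_inv hc (by rw [e0]; exact hp.isUnit)
  have hr : HasDerivWithinAt (fun ε : ℝ => metric G (γ t + ε • c) (velocity γ t) (velocity γ t)) _
      univ 0 :=
    (hasDerivWithinAt_trace (((hci.mul_const (velocity γ t)).mul hci).mul_const (velocity γ t))).mul
      (hasDerivWithinAt_density hG hc (by rw [e0]; exact hp))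
  rw [hl.derivWithin (uniqueDiffOn_Icc zero_lt_one t ht), (hasDerivWithinAt_univ.1 hr).deriv]
  simp only [Pi.mul_apply, e0]
  set i := (γ t)⁻¹
  set V := velocity γ t
  have c1 : (i * c * i * V * i * V).trace = (i * V * i * V * i * c).trace := by
    rw [show i * c * i * V * i * V = (i * c) * (i * V * i * V) by simp only [Matrix.mul_assoc],
      trace_mul_comm]
    simp only [Matrix.mul_assoc]
  have c2 : (i * V * i * c * i * V).trace = (i * V * i * V * i * c).trace := by
    rw [show i * V * i * c * i * V = (i * V * i * c) * (i * V) by simp only [Matrix.mul_assoc],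
      trace_mul_comm]
    simp only [Matrix.mul_assoc]
  simp only [Matrix.add_mul, Matrix.sub_mul, Matrix.neg_mul, Matrix.mul_neg, Matrix.smul_mul,
    trace_add, trace_sub,
    trace_neg, trace_smul, smul_eq_mul, Matrix.one_mul, ← Matrix.mul_assoc, c1, c2]
  ring

/-- The geodesic equation, for the logarithmic velocity `γ⁻¹ γ'`. -/
theorem isRiemannianGeodesic_iff (hG : G.PosDef) {γ : ℝ → Matrix (Fin n) (Fin n) ℝ}
    (h : IsCurve 2 γ) : IsRiemannianGeodesic G γ ↔ ∀ t ∈ Icc (0 : ℝ) 1,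
      HasDerivWithinAt (fun s => (γ s)⁻¹ * velocity γ s)
        (((1 / 4) * ((γ t)⁻¹ * velocity γ t * ((γ t)⁻¹ * velocity γ t)).trace) • 1 -
          ((1 / 2) * ((γ t)⁻¹ * velocity γ t).trace) • ((γ t)⁻¹ * velocity γ t)) (Icc 0 1) t := by
  constructor
  · intro hg t ht
    obtain ⟨W, hWs, hW⟩ := h.exists_acceleration ht
    have hp := h.posDef t ht
    have hVs := h.isSymm_velocity (by norm_num) ht
    have his : ((γ t)⁻¹).IsSymm := IsSymm_of_posDef hp.inv
    have hA := (hasDerivWithinAt_inv (h.velocity_hasDerivWithinAt (by norm_num) ht) hp.isUnit).mul hW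
    set N := (-((γ t)⁻¹ * velocity γ t * (γ t)⁻¹) * velocity γ t + (γ t)⁻¹ * W +
      ((1 / 2) * ((γ t)⁻¹ * velocity γ t).trace) • ((γ t)⁻¹ * velocity γ t) -
      ((1 / 4) * ((γ t)⁻¹ * velocity γ t * ((γ t)⁻¹ * velocity γ t)).trace) • 1) with hN
    have hNs : (N * (γ t)⁻¹).IsSymm := by
      rw [IsSymm, hN]
      simp only [transpose_mul, transpose_add, transpose_sub, transpose_neg, transpose_smul,
        transpose_one, his.eq, hVs.eq, hWs.eq]
      simp only [Matrix.add_mul, Matrix.mul_add, Matrix.mul_sub, Matrix.sub_mul, Matrix.neg_mul,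
        Matrix.mul_neg, Matrix.mul_smul, Matrix.smul_mul, Matrix.mul_one, Matrix.one_mul,
        Matrix.mul_assoc]
    -- The defect is a positive multiple of c ↦ tr(Nγ⁻¹c), and Nγ⁻¹ is itself an admissible
    -- symmetric test tensor; testing with it gives tr((Nγ⁻¹)²) = 0.
    have h1 := geodesic_defect hG h ht hW (N * (γ t)⁻¹)
    rw [hg.equation t ht _ hNs, sub_self] at h1
    have h2 : (N * (γ t)⁻¹ * (N * (γ t)⁻¹)).trace = 0 :=
      (mul_eq_zero.1 h1.symm).resolve_left (Real.sqrt_pos.2 (det_pos_of_posDef hG hp)).ne'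
    have h3 := eq_zero_of_trace_sq hNs h2.le
    have h4 : N = 0 := by
      have : N * (γ t)⁻¹ * γ t = 0 := by rw [h3, Matrix.zero_mul]
      rwa [Matrix.mul_assoc, nonsing_inv_mul _ (isUnit_det_of_posDef hp), Matrix.mul_one] at this
    refine hA.congr_deriv ?_
    rw [← sub_eq_zero, ← h4, hN]
    abel
  · intro hg
    refine ⟨h, fun t ht c _ => ?_⟩
    obtain ⟨W, -, hW⟩ := h.exists_acceleration ht
    have hp := h.posDef t ht
    have hA := (hasDerivWithinAt_inv (h.velocity_hasDerivWithinAt (by norm_num) ht) hp.isUnit).mul hW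
    have e := (uniqueDiffOn_Icc zero_lt_one t ht).eq_deriv _ hA (hg t ht)
    rw [← sub_eq_zero, geodesic_defect hG h ht hW c, e]
    simp

theorem eq_of_hasDerivWithinAt_zero {E : Type*} [NormedAddCommGroup E] [NormedSpace ℝ E]
    {f : ℝ → E} (h : ∀ t ∈ Icc (0 : ℝ) 1, HasDerivWithinAt f 0 (Icc 0 1) t) {t : ℝ}
    (ht : t ∈ Icc (0 : ℝ) 1) : f t = f 0 :=
  constant_of_derivWithin_zero (fun x hx => (h x hx).differentiableWithinAt)
    (fun x hx => (h x (Ico_subset_Icc_self hx)).derivWithin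
      (uniqueDiffOn_Icc zero_lt_one x (Ico_subset_Icc_self hx))) t ht

/-! ### Congruence to the identity and traceless parts. -/

theorem exists_eq_conj {S b : Matrix (Fin n) (Fin n) ℝ} (hS : IsUnit S) (hb : b.IsSymm) :
    ∃ X : Matrix (Fin n) (Fin n) ℝ, X.IsSymm ∧ b = Sᵀ * X * S := by
  have hd := (isUnit_iff_isUnit_det _).1 hS
  have hd' : IsUnit Sᵀ.det := by rwa [det_transpose]
  refine ⟨(Sᵀ)⁻¹ * b * S⁻¹, ?_, ?_⟩
  · rw [IsSymm]
    simp only [transpose_mul, transpose_nonsing_inv, transpose_transpose, hb.eq, Matrix.mul_assoc]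
  · simp only [Matrix.mul_assoc]
    rw [nonsing_inv_mul _ hd, Matrix.mul_one, ← Matrix.mul_assoc, mul_nonsing_inv _ hd',
      Matrix.one_mul]

theorem isSymm_conj {S X : Matrix (Fin n) (Fin n) ℝ} (hX : X.IsSymm) : (Sᵀ * X * S).IsSymm := by
  rw [IsSymm]
  simp only [transpose_mul, transpose_transpose, hX.eq, Matrix.mul_assoc]

theorem inv_mul_conj {S : Matrix (Fin n) (Fin n) ℝ} (hS : IsUnit S)
    (X : Matrix (Fin n) (Fin n) ℝ) : (Sᵀ * S)⁻¹ * (Sᵀ * X * S) = S⁻¹ * X * S := by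
  have hd' : IsUnit Sᵀ.det := by
    rw [det_transpose]; exact (isUnit_iff_isUnit_det _).1 hS
  rw [Matrix.mul_inv_rev]
  simp only [Matrix.mul_assoc]
  rw [← Matrix.mul_assoc (Sᵀ)⁻¹, nonsing_inv_mul _ hd', Matrix.one_mul]

theorem mul_exp_conj {S : Matrix (Fin n) (Fin n) ℝ} (hS : IsUnit S)
    (X : Matrix (Fin n) (Fin n) ℝ) :
    Sᵀ * S * exp ((Sᵀ * S)⁻¹ * (Sᵀ * X * S)) = Sᵀ * exp X * S := by
  have hd := (isUnit_iff_isUnit_det _).1 hS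
  rw [inv_mul_conj hS, Matrix.exp_conj' _ _ hS]
  simp only [Matrix.mul_assoc]
  rw [← Matrix.mul_assoc S, mul_nonsing_inv _ hd, Matrix.one_mul]

theorem trace_conj {S : Matrix (Fin n) (Fin n) ℝ} (hS : IsUnit S)
    (X : Matrix (Fin n) (Fin n) ℝ) : (S⁻¹ * X * S).trace = X.trace := by
  rw [trace_mul_comm, ← Matrix.mul_assoc, mul_nonsing_inv _ ((isUnit_iff_isUnit_det _).1 hS),
    Matrix.one_mul]

theorem tr₁_conj {S : Matrix (Fin n) (Fin n) ℝ} (hS : IsUnit S)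
    (X : Matrix (Fin n) (Fin n) ℝ) : tr₁ (Sᵀ * S) (Sᵀ * X * S) = X.trace := by
  rw [tr₁, inv_mul_conj hS, trace_conj hS]

theorem tr₂_eq (a b : Matrix (Fin n) (Fin n) ℝ) : tr₂ a b b = (a⁻¹ * b * (a⁻¹ * b)).trace := by
  rw [tr₂, ← Matrix.mul_assoc]

theorem tr₂_conj {S : Matrix (Fin n) (Fin n) ℝ} (hS : IsUnit S)
    (X : Matrix (Fin n) (Fin n) ℝ) :
    tr₂ (Sᵀ * S) (Sᵀ * X * S) (Sᵀ * X * S) = (X * X).trace := by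
  rw [tr₂_eq, inv_mul_conj hS]
  rw [show S⁻¹ * X * S * (S⁻¹ * X * S) = S⁻¹ * (X * (S * S⁻¹) * X) * S by
    simp only [Matrix.mul_assoc], trace_conj hS,
    mul_nonsing_inv _ ((isUnit_iff_isUnit_det _).1 hS), Matrix.mul_one]

/-- The traceless part of a matrix. -/
def dev (X : Matrix (Fin n) (Fin n) ℝ) : Matrix (Fin n) (Fin n) ℝ := X - (X.trace / n) • 1

theorem isSymm_dev {X : Matrix (Fin n) (Fin n) ℝ} (hX : X.IsSymm) : (dev X).IsSymm :=
  hX.sub (isSymm_one.smul _)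

theorem trace_dev (hn : 0 < n) (X : Matrix (Fin n) (Fin n) ℝ) : (dev X).trace = 0 := by
  have hn' : (n : ℝ) ≠ 0 := by exact_mod_cast hn.ne'
  rw [dev, trace_sub, trace_smul, trace_one, Fintype.card_fin, smul_eq_mul]
  field_simp
  ring

theorem trace_sq_dev (hn : 0 < n) (X : Matrix (Fin n) (Fin n) ℝ) :
    (dev X * dev X).trace = (X * X).trace - X.trace ^ 2 / n := by
  have hn' : (n : ℝ) ≠ 0 := by exact_mod_cast hn.ne'
  simp only [dev, Matrix.sub_mul, Matrix.mul_sub, Matrix.smul_mul, Matrix.mul_smul, Matrix.mul_one,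
    Matrix.one_mul, trace_sub, trace_smul, trace_one, Fintype.card_fin, smul_eq_mul]
  field_simp
  ring

theorem traceless_conj {S : Matrix (Fin n) (Fin n) ℝ} (hS : IsUnit S)
    (X : Matrix (Fin n) (Fin n) ℝ) :
    traceless (Sᵀ * S) (Sᵀ * X * S) = Sᵀ * dev X * S := by
  rw [traceless, tr₁_conj hS, dev, Matrix.mul_sub, Matrix.sub_mul]
  simp only [Matrix.mul_smul, Matrix.smul_mul, Matrix.mul_one]
  congr 2
  ring

theorem isSymm_traceless {a b : Matrix (Fin n) (Fin n) ℝ} (ha : a.PosDef) (hb : b.IsSymm) :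
    (traceless a b).IsSymm := hb.sub ((IsSymm_of_posDef ha).smul _)

theorem tr₂_nonneg {a b : Matrix (Fin n) (Fin n) ℝ} (ha : a.PosDef) (hb : b.IsSymm) :
    0 ≤ tr₂ a b b := by
  obtain ⟨S, hS, rfl⟩ := exists_transpose_mul_self ha
  obtain ⟨X, hX, rfl⟩ := exists_eq_conj hS hb
  rw [tr₂_conj hS]
  exact trace_sq_nonneg hX

theorem tr₂_pos {a b : Matrix (Fin n) (Fin n) ℝ} (ha : a.PosDef) (hb : b.IsSymm) (h : b ≠ 0) :
    0 < tr₂ a b b := by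
  refine (tr₂_nonneg ha hb).lt_of_ne' fun h0 => h ?_
  obtain ⟨S, hS, rfl⟩ := exists_transpose_mul_self ha
  obtain ⟨X, hX, rfl⟩ := exists_eq_conj hS hb
  rw [tr₂_conj hS] at h0
  rw [eq_zero_of_trace_sq hX h0.le, Matrix.mul_zero, Matrix.zero_mul]

/-! ### Explicit geodesics. -/

/-- The squared radius along a geodesic with initial point `a` and initial velocity `v`, relative to
its value at `a`. -/
def growth (a v : Matrix (Fin n) (Fin n) ℝ) (t : ℝ) : ℝ :=
  (1 + t / 4 * tr₁ a v) ^ 2 + (t / 4) ^ 2 * (n * tr₂ a (traceless a v) (traceless a v))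

theorem hasDerivAt_growth (a v : Matrix (Fin n) (Fin n) ℝ) (t : ℝ) :
    HasDerivAt (growth a v) (tr₁ a v / 2 * (1 + t / 4 * tr₁ a v) +
      t / 8 * (n * tr₂ a (traceless a v) (traceless a v))) t := by
  have h1 := ((hasDerivAt_id t).div_const 4)
  have h2 := (((h1.mul_const (tr₁ a v)).const_add 1).pow 2).add
    ((h1.pow 2).mul_const (n * tr₂ a (traceless a v) (traceless a v)))
  refine h2.congr_deriv ?_
  simp only [id]
  push_cast
  ring

/-- Without traceless part the growth is the square of an affine function with value 1 at 0. If that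
function were nonpositive at t, it would vanish at some time in [0, t], and so would the growth. -/
theorem affine_pos_of_growth_pos {a v : Matrix (Fin n) (Fin n) ℝ} (hv : traceless a v = 0)
    (hg : ∀ t ∈ Icc (0 : ℝ) 1, 0 < growth a v t) {t : ℝ} (ht : t ∈ Icc (0 : ℝ) 1) :
    0 < 1 + t / 4 * tr₁ a v := by
  by_contra! h
  set c := t / 4 * tr₁ a v
  have hc : 0 < -c := by linarith
  have h1 := hg (t / (-c)) ⟨div_nonneg ht.1 hc.le, by rw [div_le_one hc]; linarith [ht.2]⟩
  rw [growth, hv] at h1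
  have h2 : t / -c / 4 * tr₁ a v = -1 := by
    rw [show t / -c / 4 * tr₁ a v = c / -c by simp only [c]; ring, div_neg, div_self (by linarith)]
  rw [h2] at h1
  simp [tr₂] at h1

/-- The argument is the imaginary part of the logarithm; the hypothesis keeps the point in the slit
plane. -/
theorem hasDerivWithinAt_arg {q r : ℝ → ℝ} {q' r' t : ℝ} {s : Set ℝ} (hq : HasDerivWithinAt q q' s t)
    (hr : HasDerivWithinAt r r' s t) (h : 0 < q t ∨ r t ≠ 0) :
    HasDerivWithinAt (fun x => Complex.arg ⟨q x, r x⟩)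
      ((q t * r' - r t * q') / (q t ^ 2 + r t ^ 2)) s t := by
  have h1 : HasDerivWithinAt (fun x => (⟨q x, r x⟩ : ℂ)) ⟨q', r'⟩ s t := by
    have e (x y : ℝ) : (⟨x, y⟩ : ℂ) = (x : ℂ) + (y : ℂ) * Complex.I := Complex.mk_eq_add_mul_I x y
    simp only [e]
    exact hq.ofReal_comp.add (hr.ofReal_comp.mul_const _)
  have h2 := h1.clog_real (Complex.mem_slitPlane_iff.2 h)
  have h3 := Complex.imCLM.hasFDerivAt.comp_hasDerivWithinAt t h2
  have h4 : HasDerivWithinAt (fun x => Complex.arg ⟨q x, r x⟩)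
      (Complex.im (⟨q', r'⟩ / ⟨q t, r t⟩)) s t :=
    h3.congr (fun x _ => (Complex.log_im _).symm) (Complex.log_im _).symm
  refine h4.congr_deriv ?_
  rw [Complex.div_im, Complex.normSq_apply]
  simp only
  ring

/-- Both branches of `geodesicFrom` are brought to one formula, in which the only fact needed about
the coefficient U of the traceless direction is U' = 1/growth. -/
theorem exists_angle {a v : Matrix (Fin n) (Fin n) ℝ} (ha : a.PosDef) (hv : v.IsSymm) (hn : 0 < n)
    (hg : ∀ t ∈ Icc (0 : ℝ) 1, 0 < growth a v t) :
    ∃ U : ℝ → ℝ, U 0 = 0 ∧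
      (∀ t ∈ Icc (0 : ℝ) 1, HasDerivWithinAt U (growth a v t)⁻¹ (Icc 0 1) t) ∧
      ∀ t ∈ Icc (0 : ℝ) 1, geodesicFrom a v t =
        (growth a v t ^ (2 / (n : ℝ)) : ℝ) • (a * exp (U t • (a⁻¹ * traceless a v))) := by
  have hq (t : ℝ) : HasDerivWithinAt (fun t => 1 + t / 4 * tr₁ a v) (tr₁ a v / 4) (Icc 0 1) t := by
    have h1 := ((((hasDerivAt_id t).div_const 4).mul_const (tr₁ a v)).const_add 1)
    exact (h1.congr_deriv (by ring)).hasDerivWithinAt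
  by_cases h0 : traceless a v = 0
  · have hg' (t : ℝ) : growth a v t = (1 + t / 4 * tr₁ a v) ^ 2 := by
      simp [growth, h0, tr₂]
    -- Here U multiplies the zero matrix, so any function with the right derivative and U 0 = 0 will
    -- do.
    refine ⟨fun t => t / (1 + t / 4 * tr₁ a v), by simp, fun t ht => ?_, fun t ht => ?_⟩
    · have hp := affine_pos_of_growth_pos h0 hg ht
      refine ((hasDerivWithinAt_id t _).div (hq t) hp.ne').congr_deriv ?_
      rw [hg']
      simp only [id]
      field_simp
      ring
    · have hp := affine_pos_of_growth_pos h0 hg ht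
      rw [geodesicFrom, if_pos h0, hg', h0, Matrix.mul_zero, smul_zero, exp_zero, Matrix.mul_one,
        ← Real.rpow_natCast, ← Real.rpow_mul hp.le]
      congr 2
      push_cast
      ring
  · have hτ := tr₂_pos ha (isSymm_traceless ha hv) h0
    set τ := tr₂ a (traceless a v) (traceless a v) with hτd
    have hn' : (0 : ℝ) < n := by exact_mod_cast hn
    have hm : 0 < (n : ℝ) * τ := mul_pos hn' hτ
    have hs := Real.sqrt_pos.2 hm
    have hs2 := Real.sq_sqrt hm.le
    have hgr (t : ℝ) : growth a v t = (1 + t / 4 * tr₁ a v) ^ 2 + (t / 4 * √(n * τ)) ^ 2 := by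
      rw [growth, mul_pow _ (√(n * τ)), hs2]
    refine ⟨fun t => 4 / √(n * τ) * Complex.arg ⟨1 + t / 4 * tr₁ a v, t / 4 * √(n * τ)⟩, ?_,
      fun t ht => ?_, fun t ht => ?_⟩
    · have : (⟨1, 0⟩ : ℂ) = 1 := rfl
      simp [this]
    · have hr : HasDerivWithinAt (fun t => t / 4 * √(n * τ)) (√(n * τ) / 4) (Icc 0 1) t :=
        ((((hasDerivAt_id t).div_const 4).mul_const (√(n * τ))).congr_deriv
          (by ring)).hasDerivWithinAt
      have h1 := (hasDerivWithinAt_arg (hq t) hr (by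
        rcases ht.1.eq_or_lt with h | h
        · left; rw [← h]; simp
        · right; positivity)).const_mul (4 / √(n * τ))
      refine h1.congr_deriv ?_
      have h2 := hg t ht
      rw [hgr] at h2 ⊢
      field_simp
      ring
    · simp only [geodesicFrom]
      rw [if_neg h0, hgr]

/-- Explicit integration of the geodesic equation. -/
theorem IsRiemannianGeodesic.eq_geodesicFrom (hn : 0 < n) (hG : G.PosDef)
    {γ : ℝ → Matrix (Fin n) (Fin n) ℝ} (h : IsRiemannianGeodesic G γ) :
    (∀ t ∈ Icc (0 : ℝ) 1, 0 < growth (γ 0) (velocity γ 0) t) ∧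
      ∀ t ∈ Icc (0 : ℝ) 1, γ t = geodesicFrom (γ 0) (velocity γ 0) t := by
  have hn' : (0 : ℝ) < n := by exact_mod_cast hn
  have h0 : (0 : ℝ) ∈ Icc (0 : ℝ) 1 := left_mem_Icc.2 zero_le_one
  have hc := h.isCurve
  have hp := hc.posDef
  have hV := fun t ht => hc.velocity_hasDerivWithinAt (t := t) (by norm_num) ht
  have hA := (isRiemannianGeodesic_iff hG hc).1 h
  set A : ℝ → Matrix (Fin n) (Fin n) ℝ := fun t => (γ t)⁻¹ * velocity γ t with hAd
  set f : ℝ → ℝ := fun t => √(G⁻¹ * γ t).det with hf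
  have hfp : ∀ t ∈ Icc (0 : ℝ) 1, 0 < f t := fun t ht =>
    Real.sqrt_pos.2 (det_pos_of_posDef hG (hp t ht))
  set u : ℝ → ℝ := fun t => (A t).trace with hu
  set g : ℝ → ℝ := fun t => f t / f 0 with hg
  have hgp : ∀ t ∈ Icc (0 : ℝ) 1, 0 < g t := fun t ht => div_pos (hfp t ht) (hfp 0 h0)
  have hg0 : g 0 = 1 := div_self (hfp 0 h0).ne'
  set C : Matrix (Fin n) (Fin n) ℝ := dev (A 0) with hC
  have hCT : (γ 0)⁻¹ * traceless (γ 0) (velocity γ 0) = C := by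
    rw [traceless, Matrix.mul_sub, Matrix.mul_smul,
      nonsing_inv_mul _ (isUnit_det_of_posDef (hp 0 h0)), hC, dev, tr₁]
    congr 2
    ring
  set κ := (C * C).trace with hκ
  have hκT : tr₂ (γ 0) (traceless (γ 0) (velocity γ 0)) (traceless (γ 0) (velocity γ 0)) = κ := by
    rw [tr₂_eq, hCT]
  have hgd : ∀ t ∈ Icc (0 : ℝ) 1, HasDerivWithinAt g (g t * u t / 2) (Icc 0 1) t := fun t ht =>
    ((hasDerivWithinAt_density hG (hV t ht) (hp t ht)).div_const (f 0)).congr_deriv (by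
      simp only [hg, hu, hf, hAd]; ring)
  have hA' : ∀ t ∈ Icc (0 : ℝ) 1, HasDerivWithinAt A
      (((1 / 4) * (A t * A t).trace) • 1 - ((1 / 2) * u t) • A t) (Icc 0 1) t := hA
  have hud : ∀ t ∈ Icc (0 : ℝ) 1, HasDerivWithinAt u
      (n / 4 * (A t * A t).trace - u t ^ 2 / 2) (Icc 0 1) t := fun t ht =>
    (hasDerivWithinAt_trace (hA' t ht)).congr_deriv (by
      simp only [trace_sub, trace_smul, trace_one, Fintype.card_fin, smul_eq_mul, hu]; ring)
  -- First integral: dev A satisfies (dev A)' = −(u/2) dev A while g' = (u/2) g.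
  have hgC : ∀ t ∈ Icc (0 : ℝ) 1, g t • dev (A t) = C := by
    intro t ht
    have h1 := eq_of_hasDerivWithinAt_zero (f := fun t => g t • dev (A t)) (fun t ht => by
      refine ((hgd t ht).smul ((hA' t ht).sub (((hud t ht).div_const (n : ℝ)).smul_const
        (1 : Matrix (Fin n) (Fin n) ℝ)))).congr_deriv ?_
      change g t • ((((1 / 4) * (A t * A t).trace) • 1 - ((1 / 2) * u t) • A t) - _) +
        (g t * u t / 2) • (A t - (u t / n) • 1) = 0
      match_scalars <;> field_simp <;> ring) ht
    rw [h1, hg0, one_smul]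
  have hAe : ∀ t ∈ Icc (0 : ℝ) 1, A t = (u t / n) • 1 + (g t)⁻¹ • C := by
    intro t ht
    rw [← hgC t ht, smul_smul, inv_mul_cancel₀ (hgp t ht).ne', one_smul, dev]
    abel
  have hAA : ∀ t ∈ Icc (0 : ℝ) 1, (A t * A t).trace = u t ^ 2 / n + κ / g t ^ 2 := by
    intro t ht
    have h1 := trace_sq_dev hn (A t)
    have h2 : dev (A t) = (g t)⁻¹ • C := by
      rw [← hgC t ht, smul_smul, inv_mul_cancel₀ (hgp t ht).ne', one_smul]
    rw [h2, Matrix.smul_mul, Matrix.mul_smul, trace_smul, trace_smul, smul_eq_mul, smul_eq_mul,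
      ← hκ] at h1
    have h3 : (A t * A t).trace = (g t)⁻¹ * ((g t)⁻¹ * κ) + u t ^ 2 / n := by rw [h1, hu]; ring
    rw [h3]
    have := (hgp t ht).ne'
    field_simp
    ring
  -- Conservation of energy: this is n times the squared speed, divided by the initial density.
  have hK : ∀ t ∈ Icc (0 : ℝ) 1, g t * u t ^ 2 + n * κ / g t = u 0 ^ 2 + n * κ := by
    intro t ht
    have h1 := eq_of_hasDerivWithinAt_zero (f := fun t => g t * u t ^ 2 + n * κ / g t)
      (fun t ht => by
        have hne := (hgp t ht).ne'
        refine (((hgd t ht).mul ((hud t ht).pow 2)).add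
          ((hasDerivWithinAt_const t _ (n * κ)).div (hgd t ht) hne)).congr_deriv ?_
        rw [hAA t ht]
        simp only [Pi.pow_apply]
        push_cast
        field_simp
        ring) ht
    rw [h1]
    simp only [hg0]
    ring
  -- By conservation of energy g' = gu/2 has constant derivative, so g is a quadratic polynomial; it
  -- is then identified with `growth`.
  have hgu : ∀ t ∈ Icc (0 : ℝ) 1, g t * u t = u 0 + (u 0 ^ 2 + n * κ) / 4 * t := by
    intro t ht
    have h1 := eq_of_hasDerivWithinAt_zero
      (f := fun t => g t * u t - (u 0 ^ 2 + n * κ) / 4 * t)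
      (fun t ht => by
        have hne := (hgp t ht).ne'
        refine (((hgd t ht).mul (hud t ht)).sub
          ((hasDerivWithinAt_id t _).const_mul ((u 0 ^ 2 + n * κ) / 4))).congr_deriv ?_
        rw [hAA t ht, ← hK t ht]
        field_simp
        ring) ht
    simp only [hg0, mul_zero, one_mul, sub_zero] at h1
    linarith
  have hgrow : ∀ t ∈ Icc (0 : ℝ) 1, g t = growth (γ 0) (velocity γ 0) t := by
    intro t ht
    have h1 := eq_of_hasDerivWithinAt_zero (f := fun t => g t - growth (γ 0) (velocity γ 0) t)
      (fun t ht => by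
        refine ((hgd t ht).sub (hasDerivAt_growth _ _ t).hasDerivWithinAt).congr_deriv ?_
        rw [hgu t ht, hκT]
        change _ - (u 0 / 2 * (1 + t / 4 * u 0) + _) = 0
        ring) ht
    have h2 : growth (γ 0) (velocity γ 0) 0 = 1 := by simp [growth]
    rw [hg0, h2, sub_self] at h1
    linarith
  have hpos : ∀ t ∈ Icc (0 : ℝ) 1, 0 < growth (γ 0) (velocity γ 0) t := fun t ht =>
    hgrow t ht ▸ hgp t ht
  refine ⟨hpos, fun t ht => ?_⟩
  obtain ⟨U, hU0, hU, he⟩ := exists_angle (hp 0 h0) (hc.isSymm_velocity (by norm_num) h0) hn hpos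
  rw [he t ht, hCT]
  have hX : ∀ t ∈ Icc (0 : ℝ) 1, HasDerivWithinAt (fun t => exp (-U t • C))
      (-(g t)⁻¹ • (C * exp (-U t • C))) (Icc 0 1) t := fun t ht => by
    have h1 := (hU t ht).neg
    rw [← hgrow t ht] at h1
    exact (hasDerivAt_exp_smul_const' (𝕂 := ℝ) C (-U t)).scomp_hasDerivWithinAt t h1
  have hgr : ∀ t ∈ Icc (0 : ℝ) 1, HasDerivWithinAt (fun t => g t ^ (-(2 / (n : ℝ))))
      (-(u t / n) * g t ^ (-(2 / (n : ℝ)))) (Icc 0 1) t := fun t ht => by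
    refine ((hgd t ht).rpow_const (p := -(2 / (n : ℝ))) (Or.inl (hgp t ht).ne')).congr_deriv ?_
    rw [Real.rpow_sub_one (hgp t ht).ne']
    have := (hgp t ht).ne'
    field_simp
  -- The logarithmic velocity is now (u/n)·1 + g⁻¹C with C constant. Multiplying γ by the inverses
  -- of the two integrating factors gives a constant curve.
  have h1 := eq_of_hasDerivWithinAt_zero
    (f := fun t => g t ^ (-(2 / (n : ℝ))) • (γ t * exp (-U t • C)))
    (fun t ht => by
      refine ((hgr t ht).smul ((hV t ht).mul (hX t ht))).congr_deriv ?_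
      have e : velocity γ t = γ t * A t := by
        rw [hAd, ← Matrix.mul_assoc, mul_nonsing_inv _ (isUnit_det_of_posDef (hp t ht)),
          Matrix.one_mul]
      change g t ^ (-(2 / (n : ℝ))) • (velocity γ t * exp (-U t • C) +
        γ t * (-(g t)⁻¹ • (C * exp (-U t • C)))) +
        (-(u t / n) * g t ^ (-(2 / (n : ℝ)))) • (γ t * exp (-U t • C)) = 0
      rw [e, hAe t ht]
      simp only [Matrix.mul_add, Matrix.add_mul, Matrix.mul_smul, Matrix.smul_mul, Matrix.mul_one,
        Matrix.mul_assoc]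
      module) ht
  rw [hg0, hU0, Real.one_rpow, one_smul, neg_zero, zero_smul, exp_zero, Matrix.mul_one] at h1
  rw [← hgrow t ht, ← h1, Matrix.smul_mul, smul_smul, ← Real.rpow_add (hgp t ht), add_neg_cancel,
    Real.rpow_zero, one_smul, Matrix.mul_assoc, ← Matrix.exp_add_of_commute, ← add_smul, neg_add_cancel,
    zero_smul, exp_zero, Matrix.mul_one]
  exact ((Commute.refl C).smul_left _).smul_right _

theorem contDiffOn_of_hasDerivWithinAt {k : ℕ} {f f' : ℝ → ℝ}
    (h : ∀ t ∈ Icc (0 : ℝ) 1, HasDerivWithinAt f (f' t) (Icc 0 1) t)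
    (h' : ContDiffOn ℝ k f' (Icc 0 1)) : ContDiffOn ℝ (k + 1) f (Icc 0 1) := by
  rw [contDiffOn_succ_iff_derivWithin (uniqueDiffOn_Icc zero_lt_one)]
  refine ⟨fun t ht => (h t ht).differentiableWithinAt, by simp, ?_⟩
  exact h'.congr fun t ht => (h t ht).derivWithin (uniqueDiffOn_Icc zero_lt_one t ht)

theorem contDiff_growth (a v : Matrix (Fin n) (Fin n) ℝ) (k : ℕ) : ContDiff ℝ k (growth a v) := by
  unfold growth
  fun_prop

theorem contDiff_exp_smul (C : Matrix (Fin n) (Fin n) ℝ) (k : ℕ) :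
    ContDiff ℝ k (fun t : ℝ => exp (t • C)) := by
  have h : ContDiff ℝ k (exp : Matrix (Fin n) (Fin n) ℝ → Matrix (Fin n) (Fin n) ℝ) :=
    contDiff_iff_contDiffAt.2 fun x => (exp_analytic (𝕂 := ℝ) x).contDiffAt
  exact h.comp (contDiff_id.smul contDiff_const)

theorem contDiffOn_entry {γ : ℝ → Matrix (Fin n) (Fin n) ℝ} {k : ℕ} {s : Set ℝ}
    (h : ContDiffOn ℝ k γ s) (i j : Fin n) : ContDiffOn ℝ k (fun t => γ t i j) s :=
  (LinearMap.toContinuousLinearMap (Matrix.entryLinearMap ℝ ℝ i j)).contDiff.comp_contDiffOn h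

theorem posDef_smul_mul_exp {a T : Matrix (Fin n) (Fin n) ℝ} (ha : a.PosDef) (hT : T.IsSymm)
    {c : ℝ} (hc : 0 < c) (s : ℝ) : (c • (a * exp (s • (a⁻¹ * T)))).PosDef := by
  obtain ⟨S, hS, rfl⟩ := exists_transpose_mul_self ha
  obtain ⟨X, hX, rfl⟩ := exists_eq_conj hS hT
  have e : s • ((Sᵀ * S)⁻¹ * (Sᵀ * X * S)) = (Sᵀ * S)⁻¹ * (Sᵀ * (s • X) * S) := by
    simp only [Matrix.mul_smul, Matrix.smul_mul]
  rw [e, mul_exp_conj hS]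
  exact (posDef_chartPoint hS (hX.smul s)).smul hc

theorem growth_zero (a v : Matrix (Fin n) (Fin n) ℝ) : growth a v 0 = 1 := by simp [growth]

theorem trace_inv_mul_traceless (hn : 0 < n) {a v : Matrix (Fin n) (Fin n) ℝ} (ha : a.PosDef) :
    (a⁻¹ * traceless a v).trace = 0 := by
  have hn' : (n : ℝ) ≠ 0 := by exact_mod_cast hn.ne'
  rw [traceless, Matrix.mul_sub, Matrix.mul_smul, nonsing_inv_mul _ (isUnit_det_of_posDef ha),
    trace_sub, trace_smul, trace_one, Fintype.card_fin, smul_eq_mul, tr₁]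
  field_simp
  ring

theorem det_mul_exp_traceless (hn : 0 < n) {a v : Matrix (Fin n) (Fin n) ℝ} (ha : a.PosDef)
    (hv : v.IsSymm) (s : ℝ) : (exp (s • (a⁻¹ * traceless a v))).det = 1 := by
  obtain ⟨S, hS, rfl⟩ := exists_transpose_mul_self ha
  obtain ⟨X, hX, rfl⟩ := exists_eq_conj hS hv
  rw [traceless_conj hS, inv_mul_conj hS, ← Matrix.smul_mul, ← Matrix.mul_smul,
    Matrix.exp_conj' _ _ hS, det_mul_right_comm, nonsing_inv_mul _ ((isUnit_iff_isUnit_det _).1 hS),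
    Matrix.one_mul, det_exp_of_isSymm ((isSymm_dev hX).smul _), trace_smul, trace_dev hn,
    smul_zero, Real.exp_zero]

/-- The explicit curves solve the geodesic equation as long as they do not reach the singular
point, and they have constant speed. -/
theorem isRiemannianGeodesic_geodesicFrom (hn : 0 < n) (hG : G.PosDef)
    {a v : Matrix (Fin n) (Fin n) ℝ} (ha : a.PosDef) (hv : v.IsSymm)
    (hg : ∀ t ∈ Icc (0 : ℝ) 1, 0 < growth a v t) :
    IsRiemannianGeodesic G (geodesicFrom a v) ∧ geodesicFrom a v 0 = a ∧
      ∀ t ∈ Icc (0 : ℝ) 1, √(metric G (geodesicFrom a v t) (velocity (geodesicFrom a v) t)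
        (velocity (geodesicFrom a v) t)) = radius G a *
          √((tr₁ a v / 4) ^ 2 + n * tr₂ a (traceless a v) (traceless a v) / 16) := by
  have hn' : (0 : ℝ) < n := by exact_mod_cast hn
  obtain ⟨U, hU0, hU, he⟩ := exists_angle ha hv hn hg
  set C := a⁻¹ * traceless a v with hC
  set g := growth a v with hgd
  set g' : ℝ → ℝ := fun t => tr₁ a v / 2 * (1 + t / 4 * tr₁ a v) +
      t / 8 * (n * tr₂ a (traceless a v) (traceless a v)) with hg'
  have hgD (t : ℝ) : HasDerivWithinAt g (g' t) (Icc 0 1) t :=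
    (hasDerivAt_growth a v t).hasDerivWithinAt
  set A : ℝ → Matrix (Fin n) (Fin n) ℝ := fun t => (2 * g' t / (n * g t)) • 1 + (g t)⁻¹ • C with hA
  have hCtr : C.trace = 0 := trace_inv_mul_traceless hn ha
  have hκ : (C * C).trace = tr₂ a (traceless a v) (traceless a v) := by rw [tr₂_eq]
  set κ := tr₂ a (traceless a v) (traceless a v)
  have hAA (t : ℝ) : (A t * A t).trace = 4 * g' t ^ 2 / (n * g t ^ 2) + κ / g t ^ 2 := by
    simp only [hA, Matrix.add_mul, Matrix.mul_add, Matrix.smul_mul, Matrix.mul_smul, Matrix.mul_one,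
      Matrix.one_mul, trace_add, trace_smul, trace_one, Fintype.card_fin, smul_eq_mul, hCtr, hκ]
    field_simp
    ring
  have hAt (t : ℝ) : (A t).trace = 2 * g' t / g t := by
    simp only [hA, trace_add, trace_smul, trace_one, Fintype.card_fin, smul_eq_mul, hCtr]
    field_simp
    ring
  -- Conservation of energy written for the quadratic polynomial g; it serves both the geodesic
  -- equation and the constancy of the speed.
  have hen (t : ℝ) : 4 * g' t ^ 2 + n * κ = g t * (tr₁ a v ^ 2 + n * κ) := by
    simp only [hg', hgd, growth]
    ring
  have hF : ∀ t ∈ Icc (0 : ℝ) 1, HasDerivWithinAt (geodesicFrom a v)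
      (geodesicFrom a v t * A t) (Icc 0 1) t := by
    intro t ht
    have h1 := (hgD t).rpow_const (p := 2 / (n : ℝ)) (Or.inl (hg t ht).ne')
    have h2 := (hasDerivAt_exp_smul_const (𝕂 := ℝ) C (U t)).scomp_hasDerivWithinAt t (hU t ht)
    have h3 := h1.smul (h2.const_mul a)
    refine (h3.congr_deriv ?_).congr he (he t ht)
    change g t ^ (2 / (n : ℝ)) • (a * ((g t)⁻¹ • (exp (U t • C) * C))) +
      (g' t * (2 / (n : ℝ)) * g t ^ (2 / (n : ℝ) - 1)) • (a * exp (U t • C)) = _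
    rw [he t ht, hA, Real.rpow_sub_one (hg t ht).ne']
    simp only [Matrix.mul_add, Matrix.mul_smul, Matrix.smul_mul, Matrix.mul_one, Matrix.mul_assoc]
    match_scalars <;> field_simp
  have hpd : ∀ t ∈ Icc (0 : ℝ) 1, (geodesicFrom a v t).PosDef := fun t ht => by
    rw [he t ht]
    exact posDef_smul_mul_exp ha (isSymm_traceless ha hv) (Real.rpow_pos_of_pos (hg t ht) _) _
  have hcurve : IsCurve 2 (geodesicFrom a v) := by
    refine ⟨fun i j => ?_, hpd⟩
    have hUs : ContDiffOn ℝ 2 U (Icc 0 1) :=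
      contDiffOn_of_hasDerivWithinAt (k := 1) hU
        ((contDiff_growth a v 1).contDiffOn.inv fun t ht => (hg t ht).ne')
    have hgs : ContDiffOn ℝ 2 (fun t => g t ^ (2 / (n : ℝ))) (Icc 0 1) :=
      (contDiff_growth a v 2).contDiffOn.rpow_const_of_ne fun t ht => (hg t ht).ne'
    have hes : ContDiffOn ℝ 2 (fun t => a * exp (U t • C)) (Icc 0 1) :=
      contDiffOn_const.mul ((contDiff_exp_smul C 2).comp_contDiffOn hUs)
    exact contDiffOn_entry (k := 2) ((hgs.smul hes).congr he) i j
  have hvel : ∀ t ∈ Icc (0 : ℝ) 1, velocity (geodesicFrom a v) t = geodesicFrom a v t * A t :=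
    fun t ht => (uniqueDiffOn_Icc zero_lt_one t ht).eq_deriv _
      (hcurve.velocity_hasDerivWithinAt (by norm_num) ht) (hF t ht)
  have hlog : ∀ t ∈ Icc (0 : ℝ) 1,
      (geodesicFrom a v t)⁻¹ * velocity (geodesicFrom a v) t = A t := fun t ht => by
    rw [hvel t ht, ← Matrix.mul_assoc, nonsing_inv_mul _ (isUnit_det_of_posDef (hpd t ht)),
      Matrix.one_mul]
  refine ⟨(isRiemannianGeodesic_iff hG hcurve).2 fun t ht => ?_, ?_, ?_⟩
  · rw [hlog t ht]
    have hg'D : HasDerivWithinAt g' ((tr₁ a v ^ 2 + n * κ) / 8) (Icc 0 1) t := by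
      have h1 := ((hasDerivAt_id t).div_const 4)
      have h2 := (((h1.mul_const (tr₁ a v)).const_add 1).const_mul (tr₁ a v / 2)).add
        (((hasDerivAt_id t).div_const 8).mul_const (n * κ))
      exact (h2.congr_deriv (by ring)).hasDerivWithinAt
    have hne := (hg t ht).ne'
    have h3 := ((((hg'D.const_mul 2).div ((hgD t).const_mul (n : ℝ))
      (mul_ne_zero hn'.ne' hne)).smul_const (1 : Matrix (Fin n) (Fin n) ℝ))).add
      (((hgD t).inv hne).smul_const C)
    refine (h3.congr_deriv ?_).congr (fun s hs => hlog s hs) (hlog t ht)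
    rw [hAA, hAt]
    simp only [hA]
    have h5 := hen t
    have h4 : tr₁ a v ^ 2 + n * κ = (4 * g' t ^ 2 + n * κ) / g t := by
      rw [h5]; field_simp
    rw [h4]
    match_scalars <;> field_simp
    ring
  · rw [he 0 (left_mem_Icc.2 zero_le_one), hgd, growth_zero, hU0, Real.one_rpow, one_smul,
      zero_smul, exp_zero, Matrix.mul_one]
  · have hm : ∀ t ∈ Icc (0 : ℝ) 1, metric G (geodesicFrom a v t) (velocity (geodesicFrom a v) t)
        (velocity (geodesicFrom a v) t) =
        (radius G a * √((tr₁ a v / 4) ^ 2 + n * κ / 16)) ^ 2 := by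
      intro t ht
      have hnn : 0 ≤ κ := tr₂_nonneg ha (isSymm_traceless ha hv)
      rw [metric, tr₂_eq, hlog t ht, hAA, mul_pow, radius_sq, Real.sq_sqrt (by positivity)]
      have hd : √(G⁻¹ * geodesicFrom a v t).det = g t * √(G⁻¹ * a).det := by
        have h1 : (g t ^ (2 / (n : ℝ)) : ℝ) ^ n = g t ^ 2 := by
          rw [← Real.rpow_natCast, ← Real.rpow_mul (hg t ht).le, div_mul_cancel₀ _ hn'.ne']
          norm_num
        have h2 : (G⁻¹ * geodesicFrom a v t).det = g t ^ 2 * (G⁻¹ * a).det := by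
          rw [he t ht, Matrix.mul_smul, det_smul, Fintype.card_fin, h1, ← Matrix.mul_assoc, det_mul,
            det_mul_exp_traceless hn ha hv, mul_one]
        rw [h2, Real.sqrt_mul (sq_nonneg _), Real.sqrt_sq (hg t ht).le]
      have hne := (hg t ht).ne'
      rw [hd]
      have h5 := hen t
      have h6 : 4 * g' t ^ 2 / (n * g t ^ 2) + κ / g t ^ 2 = (tr₁ a v ^ 2 + n * κ) / (n * g t) := by
        field_simp
        linear_combination h5
      rw [h6]
      field_simp
      ring
    have hnn : 0 ≤ radius G a * √((tr₁ a v / 4) ^ 2 + n * κ / 16) :=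
      mul_nonneg (radius_pos hn hG ha).le (Real.sqrt_nonneg _)
    intro t ht
    rw [hm t ht, Real.sqrt_sq hnn]

end

/-! ### The inverse of the Riemannian exponential map. -/

theorem exp_smul_one_add (c : ℝ) (M : Matrix (Fin n) (Fin n) ℝ) :
    exp (c • 1 + M) = Real.exp c • exp M := by
  have h : exp (c • (1 : Matrix (Fin n) (Fin n) ℝ)) = Real.exp c • 1 := by
    rw [smul_one_eq_diagonal, exp_diagonal, smul_one_eq_diagonal]
    congr 1
    ext i
    rw [Real.exp_eq_exp_ℝ, Pi.coe_exp]
  rw [Matrix.exp_add_of_commute _ _ ((Commute.one_left M).smul_left c), h, Matrix.smul_mul,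
    Matrix.one_mul]

theorem tr₁_traceless (hn : 0 < n) {a : Matrix (Fin n) (Fin n) ℝ} (ha : a.PosDef)
    (b : Matrix (Fin n) (Fin n) ℝ) : tr₁ a (traceless a b) = 0 :=
  trace_inv_mul_traceless hn ha

theorem tr₁_smul_add (a T : Matrix (Fin n) (Fin n) ℝ) (ha : a.PosDef)
    (hT : tr₁ a T = 0) (c d : ℝ) : tr₁ a (c • a + d • T) = n * c := by
  rw [tr₁] at *
  rw [Matrix.mul_add, Matrix.mul_smul, Matrix.mul_smul, trace_add, trace_smul, trace_smul, hT,
    nonsing_inv_mul _ (isUnit_det_of_posDef ha), trace_one, Fintype.card_fin]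
  simp [mul_comm]

theorem traceless_smul_add (hn : 0 < n) {a T : Matrix (Fin n) (Fin n) ℝ} (ha : a.PosDef)
    (hT : tr₁ a T = 0) (c d : ℝ) : traceless a (c • a + d • T) = d • T := by
  have hn' : (n : ℝ) ≠ 0 := by exact_mod_cast hn.ne'
  rw [traceless, tr₁_smul_add a T ha hT]
  rw [show 1 / (n : ℝ) * (n * c) = c by field_simp, add_sub_cancel_left]

theorem eq_smul_add_traceless (a b : Matrix (Fin n) (Fin n) ℝ) :
    b = (tr₁ a b / n) • a + traceless a b := by
  rw [traceless, one_div, inv_mul_eq_div, add_sub_cancel]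

theorem tr₂_smul (a b : Matrix (Fin n) (Fin n) ℝ) (c : ℝ) :
    tr₂ a (c • b) (c • b) = c ^ 2 * tr₂ a b b := by
  simp only [tr₂, Matrix.mul_smul, Matrix.smul_mul, trace_smul, smul_eq_mul]
  ring

theorem mul_exp_smul_add {a : Matrix (Fin n) (Fin n) ℝ} (ha : a.PosDef) (c : ℝ)
    (T : Matrix (Fin n) (Fin n) ℝ) :
    a * exp (a⁻¹ * (c • a + T)) = Real.exp c • (a * exp (a⁻¹ * T)) := by
  rw [Matrix.mul_add, Matrix.mul_smul, nonsing_inv_mul _ (isUnit_det_of_posDef ha),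
    exp_smul_one_add, Matrix.mul_smul]

theorem mul_exp_injective {a b b' : Matrix (Fin n) (Fin n) ℝ} (ha : a.PosDef) (hb : b.IsSymm)
    (hb' : b'.IsSymm) (h : a * exp (a⁻¹ * b) = a * exp (a⁻¹ * b')) : b = b' := by
  obtain ⟨S, hS, rfl⟩ := exists_transpose_mul_self ha
  obtain ⟨X, hX, rfl⟩ := exists_eq_conj hS hb
  obtain ⟨Y, hY, rfl⟩ := exists_eq_conj hS hb'
  rw [mul_exp_conj hS, mul_exp_conj hS] at h
  have : X = Y := by rw [← chart_chartPoint hS hX, h, chart_chartPoint hS hY]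
  rw [this]

/-- The angle between the rays through `a` and `a exp (a⁻¹ b)`. -/
def angle (a b : Matrix (Fin n) (Fin n) ℝ) : ℝ :=
  √(n * tr₂ a (traceless a b) (traceless a b)) / 4

theorem isSymm_invExp {a b : Matrix (Fin n) (Fin n) ℝ} (ha : a.PosDef) (hb : b.IsSymm) :
    (invExp a b).IsSymm := by
  simp only [invExp]
  have := IsSymm_of_posDef ha
  have := isSymm_traceless ha hb
  split_ifs
  · exact IsSymm.smul ‹_› _
  · exact IsSymm.add (IsSymm.smul ‹_› _) (IsSymm.smul ‹_› _)

theorem angle_pos (hn : 0 < n) {a b : Matrix (Fin n) (Fin n) ℝ} (ha : a.PosDef) (hb : b.IsSymm)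
    (h : traceless a b ≠ 0) : 0 < angle a b := by
  have hn' : (0 : ℝ) < n := by exact_mod_cast hn
  have := tr₂_pos ha (isSymm_traceless ha hb) h
  rw [angle]
  positivity

theorem angle_of_traceless_eq_zero {a b : Matrix (Fin n) (Fin n) ℝ} (h : traceless a b = 0) :
    angle a b = 0 := by
  simp [angle, h, tr₂]

/-- The planar curve q + ir with this initial velocity has to end at exp(tr_a(b)/4)·e^{iθ}, θ being
the angle. The two identities encode the real part and the square of the imaginary part of that end
point. -/
theorem invExp_data (hn : 0 < n) {a b : Matrix (Fin n) (Fin n) ℝ} (ha : a.PosDef) (hb : b.IsSymm) :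
    tr₁ a (invExp a b) = 4 * (Real.exp (tr₁ a b / 4) * Real.cos (angle a b) - 1) ∧
    n * tr₂ a (traceless a (invExp a b)) (traceless a (invExp a b)) =
      (4 * (Real.exp (tr₁ a b / 4) * Real.sin (angle a b))) ^ 2 := by
  have hn' : (0 : ℝ) < n := by exact_mod_cast hn
  have h0 := tr₁_traceless hn ha b
  by_cases h : traceless a b = 0
  · have e : invExp a b = (4 / (n : ℝ) * (Real.exp (tr₁ a b / 4) - 1)) • a + (0 : ℝ) • traceless a b := by
      rw [invExp, if_pos h]; simp
    rw [e, tr₁_smul_add a _ ha h0, traceless_smul_add hn ha h0, angle_of_traceless_eq_zero h]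
    constructor
    · rw [Real.cos_zero]; field_simp
    · simp [tr₂]
  · have hρ := angle_pos hn ha hb h
    have e : invExp a b = (4 / (n : ℝ) * (Real.exp (tr₁ a b / 4) * Real.cos (angle a b) - 1)) • a +
        (4 / (4 * angle a b) * Real.exp (tr₁ a b / 4) * Real.sin (angle a b)) • traceless a b := by
      rw [invExp, if_neg h, angle, mul_div_cancel₀ _ (by norm_num)]
    have hρ2 : (4 * angle a b) ^ 2 = n * tr₂ a (traceless a b) (traceless a b) := by
      rw [angle, mul_div_cancel₀ _ (by norm_num), Real.sq_sqrt]
      exact mul_nonneg hn'.le (tr₂_nonneg ha (isSymm_traceless ha hb))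
    rw [e, tr₁_smul_add a _ ha h0, traceless_smul_add hn ha h0, tr₂_smul]
    constructor
    · field_simp
    · rw [mul_left_comm, ← hρ2]
      field_simp

/-- The growth is the squared modulus on the planar segment from 1 to exp(tr_a(b)/4)·e^{iθ}, which
misses the origin because 0 ≤ θ < π. -/
theorem growth_invExp (hn : 0 < n) {a b : Matrix (Fin n) (Fin n) ℝ} (ha : a.PosDef) (hb : b.IsSymm)
    (hπ : angle a b < Real.pi) {t : ℝ} (ht : t ∈ Icc (0 : ℝ) 1) :
    0 < growth a (invExp a b) t := by
  obtain ⟨h1, h2⟩ := invExp_data hn ha hb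
  rw [growth, h1, h2]
  have hE := Real.exp_pos (tr₁ a b / 4)
  by_cases h : traceless a b = 0
  · rw [angle_of_traceless_eq_zero h, Real.cos_zero, Real.sin_zero]
    have : 0 < 1 + t / 4 * (4 * (Real.exp (tr₁ a b / 4) * 1 - 1)) := by
      rcases ht.1.eq_or_lt with h | h
      · rw [← h]; norm_num
      · nlinarith [mul_pos h hE, ht.2]
    positivity
  · have hs := Real.sin_pos_of_pos_of_lt_pi (angle_pos hn ha hb h) hπ
    rcases ht.1.eq_or_lt with h | h
    · rw [← h]; norm_num
    · positivity

theorem geodesicFrom_invExp_one (hn : 0 < n) {a b : Matrix (Fin n) (Fin n) ℝ} (ha : a.PosDef)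
    (hb : b.IsSymm) (hπ : angle a b < Real.pi) :
    geodesicFrom a (invExp a b) 1 = a * exp (a⁻¹ * b) := by
  obtain ⟨h1, h2⟩ := invExp_data hn ha hb
  have hn' : (0 : ℝ) < n := by exact_mod_cast hn
  have h0 := tr₁_traceless hn ha b
  have hE := Real.exp_pos (tr₁ a b / 4)
  conv_rhs => rw [eq_smul_add_traceless a b, mul_exp_smul_add ha]
  rw [geodesicFrom]
  simp only [h1, h2]
  by_cases h : traceless a b = 0
  · have e : invExp a b = (4 / (n : ℝ) * (Real.exp (tr₁ a b / 4) - 1)) • a + (0 : ℝ) • traceless a b := by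
      rw [invExp, if_pos h]; simp
    have h3 : traceless a (invExp a b) = 0 := by
      rw [e, traceless_smul_add hn ha h0, zero_smul]
    rw [if_pos h3, angle_of_traceless_eq_zero h, h, Matrix.mul_zero, exp_zero, Matrix.mul_one,
      Real.cos_zero, show 1 + 1 / 4 * (4 * (Real.exp (tr₁ a b / 4) * 1 - 1)) =
        Real.exp (tr₁ a b / 4) by ring, ← Real.exp_mul]
    congr 2
    field_simp
  · have hρ := angle_pos hn ha hb h
    have hs := Real.sin_pos_of_pos_of_lt_pi hρ hπ
    have e : invExp a b = (4 / (n : ℝ) * (Real.exp (tr₁ a b / 4) * Real.cos (angle a b) - 1)) • a +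
        (4 / (4 * angle a b) * Real.exp (tr₁ a b / 4) * Real.sin (angle a b)) • traceless a b := by
      rw [invExp, if_neg h, angle, mul_div_cancel₀ _ (by norm_num)]
    have h3 : traceless a (invExp a b) =
        (4 / (4 * angle a b) * Real.exp (tr₁ a b / 4) * Real.sin (angle a b)) • traceless a b := by
      rw [e, traceless_smul_add hn ha h0]
    have h4 : traceless a (invExp a b) ≠ 0 := by
      rw [h3]
      exact smul_ne_zero (by positivity) h
    rw [if_neg h4, Real.sqrt_sq (by positivity), h3]
    have harg : Complex.arg ⟨1 + 1 / 4 * (4 * (Real.exp (tr₁ a b / 4) * Real.cos (angle a b) - 1)),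
        1 / 4 * (4 * (Real.exp (tr₁ a b / 4) * Real.sin (angle a b)))⟩ = angle a b := by
      refine Eq.trans ?_ (Complex.arg_mul_cos_add_sin_mul_I hE (θ := angle a b) ⟨by linarith, hπ.le⟩)
      congr 1
      apply Complex.ext
      · simp [Complex.cos_ofReal_re, Complex.sin_ofReal_re, Complex.cos_ofReal_im,
          Complex.sin_ofReal_im, -Complex.ofReal_exp]
      · simp [Complex.cos_ofReal_re, Complex.sin_ofReal_re, Complex.cos_ofReal_im,
          Complex.sin_ofReal_im, -Complex.ofReal_exp]
    rw [harg, Matrix.mul_smul, smul_smul]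
    have hc : 4 / (4 * (Real.exp (tr₁ a b / 4) * Real.sin (angle a b))) * angle a b *
        (4 / (4 * angle a b) * Real.exp (tr₁ a b / 4) * Real.sin (angle a b)) = 1 := by
      field_simp
    rw [hc, one_smul]
    congr 1
    have hsq : (1 + 1 / 4 * (4 * (Real.exp (tr₁ a b / 4) * Real.cos (angle a b) - 1))) ^ 2 +
        (1 / 4 * (4 * (Real.exp (tr₁ a b / 4) * Real.sin (angle a b)))) ^ 2 =
        Real.exp (tr₁ a b / 2) := by
      rw [show Real.exp (tr₁ a b / 2) = Real.exp (tr₁ a b / 4) ^ 2 by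
        rw [← Real.exp_nat_mul]; congr 1; push_cast; ring]
      linear_combination Real.exp (tr₁ a b / 4) ^ 2 * Real.sin_sq_add_cos_sq (angle a b)
    rw [hsq, ← Real.exp_mul]
    congr 1
    field_simp

/-- By injectivity of the exponential on symmetric matrices, the logarithm of the modulus and the
argument of q(1) + ir(1) determine the trace and the traceless part of b. Reading these relations
backwards expresses v through b. -/
theorem eq_invExp (hn : 0 < n) {a b v : Matrix (Fin n) (Fin n) ℝ} (ha : a.PosDef)
    (hb : b.IsSymm) (hv : v.IsSymm) (hg : ∀ t ∈ Icc (0 : ℝ) 1, 0 < growth a v t)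
    (h : geodesicFrom a v 1 = a * exp (a⁻¹ * b)) : v = invExp a b := by
  have hn' : (0 : ℝ) < n := by exact_mod_cast hn
  have h0 := tr₁_traceless hn ha v
  by_cases hT : traceless a v = 0
  · have hq := affine_pos_of_growth_pos hT hg (right_mem_Icc.2 zero_le_one)
    rw [geodesicFrom, if_pos hT] at h
    set q := 1 + 1 / 4 * tr₁ a v with hqd
    have e : a * exp (a⁻¹ * ((4 / n * Real.log q) • a + (0 : ℝ) • traceless a v)) =
        a * exp (a⁻¹ * b) := by
      rw [← h, mul_exp_smul_add ha, zero_smul, Matrix.mul_zero, exp_zero, Matrix.mul_one,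
        Real.rpow_def_of_pos hq, mul_comm]
    have hb' := mul_exp_injective ha
      (((IsSymm_of_posDef ha).smul _).add ((isSymm_traceless ha hv).smul _)) hb e
    have hbT : traceless a b = 0 := by
      rw [← hb', traceless_smul_add hn ha h0, zero_smul]
    have hbt : tr₁ a b = 4 * Real.log q := by
      rw [← hb', tr₁_smul_add a _ ha h0]; field_simp
    rw [invExp, if_pos hbT, hbt, mul_div_cancel_left₀ _ (by norm_num), Real.exp_log hq]
    conv_lhs => rw [eq_smul_add_traceless a v, hT, add_zero]
    congr 1
    rw [hqd]
    field_simp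
    ring
  · have hτ := tr₂_pos ha (isSymm_traceless ha hv) hT
    have hm : 0 < (n : ℝ) * tr₂ a (traceless a v) (traceless a v) := mul_pos hn' hτ
    have hs := Real.sqrt_pos.2 hm
    have hs2 := Real.sq_sqrt hm.le
    rw [geodesicFrom, if_neg hT] at h
    set s := √(n * tr₂ a (traceless a v) (traceless a v))
    set z : ℂ := ⟨1 + 1 / 4 * tr₁ a v, 1 / 4 * s⟩ with hz
    have hz0 : z ≠ 0 := fun h => by
      have := congrArg Complex.im h
      simp only [hz, Complex.zero_im] at this
      linarith
    have hN : 0 < ‖z‖ := norm_pos_iff.2 hz0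
    have hNsq : (1 + 1 / 4 * tr₁ a v) ^ 2 + (1 / 4 * s) ^ 2 = ‖z‖ ^ 2 := by
      rw [← Complex.normSq_eq_norm_sq, Complex.normSq_apply]
      simp only [hz]
      ring
    have hθ : 0 < Complex.arg z := by
      refine lt_of_le_of_ne (Complex.arg_nonneg_iff.2 (by simp only [hz]; positivity)) fun h => ?_
      have := (Complex.arg_eq_zero_iff.1 h.symm).2
      simp only [hz] at this
      linarith
    have hcos := Complex.norm_mul_cos_arg z
    have hsin := Complex.norm_mul_sin_arg z
    set θ := Complex.arg z
    have e : a * exp (a⁻¹ * ((4 / n * Real.log ‖z‖) • a + (4 / s * θ) • traceless a v)) =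
        a * exp (a⁻¹ * b) := by
      rw [← h, mul_exp_smul_add ha, hNsq, Matrix.mul_smul, ← Real.rpow_natCast,
        ← Real.rpow_mul hN.le, Real.rpow_def_of_pos hN]
      congr 2
      push_cast
      ring
    have hb' := mul_exp_injective ha
      (((IsSymm_of_posDef ha).smul _).add ((isSymm_traceless ha hv).smul _)) hb e
    have hbT : traceless a b = (4 / s * θ) • traceless a v := by
      rw [← hb', traceless_smul_add hn ha h0]
    have hbt : tr₁ a b / 4 = Real.log ‖z‖ := by
      rw [← hb', tr₁_smul_add a _ ha h0]; field_simp
    have hbn : traceless a b ≠ 0 := by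
      rw [hbT]; exact smul_ne_zero (by positivity) hT
    have hρ : √(n * tr₂ a (traceless a b) (traceless a b)) = 4 * θ := by
      rw [hbT, tr₂_smul, mul_left_comm, ← hs2, ← mul_pow, Real.sqrt_sq (by positivity)]
      field_simp
    simp only [invExp]
    rw [if_neg hbn, hbt, hρ, mul_div_cancel_left₀ _ (by norm_num), Real.exp_log hN, hbT, smul_smul,
      mul_assoc (4 / (4 * θ)), hcos, hsin]
    conv_lhs => rw [eq_smul_add_traceless a v]
    have hc : 4 / (4 * θ) * (1 / 4 * s) * (4 / s * θ) = 1 := by field_simp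
    rw [hc, one_smul]
    congr 2
    simp only [hz]
    field_simp
    ring

/-! ### Upper bounds for the distance. -/

theorem metric_smul (k : ℝ) (a V : Matrix (Fin n) (Fin n) ℝ) :
    metric G a (k • V) (k • V) = k ^ 2 * metric G a V V := by
  rw [metric, metric, tr₂_smul, mul_assoc]

theorem dist_le_length {γ : ℝ → Matrix (Fin n) (Fin n) ℝ} (hγ : IsCurve 1 γ) {a b : Fiber G}
    (ha : γ 0 = a.val) (hb : γ 1 = b.val) : dist a b ≤ length G γ :=
  csInf_le ⟨0, fun _ h => h.nonneg⟩ (by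
    simpa using Joins.cons γ hγ a b b ha hb 0 (Joins.refl b))

theorem IsCurve.of_le {k l : ℕ} (h : k ≤ l) {γ : ℝ → Matrix (Fin n) (Fin n) ℝ} (hγ : IsCurve l γ) :
    IsCurve k γ :=
  ⟨fun i j => (hγ.contDiffOn i j).of_le (by exact_mod_cast h), hγ.posDef⟩

theorem dist_le_of_constant_speed {γ : ℝ → Matrix (Fin n) (Fin n) ℝ} (hγ : IsCurve 1 γ) {c : ℝ}
    (hc : ∀ t ∈ Icc (0 : ℝ) 1, √(metric G (γ t) (velocity γ t) (velocity γ t)) = c)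
    {s t : ℝ} (hs : 0 ≤ s) (hst : s ≤ t) (ht : t ≤ 1) {a b : Fiber G} (ha : γ s = a.val)
    (hb : γ t = b.val) : dist a b ≤ (t - s) * c := by
  have hm : MapsTo (fun x : ℝ => s + x * (t - s)) (Icc 0 1) (Icc 0 1) := fun x hx =>
    ⟨by nlinarith [hx.1], by nlinarith [hx.2]⟩
  have hδ : IsCurve 1 (fun x => γ (s + x * (t - s))) := by
    refine ⟨fun i j => ?_, fun x hx => hγ.posDef _ (hm hx)⟩
    exact (hγ.contDiffOn i j).comp (f := fun x : ℝ => s + x * (t - s)) (by fun_prop) hm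
  have hv : ∀ x ∈ Icc (0 : ℝ) 1, velocity (fun x => γ (s + x * (t - s))) x =
      (t - s) • velocity γ (s + x * (t - s)) := by
    intro x hx
    ext i j
    have h1 := hasDerivWithinAt_matrix.1 (hγ.velocity_hasDerivWithinAt le_rfl (hm hx)) i j
    have h2 : HasDerivWithinAt (fun x : ℝ => s + x * (t - s)) (t - s) (Icc 0 1) x :=
      ((((hasDerivAt_id x).mul_const (t - s)).const_add s).congr_deriv (one_mul _)).hasDerivWithinAt
    have h3 := (h1.comp x h2 hm).derivWithin (uniqueDiffOn_Icc zero_lt_one x hx)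
    rw [velocity, of_apply, Matrix.smul_apply, smul_eq_mul, mul_comm, ← h3]
    rfl
  refine (dist_le_length hδ (by simpa using ha) (by simpa using hb)).trans_eq ?_
  rw [length, intervalIntegral.integral_congr (g := fun _ => (t - s) * c) fun x hx => ?_]
  · simp
  · rw [uIcc_of_le zero_le_one] at hx
    simp only
    rw [hv x hx, metric_smul, Real.sqrt_mul (sq_nonneg _), Real.sqrt_sq (by linarith), hc _ (hm hx)]

/-- The dilation factor of the multiplication by `s`. -/
def dilation (n : ℕ) (s : ℝ) : ℝ := √√(s ^ n)

theorem det_smul_inv_mul (s : ℝ) (a : Matrix (Fin n) (Fin n) ℝ) :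
    (G⁻¹ * (s • a)).det = s ^ n * (G⁻¹ * a).det := by
  rw [Matrix.mul_smul, det_smul, Fintype.card_fin]

theorem radius_smul {s : ℝ} (hs : 0 ≤ s) (a : Matrix (Fin n) (Fin n) ℝ) :
    radius G (s • a) = dilation n s * radius G a := by
  rw [radius, radius, dilation, det_smul_inv_mul, Real.sqrt_mul (pow_nonneg hs n),
    Real.sqrt_mul (Real.sqrt_nonneg _)]
  ring

/-- The multiple of a point of the fiber by a positive number. -/
def Fiber.scale (a : Fiber G) {s : ℝ} (hs : 0 < s) : Fiber G := ⟨s • a.val, a.posDef.smul hs⟩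

/-- The two inverses cancel the scaling of the two vectors, and only the density changes.
Multiplication by s is thus a homothety with ratio `dilation n s`. -/
theorem metric_smul_smul {s : ℝ} (hs : 0 < s) {a : Matrix (Fin n) (Fin n) ℝ} (ha : a.PosDef)
    (V : Matrix (Fin n) (Fin n) ℝ) :
    metric G (s • a) (s • V) (s • V) = √(s ^ n) * metric G a V V := by
  have h : (s • a)⁻¹ = s⁻¹ • a⁻¹ := by
    refine inv_eq_left_inv ?_
    rw [Matrix.smul_mul, Matrix.mul_smul, nonsing_inv_mul _ (isUnit_det_of_posDef ha), smul_smul,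
      inv_mul_cancel₀ hs.ne', one_smul]
  rw [metric, metric, det_smul_inv_mul, Real.sqrt_mul (pow_nonneg hs.le n), tr₂, tr₂, h]
  simp only [Matrix.smul_mul, Matrix.mul_smul, smul_smul]
  rw [mul_inv_cancel₀ hs.ne', mul_one, mul_inv_cancel₀ hs.ne', one_smul]
  ring

theorem Joins.scale {a b : Fiber G} {L : ℝ} (h : Joins G a b L) {s : ℝ} (hs : 0 < s) :
    Joins G (a.scale hs) (b.scale hs) (dilation n s * L) := by
  induction h with
  | refl a => rw [mul_zero]; exact Joins.refl _
  | cons γ hγ a b c h₀ h₁ L h ih =>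
    have hv : ∀ t ∈ Icc (0 : ℝ) 1, velocity (fun t => s • γ t) t = s • velocity γ t := by
      intro t ht
      ext i j
      have h1 := (hasDerivWithinAt_matrix.1 (hγ.velocity_hasDerivWithinAt le_rfl ht) i j).const_mul s
      have h3 := h1.derivWithin (uniqueDiffOn_Icc zero_lt_one t ht)
      rw [velocity, of_apply, Matrix.smul_apply, smul_eq_mul, ← h3]
      rfl
    have hc : IsCurve 1 (fun t => s • γ t) :=
      ⟨fun i j => contDiffOn_const.mul (hγ.contDiffOn i j), fun t ht => (hγ.posDef t ht).smul hs⟩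
    have hl : length G (fun t => s • γ t) = dilation n s * length G γ := by
      rw [length, length, ← intervalIntegral.integral_const_mul]
      refine intervalIntegral.integral_congr fun t ht => ?_
      rw [uIcc_of_le zero_le_one] at ht
      rw [hv t ht, metric_smul_smul hs (hγ.posDef t ht), Real.sqrt_mul (Real.sqrt_nonneg _),
        dilation]
    rw [mul_add, ← hl]
    exact Joins.cons _ hc _ (b.scale hs) _ (by simp only [h₀]; rfl) (by simp only [h₁]; rfl) _ ih

theorem dist_scale_le (a b : Fiber G) {s : ℝ} (hs : 0 < s) :
    dist (a.scale hs) (b.scale hs) ≤ dilation n s * dist a b := by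
  have hd : 0 < dilation n s := by rw [dilation]; positivity
  rw [← div_le_iff₀' hd]
  refine le_csInf (exists_joins a b) fun L hL => ?_
  rw [div_le_iff₀' hd]
  exact csInf_le ⟨0, fun _ h => h.nonneg⟩ (hL.scale hs)

theorem exists_eq_mul_exp {a₀ a₁ : Matrix (Fin n) (Fin n) ℝ} (h₀ : a₀.PosDef) (h₁ : a₁.PosDef) :
    ∃ b : Matrix (Fin n) (Fin n) ℝ, b.IsSymm ∧ a₁ = a₀ * exp (a₀⁻¹ * b) := by
  obtain ⟨S, hS, rfl⟩ := exists_transpose_mul_self h₀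
  exact ⟨Sᵀ * chart S a₁ * S, isSymm_conj (isSymm_chart S a₁),
    (eq_exp_chart hS h₁).trans (mul_exp_conj hS _).symm⟩

theorem radius_mul_exp {a b : Matrix (Fin n) (Fin n) ℝ} (ha : a.PosDef) (hb : b.IsSymm) :
    radius G (a * exp (a⁻¹ * b)) = radius G a * Real.exp (tr₁ a b / 4) := by
  obtain ⟨S, hS, rfl⟩ := exists_transpose_mul_self ha
  obtain ⟨X, hX, rfl⟩ := exists_eq_conj hS hb
  rw [mul_exp_conj hS, radius_chartPoint hX, tr₁_conj hS]

/-- The left-hand side is r·|exp(tr_a(b)/4)·e^{iθ} − 1|, the length of the planar chord. -/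
theorem invExp_speed (hn : 0 < n) (hG : G.PosDef) {a b : Matrix (Fin n) (Fin n) ℝ} (ha : a.PosDef)
    (hb : b.IsSymm) : radius G a * √((tr₁ a (invExp a b) / 4) ^ 2 +
      n * tr₂ a (traceless a (invExp a b)) (traceless a (invExp a b)) / 16) =
    √(radius G a ^ 2 + radius G (a * exp (a⁻¹ * b)) ^ 2 -
      2 * radius G a * radius G (a * exp (a⁻¹ * b)) * Real.cos (angle a b)) := by
  obtain ⟨h1, h2⟩ := invExp_data hn ha hb
  have hr := (radius_pos hn hG ha).le
  rw [h1, h2, radius_mul_exp ha hb, ← Real.sqrt_sq hr, ← Real.sqrt_mul (sq_nonneg _),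
    Real.sqrt_sq hr]
  congr 1
  linear_combination radius G a ^ 2 * Real.exp (tr₁ a b / 4) ^ 2 * Real.sin_sq_add_cos_sq (angle a b)

theorem geodesicFrom_invExp (hn : 0 < n) (hG : G.PosDef) {a b : Matrix (Fin n) (Fin n) ℝ}
    (ha : a.PosDef) (hb : b.IsSymm) (hπ : angle a b < Real.pi) :
    IsRiemannianGeodesic G (geodesicFrom a (invExp a b)) ∧ geodesicFrom a (invExp a b) 0 = a ∧
      geodesicFrom a (invExp a b) 1 = a * exp (a⁻¹ * b) ∧
      ∀ t ∈ Icc (0 : ℝ) 1, √(metric G (geodesicFrom a (invExp a b) t)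
        (velocity (geodesicFrom a (invExp a b)) t) (velocity (geodesicFrom a (invExp a b)) t)) =
        √(radius G a ^ 2 + radius G (a * exp (a⁻¹ * b)) ^ 2 -
          2 * radius G a * radius G (a * exp (a⁻¹ * b)) * Real.cos (angle a b)) := by
  obtain ⟨h1, h2, h3⟩ := isRiemannianGeodesic_geodesicFrom hn hG ha (isSymm_invExp ha hb)
    fun t ht => growth_invExp hn ha hb hπ ht
  refine ⟨h1, h2, geodesicFrom_invExp_one hn ha hb hπ, fun t ht => ?_⟩
  rw [h3 t ht, invExp_speed hn hG ha hb]

theorem dist_le_of_angle_lt (hn : 0 < n) (hG : G.PosDef) {a₀ a₁ : Fiber G}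
    {b : Matrix (Fin n) (Fin n) ℝ} (hb : b.IsSymm) (h : a₁.val = a₀.val * exp (a₀.val⁻¹ * b))
    (hπ : angle a₀.val b < Real.pi) :
    dist a₀ a₁ ≤ √(radius G a₀.val ^ 2 + radius G a₁.val ^ 2 -
      2 * radius G a₀.val * radius G a₁.val * Real.cos (angle a₀.val b)) := by
  obtain ⟨h1, h2, h3, h4⟩ := geodesicFrom_invExp hn hG a₀.posDef hb hπ
  have := dist_le_of_constant_speed (G := G) (h1.isCurve.of_le (by norm_num)) h4 le_rfl zero_le_one
    le_rfl (a := a₀) (b := a₁) h2 (h3.trans h.symm)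
  rw [h]
  simpa using this

theorem mul_exp_smul_self {a : Matrix (Fin n) (Fin n) ℝ} (ha : a.PosDef) {s : ℝ} (hs : 0 < s) :
    s • a = a * exp (a⁻¹ * (Real.log s • a)) := by
  have := mul_exp_smul_add ha (Real.log s) 0
  rw [add_zero, Matrix.mul_zero, exp_zero, Matrix.mul_one, Real.exp_log hs] at this
  exact this.symm

theorem angle_smul_self (hn : 0 < n) {a : Matrix (Fin n) (Fin n) ℝ} (ha : a.PosDef) (c : ℝ) :
    angle a (c • a) = 0 := by
  refine angle_of_traceless_eq_zero ?_
  have := traceless_smul_add hn ha (T := 0) (by simp [tr₁]) c 0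
  simpa using this

theorem dist_scale_self_le (hn : 0 < n) (hG : G.PosDef) (a : Fiber G) {s : ℝ} (hs : 0 < s) :
    dist a (a.scale hs) ≤ |radius G a.val - radius G (s • a.val)| := by
  have h := dist_le_of_angle_lt (a₁ := a.scale hs) hn hG ((IsSymm_of_posDef a.posDef).smul (Real.log s))
    (mul_exp_smul_self a.posDef hs) (by rw [angle_smul_self hn a.posDef]; exact Real.pi_pos)
  rw [angle_smul_self hn a.posDef, Real.cos_zero] at h
  refine h.trans_eq ?_
  rw [← Real.sqrt_sq_eq_abs]
  congr 1
  change _ + radius G (s • a.val) ^ 2 - 2 * _ * radius G (s • a.val) * 1 = _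
  ring

/-- Shrink both points by a fixed factor, with dilation ratio η < 1. The two radial legs cost (1 −
η) times the sum of the radii and the remaining distance is at most η·dist, so the triangle
inequality can be solved for dist. -/
theorem dist_le_radius_add_radius (hn : 0 < n) (hG : G.PosDef) (a b : Fiber G) :
    dist a b ≤ radius G a.val + radius G b.val := by
  have hs : (0 : ℝ) < 1 / 2 := by norm_num
  set η := dilation n (1 / 2)
  have hη : η < 1 := by
    have h1 : ((1 : ℝ) / 2) ^ n < 1 := pow_lt_one₀ (by norm_num) (by norm_num) hn.ne'
    simp only [η, dilation]
    rw [Real.sqrt_lt' one_pos, one_pow, Real.sqrt_lt' one_pos, one_pow]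
    exact h1
  have hra := radius_pos hn hG a.posDef
  have hrb := radius_pos hn hG b.posDef
  have h1 := dist_scale_self_le hn hG a hs
  have h2 := dist_scale_self_le hn hG b hs
  have h3 := dist_scale_le a b hs
  rw [radius_smul hs.le, abs_of_nonneg (by nlinarith)] at h1 h2
  have h4 : dist a b ≤ dist a (a.scale hs) + dist (a.scale hs) (b.scale hs) +
      dist b (b.scale hs) := by
    rw [dist_comm b]; exact dist_triangle4 _ _ _ _
  have h5 : (1 - η) * dist a b ≤ (1 - η) * (radius G a.val + radius G b.val) := by
    linarith
  exact le_of_mul_le_mul_left h5 (by linarith)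

/-! ### Lower bounds and the distance formula. -/

theorem trace_mul_sq_le {E H : Matrix (Fin n) (Fin n) ℝ} (hE : E.IsSymm) (hH : H.IsSymm) :
    (E * H).trace ^ 2 ≤ (E * E).trace * (H * H).trace := by
  rcases (trace_sq_nonneg hE).eq_or_lt with h | h
  · rw [eq_zero_of_trace_sq hE h.ge]
    simp
  · have h1 := trace_sq_nonneg ((hH.smul (E * E).trace).sub (hE.smul (E * H).trace))
    simp only [Matrix.sub_mul, Matrix.mul_sub, Matrix.smul_mul, Matrix.mul_smul, trace_sub,
      trace_smul, smul_eq_mul] at h1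
    rw [trace_mul_comm H E] at h1
    nlinarith

theorem clamp_sub_sq_le (α β x y : ℝ) :
    (max α (min β x) - max α (min β y)) ^ 2 ≤ (x - y) ^ 2 := by
  refine sq_le_sq.2 ?_
  rw [max_comm α, max_comm α, min_comm β, min_comm β]
  exact (abs_sup_sub_sup_le_abs _ _ _).trans (abs_inf_sub_inf_le_abs _ _ _)

theorem trace_mul_eq_trace_mul_dev {E : Matrix (Fin n) (Fin n) ℝ} (hE : E.trace = 0)
    (X : Matrix (Fin n) (Fin n) ℝ) : (E * X).trace = (E * dev X).trace := by
  rw [dev, Matrix.mul_sub, Matrix.mul_smul, Matrix.mul_one, trace_sub, trace_smul, hE, smul_zero,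
    sub_zero]

/-- A traceless E sees only traceless parts, where Cauchy–Schwarz applies, and clamping does not
increase differences. The factor √n/4 is the angular scale of the cone. -/
theorem isShort_clamp (hn : 0 < n) {E : Matrix (Fin n) (Fin n) ℝ} (hE : E.IsSymm)
    (hE0 : E.trace = 0) (hE1 : (E * E).trace ≤ 1) (α β : ℝ) :
    IsShort fun X => max α (min β (√n / 4 * (E * X).trace)) := by
  intro X Y hX hY
  refine (clamp_sub_sq_le _ _ _ _).trans ?_
  have hs := isSymm_dev (hX.sub hY)
  have h1 := trace_mul_sq_le hE hs
  have h2 := trace_sq_nonneg hs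
  have h3 := trace_sq_dev hn (X - Y)
  rw [trace_sub] at h3
  rw [← h3, ← mul_sub, ← trace_sub, ← Matrix.mul_sub, trace_mul_eq_trace_mul_dev hE0, mul_pow,
    div_pow, Real.sq_sqrt (Nat.cast_nonneg n)]
  norm_num
  refine mul_le_mul_of_nonneg_left ?_ (by positivity)
  nlinarith

/-- The unit vector in the direction of a traceless matrix. -/
theorem exists_direction {H : Matrix (Fin n) (Fin n) ℝ} (hH : H.IsSymm) (h0 : H.trace = 0) :
    ∃ E : Matrix (Fin n) (Fin n) ℝ, E.IsSymm ∧ E.trace = 0 ∧ (E * E).trace ≤ 1 ∧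
      (E * H).trace = √(H * H).trace := by
  have hnn := trace_sq_nonneg hH
  refine ⟨(√(H * H).trace)⁻¹ • H, hH.smul _, by rw [trace_smul, h0, smul_zero], ?_, ?_⟩
  · rw [Matrix.smul_mul, Matrix.mul_smul, trace_smul, trace_smul, smul_eq_mul, smul_eq_mul]
    rcases hnn.eq_or_lt with h | h
    · rw [← h]; simp
    · have := Real.sqrt_pos.2 h
      have h2 := Real.mul_self_sqrt hnn
      refine le_of_eq ?_
      field_simp
      rw [pow_two, h2]
  · rw [Matrix.smul_mul, trace_smul, smul_eq_mul]
    rcases hnn.eq_or_lt with h | h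
    · rw [← h]; simp
    · have := Real.sqrt_pos.2 h
      have h2 := Real.mul_self_sqrt hnn
      field_simp
      rw [pow_two, h2]

/-- The law of cosines as a lower bound for the distance. -/
theorem law_of_cosines_le (hn : 0 < n) (hG : G.PosDef) {S : Matrix (Fin n) (Fin n) ℝ}
    (hS : IsUnit S) (a b : Fiber G) :
    radius G a.val ^ 2 + radius G b.val ^ 2 - 2 * radius G a.val * radius G b.val *
      Real.cos (min (√n / 4 * √(dev (chart S b.val - chart S a.val) *
        dev (chart S b.val - chart S a.val)).trace) Real.pi) ≤ dist a b ^ 2 := by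
  set H := dev (chart S b.val - chart S a.val)
  obtain ⟨E, hE, hE0, hE1, hEH⟩ := exists_direction (H := H)
    (isSymm_dev ((isSymm_chart _ _).sub (isSymm_chart _ _))) (trace_dev hn _)
  set α := √n / 4 * (E * chart S a.val).trace
  have hb : √n / 4 * (E * chart S b.val).trace = α + √n / 4 * √(H * H).trace := by
    rw [← hEH]
    simp only [H, α]
    rw [← trace_mul_eq_trace_mul_dev hE0, Matrix.mul_sub, trace_sub]
    ring
  -- Clamping between the value α at a and α + π keeps the planar angle in [0, π]; otherwise a large
  -- angle would wrap around the plane and weaken the bound.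
  have hφ := isShort_clamp hn hE hE0 hE1 α (α + Real.pi)
  have h1 := norm_develop_sub_le_dist hn hG hS hφ a b
  have h2 := pow_le_pow_left₀ (norm_nonneg _) h1 2
  rw [develop, develop, norm_polar_sub_sq] at h2
  have ea : max α (min (α + Real.pi) α) = α := by
    rw [min_eq_right (by linarith [Real.pi_pos]), max_self]
  have eb : max α (min (α + Real.pi) (α + √n / 4 * √(H * H).trace)) =
      α + min (√n / 4 * √(H * H).trace) Real.pi := by
    rw [min_add_add_left, min_comm, max_eq_right]
    have : 0 ≤ min (√n / 4 * √(H * H).trace) Real.pi := le_min (by positivity) Real.pi_pos.le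
    linarith
  simp only [hb] at h2
  change _ - 2 * _ * _ * Real.cos (max α (min (α + Real.pi) _) - max α (min (α + Real.pi) α)) ≤ _ at h2
  rw [ea, eb, add_sub_cancel_left] at h2
  linarith

theorem angle_conj {S : Matrix (Fin n) (Fin n) ℝ} (hS : IsUnit S)
    (X : Matrix (Fin n) (Fin n) ℝ) :
    angle (Sᵀ * S) (Sᵀ * X * S) = √n / 4 * √(dev X * dev X).trace := by
  rw [angle, traceless_conj hS, tr₂_conj hS, Real.sqrt_mul (Nat.cast_nonneg n)]
  ring

theorem le_dist_sq (hn : 0 < n) (hG : G.PosDef) {a₀ a₁ : Fiber G}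
    {b : Matrix (Fin n) (Fin n) ℝ} (hb : b.IsSymm) (h : a₁.val = a₀.val * exp (a₀.val⁻¹ * b)) :
    radius G a₀.val ^ 2 + radius G a₁.val ^ 2 - 2 * radius G a₀.val * radius G a₁.val *
      Real.cos (min (angle a₀.val b) Real.pi) ≤ dist a₀ a₁ ^ 2 := by
  obtain ⟨S, hS, hS₀⟩ := exists_transpose_mul_self a₀.posDef
  obtain ⟨X, hX, rfl⟩ := exists_eq_conj hS hb
  have h1 := law_of_cosines_le hn hG hS a₀ a₁
  have h2 : chart S a₁.val = X := by
    rw [h, hS₀, mul_exp_conj hS, chart_chartPoint hS hX]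
  have h3 : chart S a₀.val = 0 := by rw [hS₀, chart_self hS]
  rw [h2, h3, sub_zero, ← angle_conj hS, ← hS₀] at h1
  exact h1

theorem dist_of_angle_lt (hn : 0 < n) (hG : G.PosDef) {a₀ a₁ : Fiber G}
    {b : Matrix (Fin n) (Fin n) ℝ} (hb : b.IsSymm) (h : a₁.val = a₀.val * exp (a₀.val⁻¹ * b))
    (hπ : angle a₀.val b < Real.pi) :
    dist a₀ a₁ = √(radius G a₀.val ^ 2 + radius G a₁.val ^ 2 -
      2 * radius G a₀.val * radius G a₁.val * Real.cos (angle a₀.val b)) := by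
  refine le_antisymm (dist_le_of_angle_lt hn hG hb h hπ) ?_
  have := le_dist_sq hn hG hb h
  rw [min_eq_left hπ.le] at this
  exact Real.sqrt_le_iff.2 ⟨dist_nonneg, this⟩

theorem dist_of_le_angle (hn : 0 < n) (hG : G.PosDef) {a₀ a₁ : Fiber G}
    {b : Matrix (Fin n) (Fin n) ℝ} (hb : b.IsSymm) (h : a₁.val = a₀.val * exp (a₀.val⁻¹ * b))
    (hπ : Real.pi ≤ angle a₀.val b) :
    dist a₀ a₁ = radius G a₀.val + radius G a₁.val := by
  refine le_antisymm (dist_le_radius_add_radius hn hG _ _) ?_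
  have h1 := le_dist_sq hn hG hb h
  rw [min_eq_right hπ, Real.cos_pi] at h1
  refine abs_le_of_sq_le_sq' (a := radius G a₀.val + radius G a₁.val) ?_ dist_nonneg |>.2
  linarith

/-- With cos ≤ 1 the law of cosines leaves only the squared difference of the radii; the base point
1 of the coordinates is arbitrary. -/
theorem abs_radius_sub_radius_le_dist (hn : 0 < n) (hG : G.PosDef) (a b : Fiber G) :
    |radius G a.val - radius G b.val| ≤ dist a b := by
  refine abs_le_of_sq_le_sq (le_trans ?_ (law_of_cosines_le hn hG isUnit_one a b)) dist_nonneg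
  have := mul_pos (radius_pos hn hG a.posDef) (radius_pos hn hG b.posDef)
  have h2 := Real.cos_le_one (min (√n / 4 * √(dev (chart 1 b.val - chart 1 a.val) *
        dev (chart 1 b.val - chart 1 a.val)).trace) Real.pi)
  nlinarith

theorem dist_scale_self (hn : 0 < n) (hG : G.PosDef) (a : Fiber G) {s : ℝ} (hs : 0 < s) :
    dist a (a.scale hs) = |radius G a.val - radius G (s • a.val)| :=
  le_antisymm (dist_scale_self_le hn hG a hs) (abs_radius_sub_radius_le_dist hn hG a (a.scale hs))

/-! ### Rigidity of the development. -/

/-- If the development is isometric along the distance from the base point, then the point lies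
in the direction `E`. -/
theorem dev_chart_eq (hn : 0 < n) (hG : G.PosDef) {S E : Matrix (Fin n) (Fin n) ℝ}
    (hS : IsUnit S) (hE : E.IsSymm) (hE0 : E.trace = 0) (hE1 : (E * E).trace ≤ 1) {θ : ℝ}
    (hθ : 0 ≤ θ) (hθπ : θ < Real.pi) {p m : Fiber G} (hp : p.val = Sᵀ * S)
    (h : dist p m = ‖develop G S (fun X => max 0 (min θ (√n / 4 * (E * X).trace))) m.val -
      develop G S (fun X => max 0 (min θ (√n / 4 * (E * X).trace))) p.val‖) :
    dev (chart S m.val) =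
      (4 * max 0 (min θ (√n / 4 * (E * chart S m.val).trace)) / √n) • E := by
  have hn' : (0 : ℝ) < √n := Real.sqrt_pos.2 (by exact_mod_cast hn)
  set M := chart S m.val
  have hM : M.IsSymm := isSymm_chart _ _
  set φ := max 0 (min θ (√n / 4 * (E * M).trace)) with hφ
  have hφ0 : 0 ≤ φ := le_max_left _ _
  have hφθ : φ ≤ θ := max_le hθ (min_le_left _ _)
  have h0 : chart S p.val = 0 := by rw [hp, chart_self hS]
  have h1 := law_of_cosines_le hn hG hS p m
  rw [h, develop, develop, norm_polar_sub_sq, h0, sub_zero] at h1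
  simp only [trace_zero, mul_zero, min_eq_right hθ, max_self, sub_zero] at h1
  have hr := mul_pos (radius_pos hn hG p.posDef) (radius_pos hn hG m.posDef)
  set N := √(dev M * dev M).trace with hN
  have hN0 : 0 ≤ N := Real.sqrt_nonneg _
  have hNsq : N ^ 2 = (dev M * dev M).trace := Real.sq_sqrt (trace_sq_nonneg (isSymm_dev hM))
  -- The planar distance, with angle φ, is the true distance, which is at least the law-of-cosines
  -- value with the full angle. So the full angle of m, capped at π, does not exceed φ < π.
  have h2 : Real.cos φ ≤ Real.cos (min (√n / 4 * N) Real.pi) := by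
    have : radius G p.val * radius G m.val * Real.cos φ ≤
      radius G p.val * radius G m.val * Real.cos (min (√n / 4 * N) Real.pi) := by
      linarith
    exact le_of_mul_le_mul_left this hr
  have h3 : min (√n / 4 * N) Real.pi ≤ φ :=
    (Real.strictAntiOn_cos.le_iff_ge ⟨hφ0, hφθ.trans hθπ.le⟩
      ⟨le_min (by positivity) Real.pi_pos.le, min_le_right _ _⟩).1 h2
  have h4 : √n / 4 * N ≤ φ := by
    rcases min_le_iff.1 h3 with h | h
    · exact h
    · linarith
  set k := 4 * φ / √n with hk
  have hNk : N ≤ k := by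
    rw [hk, le_div_iff₀ hn']; linarith
  have hk0 : 0 ≤ k := by positivity
  -- With N = |dev M| ≤ k, tr(E·dev M) ≥ k and tr(E²) ≤ 1, the squared norm of dev M − kE is at most
  -- k² − 2k² + k² = 0. For k = 0 already N = 0.
  rw [← sub_eq_zero]
  refine eq_zero_of_trace_sq ((isSymm_dev hM).sub (hE.smul k)) ?_
  simp only [Matrix.sub_mul, Matrix.mul_sub, Matrix.smul_mul, Matrix.mul_smul, trace_sub,
      trace_smul, smul_eq_mul]
  rw [trace_mul_comm (dev M) E, ← hNsq]
  rcases hk0.eq_or_lt with h | h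
  · rw [← h] at hNk ⊢
    nlinarith
  · have hφ1 : 0 < φ := by
      by_contra h'
      rw [le_antisymm (not_lt.1 h') hφ0] at hk
      simp [hk] at h
    -- As φ is positive, the lower clamp is inactive, and the upper clamp can only decrease the
    -- value.
    have h5 : φ ≤ √n / 4 * (E * M).trace := by
      rcases le_max_iff.1 hφ.le with h' | h'
      · linarith
      · exact h'.trans (min_le_right _ _)
    rw [trace_mul_eq_trace_mul_dev hE0] at h5
    have h6 : k ≤ (E * dev M).trace := by
      rw [hk, div_le_iff₀ hn']; linarith
    have h7 : N ^ 2 ≤ k ^ 2 := by nlinarith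
    nlinarith [mul_le_mul_of_nonneg_left h6 hk0, mul_le_mul_of_nonneg_left hE1 (sq_nonneg k)]

/-- A point between two points with angle less than `π` is determined by its development. -/
theorem eq_of_develop_eq (hn : 0 < n) (hG : G.PosDef) {S E : Matrix (Fin n) (Fin n) ℝ}
    (hS : IsUnit S) (hE : E.IsSymm) (hE0 : E.trace = 0) (hE1 : (E * E).trace ≤ 1) {θ : ℝ}
    (hθ : 0 ≤ θ) (hθπ : θ < Real.pi) {p m m' : Fiber G} (hp : p.val = Sᵀ * S)
    (h : dist p m = ‖develop G S (fun X => max 0 (min θ (√n / 4 * (E * X).trace))) m.val -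
      develop G S (fun X => max 0 (min θ (√n / 4 * (E * X).trace))) p.val‖)
    (h' : dist p m' = ‖develop G S (fun X => max 0 (min θ (√n / 4 * (E * X).trace))) m'.val -
      develop G S (fun X => max 0 (min θ (√n / 4 * (E * X).trace))) p.val‖)
    (he : develop G S (fun X => max 0 (min θ (√n / 4 * (E * X).trace))) m.val =
      develop G S (fun X => max 0 (min θ (√n / 4 * (E * X).trace))) m'.val) : m = m' := by
  have h1 := dev_chart_eq hn hG hS hE hE0 hE1 hθ hθπ hp h
  have h2 := dev_chart_eq hn hG hS hE hE0 hE1 hθ hθπ hp h'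
  set φ := max 0 (min θ (√n / 4 * (E * chart S m.val).trace)) with hφ
  set φ' := max 0 (min θ (√n / 4 * (E * chart S m'.val).trace)) with hφ'
  have hr := radius_pos hn hG m.posDef
  have hr' := radius_pos hn hG m'.posDef
  have he' : (radius G m.val : ℂ) * Complex.exp (φ * Complex.I) =
    radius G m'.val * Complex.exp (φ' * Complex.I) := he
  have hR : radius G m.val = radius G m'.val := by
    have := congrArg norm he'
    rw [norm_mul, norm_mul, Complex.norm_exp_ofReal_mul_I, Complex.norm_exp_ofReal_mul_I, mul_one,
      mul_one, Complex.norm_of_nonneg hr.le, Complex.norm_of_nonneg hr'.le] at this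
    exact this
  have hφe : φ = φ' := by
    rw [hR] at he'
    have h3 := mul_left_cancel₀ (Complex.ofReal_ne_zero.2 hr'.ne') he'
    have h4 := congrArg Complex.re h3
    rw [Complex.exp_ofReal_mul_I_re, Complex.exp_ofReal_mul_I_re] at h4
    exact Real.injOn_cos ⟨le_max_left _ _, (max_le hθ (min_le_left _ _)).trans hθπ.le⟩
      ⟨le_max_left _ _, (max_le hθ (min_le_left _ _)).trans hθπ.le⟩ h4
  have hM : chart S m.val = chart S m'.val := by
    have e (X : Matrix (Fin n) (Fin n) ℝ) : X = dev X + (X.trace / n) • 1 := by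
      rw [dev, sub_add_cancel]
    rw [e (chart S m.val), e (chart S m'.val), h1, h2, hφe, trace_chart hn hG hS m.posDef,
      trace_chart hn hG hS m'.posDef, hR]
  obtain ⟨x, hx⟩ := m
  obtain ⟨y, hy⟩ := m'
  congr 1
  rw [eq_exp_chart hS hx, eq_exp_chart hS hy]
  simp only at hM
  rw [hM]

/-! ### Unique minimal paths in a metric space. -/

section

variable {X : Type*} [MetricSpace X] {p q : X}

theorem IsMinimal.dist_add_dist {γ : Path p q} (h : IsMinimal γ) {s t u : unitInterval}
    (hst : s ≤ t) (htu : t ≤ u) : dist (γ s) (γ t) + dist (γ t) (γ u) = dist (γ s) (γ u) := by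
  have h1 := eVariationOn.Icc_add_Icc (f := γ) (s := univ) hst htu (mem_univ t)
  simp only [univ_inter] at h1
  rw [h s t hst, h t u htu, h s u (hst.trans htu), edist_dist, edist_dist, edist_dist,
    ← ENNReal.ofReal_add dist_nonneg dist_nonneg] at h1
  exact (ENNReal.ofReal_eq_ofReal_iff (add_nonneg dist_nonneg dist_nonneg) dist_nonneg).1 h1

/-- Here h plays the role of arc length: the bounds on its increments add up to the distance of the
end points, hence all are equalities. Every point of a minimal path lies between p and q, so by `hb`
on g, and its parameter is recovered from its distance to p. -/
theorem exists_isUniqueMinimal (g : unitInterval → X) (h : unitInterval → ℝ) (hc : Continuous h)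
    (hs : StrictMono h ∨ p = q) (h0 : g 0 = p) (h1 : g 1 = q)
    (hd : ∀ s t, s ≤ t → dist (g s) (g t) ≤ h t - h s) (hD : h 1 - h 0 = dist p q)
    (hb : ∀ m, dist p m + dist m q = dist p q → ∃ t, g t = m) :
    ∃ γ : Path p q, (∀ t, γ t = g t) ∧ IsUniqueMinimal γ := by
  have hde : ∀ s t, s ≤ t → dist (g s) (g t) = h t - h s := by
    intro s t hst
    refine le_antisymm (hd s t hst) ?_
    have h2 := hd 0 s unitInterval.nonneg'
    have h3 := hd t 1 unitInterval.le_one'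
    have h4 := dist_triangle4 (g 0) (g s) (g t) (g 1)
    rw [h0, h1] at *
    linarith
  have habs : ∀ s t, dist (g s) (g t) = dist (h s) (h t) := by
    intro s t
    rcases le_total s t with hst | hst
    · rw [hde s t hst, dist_comm, Real.dist_eq, abs_of_nonneg]
      rw [← hde s t hst]; exact dist_nonneg
    · rw [dist_comm, hde t s hst, Real.dist_eq, abs_of_nonneg]
      rw [← hde t s hst]; exact dist_nonneg
  have hgc : Continuous g := by
    refine continuous_iff_continuousAt.2 fun s => tendsto_iff_dist_tendsto_zero.2 ?_
    simp only [habs]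
    exact tendsto_iff_dist_tendsto_zero.1 hc.continuousAt
  have hmono : Monotone h := fun s t hst => by
    have := hde s t hst ▸ dist_nonneg (x := g s) (y := g t)
    linarith
  refine ⟨⟨⟨g, hgc⟩, h0, h1⟩, fun t => rfl, ?_, ?_⟩
  · intro s t hst
    refine le_antisymm ?_ (eVariationOn.edist_le _ (left_mem_Icc.2 hst) (right_mem_Icc.2 hst))
    have h2 := ((hmono.monotoneOn (Icc s t)).eVariationOn_eq (left_mem_Icc.2 hst)
      (right_mem_Icc.2 hst)).le
    rw [inter_self] at h2
    have h3 : eVariationOn g (Icc s t) = eVariationOn h (Icc s t) := by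
      have h5 (x y : unitInterval) : edist (g x) (g y) = edist (h x) (h y) := by
        rw [edist_dist, edist_dist, habs]
      simp only [eVariationOn, h5]
    change eVariationOn g (Icc s t) ≤ edist (g s) (g t)
    rw [h3, edist_dist, hde s t hst]
    exact h2
  · intro γ' hγ'
    have hbt : ∀ t, dist p (γ' t) + dist (γ' t) q = dist p q := fun t => by
      have := hγ'.dist_add_dist (s := 0) (t := t) (u := 1) unitInterval.nonneg' unitInterval.le_one'
      simpa using this
    rcases hs with hs | hpq
    · choose φ hφ using fun t => hb _ (hbt t)
      have hφd : ∀ t, h (φ t) = h 0 + dist p (γ' t) := fun t => by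
        have := hde 0 (φ t) unitInterval.nonneg'
        rw [h0, hφ] at this
        linarith
      -- Compactness of the interval makes h an embedding, so φ is continuous as soon as h ∘ φ is,
      -- which up to a constant is the distance from p.
      have hemb := hc.isClosedEmbedding hs.injective
      refine ⟨φ, hemb.isInducing.continuous_iff.2 ?_, ?_, ?_, ?_, fun t => (hφ t).symm⟩
      · have : h ∘ φ = fun t => h 0 + dist p (γ' t) := funext hφd
        rw [this]
        exact continuous_const.add (continuous_const.dist γ'.continuous)
      · intro s t hst
        rw [← hs.le_iff_le, hφd, hφd]
        have := hγ'.dist_add_dist (s := 0) (t := s) (u := t) unitInterval.nonneg' hst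
        simp only [Path.source] at this
        linarith [dist_nonneg (x := γ' s) (y := γ' t)]
      · refine hs.injective ?_
        rw [hφd, Path.source, dist_self, add_zero]
      · refine hs.injective ?_
        rw [hφd, Path.target]
        linarith
    · refine ⟨id, continuous_id, monotone_id, rfl, rfl, fun t => ?_⟩
      have h2 := hbt t
      have h3 : dist p (γ' t) = 0 := by
        have h5 : dist p q = 0 := by rw [dist_eq_zero, hpq]
        linarith [dist_nonneg (x := p) (y := γ' t), dist_nonneg (x := γ' t) (y := q)]
      have h4 : dist (g 0) (g t) = 0 := by
        refine le_antisymm ?_ dist_nonneg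
        rw [hde 0 t unitInterval.nonneg']
        have := hmono (unitInterval.le_one' (t := t))
        rw [hpq, dist_self] at hD
        linarith
      change γ' t = g t
      rw [← dist_eq_zero.1 h3, ← dist_eq_zero.1 h4, h0]

end

/-! ### The singular point and the completion. -/

theorem dilation_continuous : Continuous (dilation n) :=
  (continuous_pow n).sqrt.sqrt

theorem dilation_zero (hn : 0 < n) : dilation n 0 = 0 := by
  rw [dilation, zero_pow hn.ne', Real.sqrt_zero, Real.sqrt_zero]

theorem dilation_one : dilation n 1 = 1 := by simp [dilation]

theorem dilation_strictMonoOn (hn : 0 < n) : StrictMonoOn (dilation n) (Ici 0) := by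
  intro x hx y _ hxy
  have h1 := pow_lt_pow_left₀ hxy hx hn.ne'
  have h2 := pow_nonneg (mem_Ici.1 hx) n
  exact Real.sqrt_lt_sqrt (Real.sqrt_nonneg _) (Real.sqrt_lt_sqrt h2 h1)

theorem Fiber.ext_val {a b : Fiber G} (h : a.val = b.val) : a = b := by
  cases a; cases b; cases h; rfl

theorem dist_scale_scale (hn : 0 < n) (hG : G.PosDef) (a : Fiber G) {s s' : ℝ} (hs : 0 < s)
    (hs' : 0 < s') : dist (a.scale hs) (a.scale hs') =
      |dilation n s * radius G a.val - dilation n s' * radius G a.val| := by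
  have e : a.scale hs' = (a.scale hs).scale (div_pos hs' hs) := by
    refine Fiber.ext_val ?_
    simp only [Fiber.scale, smul_smul]
    rw [div_mul_cancel₀ _ hs.ne']
  have h := dist_scale_self hn hG (a.scale hs) (div_pos hs' hs)
  rw [← e] at h
  rw [h, ← radius_smul hs.le, ← radius_smul hs'.le]
  congr 2
  simp only [Fiber.scale, smul_smul]
  rw [div_mul_cancel₀ _ hs.ne']

/-- The singular point. -/
theorem exists_origin (hn : 0 < n) (hG : G.PosDef) :
    ∃ z : CompletedFiber G, ∀ a : Fiber G, dist (a : CompletedFiber G) z = radius G a.val := by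
  -- Any point of the fiber would serve: its multiples by 1/(k+1) form a Cauchy sequence descending
  -- its ray. The distance of a from the k-th multiple differs from the radius of a by at most the
  -- radius of that multiple.
  set o : Fiber G := ⟨G, hG⟩
  have hk (k : ℕ) : (0 : ℝ) < 1 / ((k : ℝ) + 1) := Nat.one_div_pos_of_nat
  set u : ℕ → Fiber G := fun k => o.scale (hk k)
  have hR : Tendsto (fun k : ℕ => dilation n (1 / ((k : ℝ) + 1)) * radius G o.val) atTop (𝓝 0) := by
    have := ((dilation_continuous (n := n)).tendsto 0).comp
      (tendsto_one_div_add_atTop_nhds_zero_nat (𝕜 := ℝ))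
    rw [dilation_zero hn] at this
    simpa using this.mul_const (radius G o.val)
  have hc : CauchySeq u := by
    have h1 := Metric.cauchySeq_iff.1 hR.cauchySeq
    refine Metric.cauchySeq_iff.2 fun ε hε => ?_
    obtain ⟨N, hN⟩ := h1 ε hε
    refine ⟨N, fun i hi j hj => ?_⟩
    rw [dist_scale_scale hn hG]
    exact hN i hi j hj
  obtain ⟨z, hz⟩ := cauchySeq_tendsto_of_complete (u := fun k => (u k : CompletedFiber G))
    (hc.map (UniformSpace.Completion.uniformContinuous_coe (Fiber G)))
  refine ⟨z, fun a => ?_⟩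
  have h2 : Tendsto (fun k => dist (a : CompletedFiber G) (u k : CompletedFiber G)) atTop
      (𝓝 (dist (a : CompletedFiber G) z)) := tendsto_const_nhds.dist hz
  have hru (k : ℕ) : radius G (u k).val = dilation n (1 / ((k : ℝ) + 1)) * radius G o.val :=
    radius_smul (hk k).le _
  have h3 : Tendsto (fun k => dist a (u k)) atTop (𝓝 (radius G a.val)) := by
    refine tendsto_of_tendsto_of_tendsto_of_le_of_le
      (g := fun k : ℕ => radius G a.val - dilation n (1 / ((k : ℝ) + 1)) * radius G o.val)
      (h := fun k : ℕ => radius G a.val + dilation n (1 / ((k : ℝ) + 1)) * radius G o.val)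
      (by simpa using tendsto_const_nhds.sub hR) (by simpa using tendsto_const_nhds.add hR)
      (fun k => ?_) fun k => ?_
    · beta_reduce
      rw [← hru]
      exact (le_abs_self _).trans (abs_radius_sub_radius_le_dist hn hG a (u k))
    · beta_reduce
      rw [← hru]
      exact dist_le_radius_add_radius hn hG a (u k)
  simp only [UniformSpace.Completion.dist_eq] at h2
  exact tendsto_nhds_unique h2 h3

/-- The development with trivial angle. -/
theorem develop_zero (S a : Matrix (Fin n) (Fin n) ℝ) :
    develop G S (fun X => max 0 (min 0 (√n / 4 * ((0 : Matrix (Fin n) (Fin n) ℝ) * X).trace))) a =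
      radius G a := by
  simp [develop]

/-- For E = 0 and θ = 0 the development is just the radius, which is equal for points at distance
zero; rigidity then identifies the points. -/
theorem eq_of_dist_eq_zero (hn : 0 < n) (hG : G.PosDef) {a b : Fiber G} (h : dist a b = 0) :
    a = b := by
  obtain ⟨S, hS, hS₀⟩ := exists_transpose_mul_self a.posDef
  have h1 := abs_radius_sub_radius_le_dist hn hG a b
  rw [h, abs_nonpos_iff, sub_eq_zero] at h1
  refine eq_of_develop_eq hn hG hS (E := 0) isSymm_zero (by simp) (by simp) le_rfl Real.pi_pos hS₀
    ?_ ?_ ?_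
  · rw [dist_self, sub_self, norm_zero]
  · simp only [develop_zero]
    rw [h, h1, sub_self, norm_zero]
  · simp only [develop_zero, h1]

/-- Points whose distance is the difference of their radii lie on a common ray. -/
theorem exists_scale_eq (hn : 0 < n) (hG : G.PosDef) {p m : Fiber G}
    (h : dist p m = |radius G p.val - radius G m.val|) :
    ∃ (s : ℝ) (hs : 0 < s), p.scale hs = m := by
  obtain ⟨S, hS, hS₀⟩ := exists_transpose_mul_self p.posDef
  have h1 := dev_chart_eq hn hG hS (E := 0) isSymm_zero (by simp) (by simp) le_rfl Real.pi_pos hS₀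
    (m := m) (by
      simp only [develop_zero]
      rw [h, ← Complex.ofReal_sub, Complex.norm_real, Real.norm_eq_abs, abs_sub_comm])
  rw [smul_zero, dev, sub_eq_zero] at h1
  refine ⟨Real.exp ((chart S m.val).trace / n), Real.exp_pos _, Fiber.ext_val ?_⟩
  refine Eq.trans ?_ (eq_exp_chart hS m.posDef).symm
  conv_rhs => rw [h1, ← add_zero (_ • _), exp_smul_one_add, exp_zero]
  simp only [Fiber.scale, hS₀, Matrix.mul_smul, Matrix.smul_mul, Matrix.mul_one]

/-- The trace bound forces the angles to 0 and the radius is continuous, so the exact distance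
formula, valid once the angle is below π, tends to 0. -/
theorem tendsto_dist_of_tendsto_val (hn : 0 < n) (hG : G.PosDef) {u : ℕ → Fiber G} {a : Fiber G}
    (h : Tendsto (fun k => (u k).val) atTop (𝓝 a.val)) :
    Tendsto (fun k => dist a (u k)) atTop (𝓝 0) := by
  obtain ⟨S, hS, hS₀⟩ := exists_transpose_mul_self a.posDef
  set X : ℕ → Matrix (Fin n) (Fin n) ℝ := fun k => chart S (u k).val
  set b : ℕ → Matrix (Fin n) (Fin n) ℝ := fun k => Sᵀ * X k * S
  have hb (k : ℕ) : (b k).IsSymm := isSymm_conj (isSymm_chart _ _)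
  have hub (k : ℕ) : (u k).val = a.val * exp (a.val⁻¹ * b k) := by
    rw [hS₀, mul_exp_conj hS]
    exact eq_exp_chart hS (u k).posDef
  have hinv : Tendsto (fun k => ((u k).val)⁻¹) atTop (𝓝 (a.val)⁻¹) :=
    (continuousAt_inv a.posDef.isUnit).tendsto.comp h
  have hT : Tendsto (fun k => (a.val⁻¹ * (u k).val).trace + ((u k).val⁻¹ * a.val).trace - 2 * n)
      atTop (𝓝 0) := by
    have h1 := ((continuous_id.matrix_trace).tendsto _).comp
      ((tendsto_const_nhds (x := a.val⁻¹)).mul h)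
    have h2 := ((continuous_id.matrix_trace).tendsto _).comp
      (hinv.mul (tendsto_const_nhds (x := a.val)))
    have h3 := (h1.add h2).sub_const (2 * (n : ℝ))
    simp only [id, nonsing_inv_mul _ (isUnit_det_of_posDef a.posDef), trace_one,
      Fintype.card_fin] at h3
    rw [show (n : ℝ) + n - 2 * n = 0 by ring] at h3
    exact h3
  have hang : Tendsto (fun k => angle a.val (b k)) atTop (𝓝 0) := by
    have h1 : Tendsto (fun k => √n / 4 * √((a.val⁻¹ * (u k).val).trace +
        ((u k).val⁻¹ * a.val).trace - 2 * n)) atTop (𝓝 0) := by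
      have := (hT.sqrt).const_mul (√n / 4)
      simpa using this
    refine squeeze_zero (fun k => by rw [angle]; positivity) (fun k => ?_) h1
    conv_lhs => rw [hS₀]
    rw [angle_conj hS]
    refine mul_le_mul_of_nonneg_left (Real.sqrt_le_sqrt ?_) (by positivity)
    have h2 := trace_chart_sub_sq_le hS a.posDef (u k).posDef
    rw [hS₀, chart_self hS, ← hS₀, zero_sub, Matrix.neg_mul, Matrix.mul_neg, neg_neg] at h2
    rw [trace_sq_dev hn]
    have : 0 ≤ (X k).trace ^ 2 / n := by positivity
    linarith
  have hr : Tendsto (fun k => radius G (u k).val) atTop (𝓝 (radius G a.val)) :=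
    (continuous_radius.tendsto _).comp h
  have h4 := (((tendsto_const_nhds (x := radius G a.val ^ 2)).add (hr.pow 2)).sub
    ((hr.const_mul (2 * radius G a.val)).mul ((Real.continuous_cos.tendsto 0).comp hang))).sqrt
  rw [Real.cos_zero, show radius G a.val ^ 2 + radius G a.val ^ 2 -
    2 * radius G a.val * radius G a.val * 1 = 0 by ring, Real.sqrt_zero] at h4
  refine h4.congr' ?_
  filter_upwards [hang.eventually_lt_const Real.pi_pos] with k hk
  exact (dist_of_angle_lt hn hG (hb k) (hub k) hk).symm

theorem coe_injective (hn : 0 < n) (hG : G.PosDef) :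
    Function.Injective (fun a : Fiber G => (a : CompletedFiber G)) := by
  intro a b h
  refine eq_of_dist_eq_zero hn hG ?_
  rw [← UniformSpace.Completion.dist_eq]
  exact dist_eq_zero.2 h

/-- In the exponential coordinates at a fixed point, the traceless parts of nearby points away from
the singular point are close. -/
theorem sqrt_trace_dev_le (hn : 0 < n) (hG : G.PosDef) {S : Matrix (Fin n) (Fin n) ℝ}
    (hS : IsUnit S) {R : ℝ} (hR : 0 < R) {a b : Fiber G} (ha : R ≤ radius G a.val)
    (hb : R ≤ radius G b.val) (hd : dist a b < R) :
    √(dev (chart S b.val - chart S a.val) * dev (chart S b.val - chart S a.val)).trace ≤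
      4 / √n * (Real.pi / (2 * R)) * dist a b := by
  have hn' : (0 : ℝ) < √n := Real.sqrt_pos.2 (by exact_mod_cast hn)
  have h1 := law_of_cosines_le hn hG hS a b
  set N := √(dev (chart S b.val - chart S a.val) * dev (chart S b.val - chart S a.val)).trace
  set x := min (√n / 4 * N) Real.pi with hx
  have hx0 : 0 ≤ x := le_min (by positivity) Real.pi_pos.le
  have hxπ : x ≤ Real.pi := min_le_right _ _
  -- The bound cos x ≤ 1 − (2/π²)x² on [−π, π] turns the law of cosines into a linear bound for the
  -- capped angle x. The hypothesis dist a b < R then gives x < π, so the cap is inactive.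
  have h2 := Real.cos_le_one_sub_mul_cos_sq (x := x) (by rwa [abs_of_nonneg hx0])
  have h3 : R * R ≤ radius G a.val * radius G b.val := mul_le_mul ha hb hR.le (hR.le.trans ha)
  have hπ := Real.pi_pos
  have h0 : 0 ≤ 2 / Real.pi ^ 2 * x ^ 2 := by positivity
  have h4 : (2 * R / Real.pi * x) ^ 2 ≤ dist a b ^ 2 := by
    have e : (2 * R / Real.pi * x) ^ 2 = 2 * (R * R) * (2 / Real.pi ^ 2 * x ^ 2) := by
      field_simp
    rw [e]
    nlinarith [mul_le_mul_of_nonneg_right h3 h0, sq_nonneg (radius G a.val - radius G b.val),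
      mul_le_mul_of_nonneg_left h2 (mul_nonneg (hR.le.trans ha) (hR.le.trans hb))]
  have h5 : 2 * R / Real.pi * x ≤ dist a b := (sq_le_sq₀ (by positivity) dist_nonneg).1 h4
  have h6 : x ≤ Real.pi / (2 * R) * dist a b := by
    rw [div_mul_eq_mul_div, div_le_iff₀ hπ] at h5
    rw [div_mul_eq_mul_div, le_div_iff₀ (by positivity)]
    linarith
  have h7 : Real.pi / (2 * R) * dist a b < Real.pi := by
    rw [div_mul_eq_mul_div, div_lt_iff₀ (by positivity)]
    nlinarith
  have h8 : √n / 4 * N ≤ Real.pi / (2 * R) * dist a b := by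
    rcases min_le_iff.1 h6 with h | h
    · exact h
    · linarith
  rw [mul_assoc]
  calc N = 4 / √n * (√n / 4 * N) := by field_simp
    _ ≤ _ := mul_le_mul_of_nonneg_left h8 (by positivity)

/-- Approximate y by points of the fiber. Their radii tend to R = dist y z > 0, so the traces of
their coordinates converge. Away from the apex the traceless parts are controlled by the distance,
so they are Cauchy. The coordinates therefore have a limit, whose exponential is y. -/
theorem exists_coe_eq (hn : 0 < n) (hG : G.PosDef) {z : CompletedFiber G}
    (hz : ∀ a : Fiber G, dist (a : CompletedFiber G) z = radius G a.val) {y : CompletedFiber G}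
    (hy : y ≠ z) : ∃ a : Fiber G, (a : CompletedFiber G) = y := by
  obtain ⟨w, hw, hwy⟩ := mem_closure_iff_seq_limit.1
    (UniformSpace.Completion.denseRange_coe (α := Fiber G) y)
  choose u hu using hw
  have huy : Tendsto (fun k => (u k : CompletedFiber G)) atTop (𝓝 y) := by
    simpa only [hu] using hwy
  have hR0 : 0 < dist y z := dist_pos.2 hy
  set R := dist y z
  have hrad : Tendsto (fun k => radius G (u k).val) atTop (𝓝 R) := by
    have := huy.dist (tendsto_const_nhds (x := z))
    simpa only [hz] using this
  have hcau : ∀ ε > 0, ∃ N, ∀ i ≥ N, ∀ j ≥ N, dist (u i) (u j) < ε := by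
    have := Metric.cauchySeq_iff.1 huy.cauchySeq
    simpa only [UniformSpace.Completion.dist_eq] using this
  set X : ℕ → Matrix (Fin n) (Fin n) ℝ := fun k => chart 1 (u k).val
  have hX (k : ℕ) : (X k).IsSymm := isSymm_chart _ _
  obtain ⟨N₁, hN₁⟩ := eventually_atTop.1 (hrad.eventually_const_le (half_lt_self hR0))
  set K := 4 / √n * (Real.pi / (2 * (R / 2)))
  have hK : 0 < K := by
    have hn' : (0 : ℝ) < √n := Real.sqrt_pos.2 (by exact_mod_cast hn)
    have := Real.pi_pos
    positivity
  have hdev : ∀ i j, CauchySeq fun k => dev (X k) i j := by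
    intro i j
    refine Metric.cauchySeq_iff.2 fun ε hε => ?_
    obtain ⟨N₂, hN₂⟩ := hcau (min (R / 2) (ε / K)) (lt_min (half_pos hR0) (div_pos hε hK))
    refine ⟨max N₁ N₂, fun k hk l hl => ?_⟩
    have h1 := hN₂ k (le_of_max_le_right hk) l (le_of_max_le_right hl)
    have h2 := sqrt_trace_dev_le hn hG isUnit_one (half_pos hR0) (hN₁ k (le_of_max_le_left hk))
      (hN₁ l (le_of_max_le_left hl)) (h1.trans_le (min_le_left _ _))
    have h3 := Real.abs_le_sqrt (sq_apply_le_trace_sq (isSymm_dev ((hX l).sub (hX k))) i j)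
    have h4 : dev (X l - X k) i j = dev (X l) i j - dev (X k) i j := by
      simp only [dev, trace_sub, Matrix.sub_apply, Matrix.smul_apply, smul_eq_mul]
      ring
    rw [h4] at h3
    rw [dist_comm, Real.dist_eq]
    calc _ ≤ _ := h3
      _ ≤ K * dist (u k) (u l) := h2
      _ < K * (ε / K) := mul_lt_mul_of_pos_left (h1.trans_le (min_le_right _ _)) hK
      _ = ε := by field_simp
  choose D hD using fun i j => cauchySeq_tendsto_of_complete (hdev i j)
  have htr : Tendsto (fun k => (X k).trace) atTop
      (𝓝 (4 * (Real.log R - Real.log (radius G ((1 : Matrix (Fin n) (Fin n) ℝ)ᵀ * 1))))) := by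
    have := ((hrad.log hR0.ne').sub_const
      (Real.log (radius G ((1 : Matrix (Fin n) (Fin n) ℝ)ᵀ * 1)))).const_mul 4
    refine this.congr fun k => ?_
    exact (trace_chart hn hG isUnit_one (u k).posDef).symm
  set τ := 4 * (Real.log R - Real.log (radius G ((1 : Matrix (Fin n) (Fin n) ℝ)ᵀ * 1)))
  set Y : Matrix (Fin n) (Fin n) ℝ := Matrix.of D + (τ / n) • 1
  have hXY : Tendsto X atTop (𝓝 Y) := by
    have h1 : Tendsto (fun k => dev (X k)) atTop (𝓝 (Matrix.of D)) :=
      tendsto_pi_nhds.2 fun i => tendsto_pi_nhds.2 fun j => hD i j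
    refine (h1.add ((htr.div_const (n : ℝ)).smul_const 1)).congr fun k => ?_
    rw [dev, sub_add_cancel]
  have hY : Y.IsSymm := by
    have h1 : Tendsto (fun k => (X k)ᵀ) atTop (𝓝 Yᵀ) :=
      (continuous_id.matrix_transpose.tendsto Y).comp hXY
    refine tendsto_nhds_unique (h1.congr fun k => (hX k).eq) hXY
  set a : Fiber G := ⟨exp Y, posDef_exp hY⟩
  have hexp : Continuous (exp : Matrix (Fin n) (Fin n) ℝ → Matrix (Fin n) (Fin n) ℝ) :=
    open scoped Matrix.Norms.Operator in exp_continuous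
  have hua : Tendsto (fun k => (u k).val) atTop (𝓝 a.val) := by
    refine ((hexp.tendsto Y).comp hXY).congr fun k => ?_
    have := eq_exp_chart (isUnit_one (M := Matrix (Fin n) (Fin n) ℝ)) (u k).posDef
    rw [transpose_one, Matrix.one_mul, Matrix.mul_one] at this
    exact this.symm
  have hlim : Tendsto (fun k => (u k : CompletedFiber G)) atTop (𝓝 (a : CompletedFiber G)) := by
    refine tendsto_iff_dist_tendsto_zero.2 ?_
    simp only [UniformSpace.Completion.dist_eq]
    exact (tendsto_dist_of_tendsto_val hn hG hua).congr fun k => dist_comm _ _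
  exact ⟨a, tendsto_nhds_unique hlim huy⟩

theorem range_coe (hn : 0 < n) (hG : G.PosDef) {z : CompletedFiber G}
    (hz : ∀ a : Fiber G, dist (a : CompletedFiber G) z = radius G a.val) :
    range (fun a : Fiber G => (a : CompletedFiber G)) = {z}ᶜ := by
  ext y
  constructor
  · rintro ⟨a, rfl⟩ h
    have h1 := hz a
    rw [show (a : CompletedFiber G) = z from h, dist_self] at h1
    exact (radius_pos hn hG a.posDef).ne h1
  · exact fun h => exists_coe_eq hn hG hz h

/-! ### Rays and intermediate points. -/

theorem angle_lt_pi_iff {a b : Matrix (Fin n) (Fin n) ℝ} (hn : 0 < n) :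
    angle a b < Real.pi ↔ tr₂ a (traceless a b) (traceless a b) < (4 * Real.pi) ^ 2 / n := by
  have hn' : (0 : ℝ) < n := by exact_mod_cast hn
  rw [angle, div_lt_iff₀ (by norm_num), Real.sqrt_lt' (by positivity), lt_div_iff₀ hn', mul_comm,
    mul_comm Real.pi]

theorem rayPoint_of_pos (z : CompletedFiber G) (a : Fiber G) {s : ℝ} (hs : 0 < s) :
    rayPoint z a s = (a.scale hs : CompletedFiber G) := by
  rw [rayPoint, dif_pos hs]; rfl

theorem rayPoint_zero (z : CompletedFiber G) (a : Fiber G) : rayPoint z a 0 = z := by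
  rw [rayPoint, dif_neg (lt_irrefl 0)]

theorem rayPoint_one (z : CompletedFiber G) (a : Fiber G) :
    rayPoint z a 1 = (a : CompletedFiber G) := by
  rw [rayPoint_of_pos z a one_pos]
  congr 1
  exact Fiber.ext_val (one_smul _ _)

theorem dist_rayPoint (hn : 0 < n) (hG : G.PosDef) {z : CompletedFiber G}
    (hz : ∀ a : Fiber G, dist (a : CompletedFiber G) z = radius G a.val) (a : Fiber G) {s s' : ℝ}
    (hs : 0 ≤ s) (hs' : s ≤ s') : dist (rayPoint z a s) (rayPoint z a s') =
      dilation n s' * radius G a.val - dilation n s * radius G a.val := by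
  rcases hs.eq_or_lt with h | h
  · rw [← h, rayPoint_zero, dilation_zero hn, zero_mul, sub_zero]
    rcases (hs.trans hs').eq_or_lt with h' | h'
    · rw [← h', rayPoint_zero, dist_self, dilation_zero hn, zero_mul]
    · rw [rayPoint_of_pos z a h', dist_comm, hz]
      exact radius_smul h'.le _
  · have h' := h.trans_le hs'
    rw [rayPoint_of_pos z a h, rayPoint_of_pos z a h', UniformSpace.Completion.dist_eq,
      dist_scale_scale hn hG, abs_sub_comm, abs_of_nonneg]
    rw [← sub_mul]
    exact mul_nonneg (sub_nonneg.2 ((dilation_strictMonoOn hn).monotoneOn hs h'.le hs'))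
      (radius_pos hn hG a.posDef).le

/-- A point whose distance from `p` is the decrease of the radius lies on the ray through `p`. -/
theorem exists_rayPoint_eq (hn : 0 < n) (hG : G.PosDef) (z : CompletedFiber G) {p m : Fiber G}
    (h : dist p m = radius G p.val - radius G m.val) :
    ∃ s ∈ Icc (0 : ℝ) 1, rayPoint z p s = (m : CompletedFiber G) := by
  have h0 : 0 ≤ radius G p.val - radius G m.val := h ▸ dist_nonneg
  obtain ⟨s, hs, rfl⟩ := exists_scale_eq hn hG (h.trans (abs_of_nonneg h0).symm)
  refine ⟨s, ⟨hs.le, ?_⟩, rayPoint_of_pos z p hs⟩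
  by_contra! h1
  have h2 := dilation_strictMonoOn hn (mem_Ici.2 zero_le_one) (mem_Ici.2 hs.le) h1
  have h3 : radius G (p.scale hs).val = dilation n s * radius G p.val := radius_smul hs.le _
  rw [h3] at h0
  rw [dilation_one] at h2
  nlinarith [radius_pos hn hG p.posDef]

/-- The setting for comparison with the plane: exponential coordinates at `p`, in which `q` lies in
the direction `E` at distance `angle p b`. -/
theorem exists_comparison (hn : 0 < n) {p q : Fiber G}
    {b : Matrix (Fin n) (Fin n) ℝ} (hb : b.IsSymm) (h : q.val = p.val * exp (p.val⁻¹ * b)) :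
    ∃ S E : Matrix (Fin n) (Fin n) ℝ, IsUnit S ∧ p.val = Sᵀ * S ∧ E.IsSymm ∧ E.trace = 0 ∧
      (E * E).trace ≤ 1 ∧ √n / 4 * (E * chart S q.val).trace = angle p.val b := by
  obtain ⟨S, hS, hS₀⟩ := exists_transpose_mul_self p.posDef
  obtain ⟨X, hX, rfl⟩ := exists_eq_conj hS hb
  have h2 : chart S q.val = X := by
    rw [h, hS₀, mul_exp_conj hS, chart_chartPoint hS hX]
  obtain ⟨E, hE, hE0, hE1, hEH⟩ := exists_direction (isSymm_dev hX) (trace_dev hn X)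
  refine ⟨S, E, hS, hS₀, hE, hE0, hE1, ?_⟩
  rw [h2, trace_mul_eq_trace_mul_dev hE0, hEH, hS₀, angle_conj hS]

theorem angle_nonneg (a b : Matrix (Fin n) (Fin n) ℝ) : 0 ≤ angle a b := by
  rw [angle]; positivity

theorem develop_base {S E : Matrix (Fin n) (Fin n) ℝ} (hS : IsUnit S) {θ : ℝ} (hθ : 0 ≤ θ) :
    develop G S (fun X => max 0 (min θ (√n / 4 * (E * X).trace))) (Sᵀ * S) =
      radius G (Sᵀ * S) := by
  simp [develop, chart_self hS, hθ]

theorem develop_target {S E a : Matrix (Fin n) (Fin n) ℝ} {θ α : ℝ} (hθ : 0 ≤ θ) (hα : θ ≤ α)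
    (h : √n / 4 * (E * chart S a).trace = α) :
    develop G S (fun X => max 0 (min θ (√n / 4 * (E * X).trace))) a =
      radius G a * Complex.exp (θ * Complex.I) := by
  rw [develop, h, min_eq_left hα, max_eq_right hθ]

theorem norm_sub_polar_sq (r s x : ℝ) :
    ‖(r : ℂ) - s * Complex.exp (x * Complex.I)‖ ^ 2 =
      r ^ 2 + s ^ 2 - 2 * r * s * Real.cos x := by
  have := norm_polar_sub_sq r s 0 x
  rw [zero_sub, Real.cos_neg] at this
  rw [← this]
  simp

/-- Points between `p` and `q` lie on every path realizing the distance linearly, if the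
angle is less than `π`. -/
theorem exists_eq_of_dist_add_dist (hn : 0 < n) (hG : G.PosDef) {p q : Fiber G}
    {b : Matrix (Fin n) (Fin n) ℝ} (hb : b.IsSymm) (h : q.val = p.val * exp (p.val⁻¹ * b))
    (hπ : angle p.val b < Real.pi) {σ : unitInterval → Fiber G}
    (hσp : ∀ t : unitInterval, dist p (σ t) = t * dist p q)
    (hσq : ∀ t : unitInterval, dist (σ t) q = (1 - t) * dist p q) {m : Fiber G}
    (hm : dist p m + dist m q = dist p q) : ∃ t, σ t = m := by
  obtain ⟨S, E, hS, hS₀, hE, hE0, hE1, hq⟩ := exists_comparison hn hb h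
  have hφ := isShort_clamp hn hE hE0 hE1 0 (angle p.val b)
  have hθ := angle_nonneg p.val b
  set P := develop G S (fun X => max 0 (min (angle p.val b) (√n / 4 * (E * X).trace))) with hP
  have hle (x y : Fiber G) : dist (P x.val) (P y.val) ≤ dist x y := by
    rw [dist_comm, dist_eq_norm]
    exact norm_develop_sub_le_dist hn hG hS hφ x y
  -- The clamp at the angle of q is exactly attained by q, so the planar distance is the
  -- law-of-cosines value, that is, the true distance.
  have hpq : dist (P p.val) (P q.val) = dist p q := by
    rw [dist_of_angle_lt hn hG hb h hπ, hP]
    conv_lhs => rw [hS₀]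
    rw [← hS₀, develop_target hθ le_rfl hq, hS₀, develop_base hS (hS₀ ▸ hθ), ← hS₀, dist_eq_norm,
      ← norm_sub_polar_sq, Real.sqrt_sq (norm_nonneg _)]
  have hbetween (x : Fiber G) (hx : dist p x + dist x q = dist p q) :
      dist (P p.val) (P x.val) = dist p x ∧ dist (P x.val) (P q.val) = dist x q := by
    have h1 := hle p x
    have h2 := hle x q
    have h3 := dist_triangle (P p.val) (P x.val) (P q.val)
    constructor <;> linarith
  obtain ⟨hm1, hm2⟩ := hbetween m hm
  -- P does not increase distances and preserves that of p and q, so equality propagates to m.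
  -- Strict convexity of the plane puts P m on the segment, where it coincides with the image of σ
  -- at the same ratio.
  have hw : Wbtw ℝ (P p.val) (P m.val) (P q.val) := by
    rw [← dist_add_dist_eq_iff]; linarith
  obtain ⟨r, hr, hrm⟩ := hw
  refine ⟨⟨r, hr⟩, ?_⟩
  obtain ⟨hs1, hs2⟩ := hbetween (σ ⟨r, hr⟩) (by rw [hσp, hσq]; ring)
  have hs : P (σ ⟨r, hr⟩).val = P m.val := by
    rw [← hrm]
    refine eq_lineMap_of_dist_eq_mul_of_dist_eq_mul ?_ ?_
    · rw [hs1, hpq, hσp]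
    · rw [hs2, hpq, hσq]
  refine eq_of_develop_eq hn hG hS hE hE0 hE1 hθ hπ hS₀ ?_ ?_ hs
  · rw [← hs1, dist_comm, dist_eq_norm]
  · rw [← hm1, dist_comm, dist_eq_norm]

/-- Points between `p` and `q` lie on the ray of `p` or of `q`, if the angle is at least `π`. -/
theorem radial_of_dist_add_dist (hn : 0 < n) (hG : G.PosDef) {p q : Fiber G}
    {b : Matrix (Fin n) (Fin n) ℝ} (hb : b.IsSymm) (h : q.val = p.val * exp (p.val⁻¹ * b))
    (hπ : Real.pi ≤ angle p.val b) {m : Fiber G} (hm : dist p m + dist m q = dist p q) :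
    dist p m = radius G p.val - radius G m.val ∨ dist q m = radius G q.val - radius G m.val := by
  obtain ⟨S, E, hS, hS₀, hE, hE0, hE1, hq⟩ := exists_comparison hn hb h
  have hφ := isShort_clamp hn hE hE0 hE1 0 Real.pi
  set P := develop G S (fun X => max 0 (min Real.pi (√n / 4 * (E * X).trace))) with hP
  have hle (x y : Fiber G) : dist (P x.val) (P y.val) ≤ dist x y := by
    rw [dist_comm, dist_eq_norm]
    exact norm_develop_sub_le_dist hn hG hS hφ x y
  have hRp := radius_pos hn hG p.posDef
  have hRq := radius_pos hn hG q.posDef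
  have hRm := radius_pos hn hG m.posDef
  have hPp : P p.val = (radius G p.val : ℂ) := by
    rw [hP, hS₀, develop_base hS Real.pi_pos.le]
  have hPq : P q.val = ((-radius G q.val : ℝ) : ℂ) := by
    rw [hP, develop_target Real.pi_pos.le hπ hq, Complex.exp_pi_mul_I]
    simp
  have hpq : dist (P p.val) (P q.val) = dist p q := by
    rw [dist_of_le_angle hn hG hb h hπ, hPp, hPq, dist_eq_norm, ← Complex.ofReal_sub,
      Complex.norm_real, Real.norm_eq_abs, abs_of_pos (by linarith)]
    ring
  have h1 := hle p m
  have h2 := hle m q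
  have h3 := dist_triangle (P p.val) (P m.val) (P q.val)
  have hw : Wbtw ℝ (P p.val) (P m.val) (P q.val) := by
    rw [← dist_add_dist_eq_iff]; linarith
  have hm1 : dist (P p.val) (P m.val) = dist p m := by linarith
  obtain ⟨r, -, hr⟩ := hw
  set φ := max 0 (min Real.pi (√n / 4 * (E * chart S m.val).trace))
  have hPm : P m.val = radius G m.val * Complex.exp (φ * Complex.I) := rfl
  -- The images of p and q are real, on opposite sides of 0, so the image of m between them is real
  -- too; thus φ is 0 or π modulo 2π, that is, m is radial from p or from q.
  have him : radius G m.val * Real.sin φ = 0 := by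
    have := congrArg Complex.im hr
    rw [hPm, hPp, hPq, AffineMap.lineMap_apply] at this
    simp only [vsub_eq_sub, vadd_eq_add, ← Complex.ofReal_sub, Complex.add_im,
      Complex.ofReal_im, Complex.real_smul, Complex.im_ofReal_mul, Complex.exp_ofReal_mul_I_im,
      mul_zero, add_zero] at this
    exact this.symm
  have hsin := (mul_eq_zero.1 him).resolve_left hRm.ne'
  have hd : dist p m ^ 2 = radius G p.val ^ 2 + radius G m.val ^ 2 -
      2 * radius G p.val * radius G m.val * Real.cos φ := by
    rw [← hm1, hPp, hPm, dist_eq_norm, norm_sub_polar_sq]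
  have hsum := dist_of_le_angle hn hG hb h hπ
  have hdp := dist_nonneg (x := p) (y := m)
  rcases (Real.sin_eq_zero_iff_cos_eq).1 hsin with hc | hc
  · left
    rw [hc] at hd
    have h4 : dist p m ^ 2 = (radius G p.val - radius G m.val) ^ 2 := by rw [hd]; ring
    rcases sq_eq_sq_iff_eq_or_eq_neg.1 h4 with h5 | h5
    · exact h5
    -- If m were farther from the apex than p, the leg from m to q would have length at least the
    -- sum of their radii, and the total would be too long; so this sign leaves only equal radii.
    · have h6 := norm_polar_sub_sq (radius G m.val) (radius G q.val) φ Real.pi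
      rw [Real.cos_sub_pi, hc] at h6
      have h7 : dist (P m.val) (P q.val) ^ 2 = (radius G m.val + radius G q.val) ^ 2 := by
        rw [hPm, hP, develop_target Real.pi_pos.le hπ hq, dist_eq_norm, h6]; ring
      have h8 := (sq_eq_sq₀ dist_nonneg (by linarith)).1 h7
      linarith
  · right
    rw [hc] at hd
    have h4 : dist p m ^ 2 = (radius G p.val + radius G m.val) ^ 2 := by rw [hd]; ring
    have h5 := (sq_eq_sq₀ hdp (by linarith)).1 h4
    rw [dist_comm]
    linarith

/-! ### Minimal paths in the completed fiber. -/

variable {z : CompletedFiber G}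

/-- The minimal path in the regular case. -/
theorem exists_isUniqueMinimal_geodesicFrom (hn : 0 < n) (hG : G.PosDef)
    (hz : ∀ a : Fiber G, dist (a : CompletedFiber G) z = radius G a.val)
    (hr : range (fun a : Fiber G => (a : CompletedFiber G)) = {z}ᶜ) {p q : Fiber G}
    {b : Matrix (Fin n) (Fin n) ℝ} (hb : b.IsSymm) (h : q.val = p.val * exp (p.val⁻¹ * b))
    (hπ : angle p.val b < Real.pi) :
    ∃ γ : Path (p : CompletedFiber G) (q : CompletedFiber G),
      (∀ t : unitInterval, ∃ c : Fiber G, c.val = geodesicFrom p.val (invExp p.val b) t ∧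
        γ t = (c : CompletedFiber G)) ∧ IsUniqueMinimal γ := by
  obtain ⟨h1, h2, h3, h4⟩ := geodesicFrom_invExp hn hG p.posDef hb hπ
  rw [← h, ← dist_of_angle_lt hn hG hb h hπ] at h4
  set σ : unitInterval → Fiber G := fun t =>
    ⟨geodesicFrom p.val (invExp p.val b) t, h1.isCurve.posDef t t.2⟩ with hσ
  have hle (s t : unitInterval) (hst : s ≤ t) : dist (σ s) (σ t) ≤ (t - s) * dist p q :=
    dist_le_of_constant_speed (h1.isCurve.of_le (by norm_num)) h4 s.2.1 hst t.2.2 rfl rfl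
  have hσ0 : σ 0 = p := Fiber.ext_val h2
  have hσ1 : σ 1 = q := Fiber.ext_val (h3.trans h.symm)
  have hp (t : unitInterval) : dist p (σ t) = t * dist p q ∧
      dist (σ t) q = (1 - t) * dist p q := by
    have e1 := hle 0 t unitInterval.nonneg'
    have e2 := hle t 1 unitInterval.le_one'
    rw [hσ0] at e1
    rw [hσ1] at e2
    have e3 := dist_triangle p (σ t) q
    simp only [Set.Icc.coe_zero, Set.Icc.coe_one, sub_zero] at e1 e2
    constructor <;> linarith
  obtain ⟨γ, hγ, hγ'⟩ := exists_isUniqueMinimal (p := (p : CompletedFiber G))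
    (q := (q : CompletedFiber G)) (fun t => (σ t : CompletedFiber G)) (fun t => t * dist p q)
    (by fun_prop) (by
      rcases (dist_nonneg (x := p) (y := q)).eq_or_lt with h0 | h0
      · right
        rw [eq_of_dist_eq_zero hn hG h0.symm]
      · left
        intro s t hst
        exact mul_lt_mul_of_pos_right hst h0)
    (by rw [hσ0]) (by rw [hσ1])
    (fun s t hst => by
      rw [UniformSpace.Completion.dist_eq, ← sub_mul]
      exact hle s t hst)
    (by rw [UniformSpace.Completion.dist_eq]; simp)
    (fun m hm => by
      by_cases hmz : m = z
      -- The apex is not between p and q: for angle below π the distance is strictly less than the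
      -- sum of the radii.
      · exfalso
        rw [hmz, dist_comm z, hz, hz, UniformSpace.Completion.dist_eq,
          dist_of_angle_lt hn hG hb h hπ] at hm
        have hRp := radius_pos hn hG p.posDef
        have hRq := radius_pos hn hG q.posDef
        have e1 : -1 < Real.cos (angle p.val b) := by
          rw [← Real.cos_pi]
          exact Real.strictAntiOn_cos ⟨angle_nonneg _ _, hπ.le⟩ ⟨Real.pi_pos.le, le_rfl⟩ hπ
        refine absurd hm (ne_of_gt ?_)
        rw [Real.sqrt_lt' (add_pos hRp hRq)]
        nlinarith [mul_pos hRp hRq]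
      · have : m ∈ range (fun a : Fiber G => (a : CompletedFiber G)) := by rw [hr]; exact hmz
        obtain ⟨m, rfl⟩ := this
        simp only [UniformSpace.Completion.dist_eq] at hm
        obtain ⟨t, ht⟩ := exists_eq_of_dist_add_dist hn hG hb h hπ (fun t => (hp t).1)
          (fun t => (hp t).2) hm
        exact ⟨t, by rw [ht]⟩)
  exact ⟨γ, fun t => ⟨σ t, rfl, hγ t⟩, hγ'⟩

/-- The minimal path through the singular point. -/
theorem exists_isUniqueMinimal_rays (hn : 0 < n) (hG : G.PosDef)
    (hz : ∀ a : Fiber G, dist (a : CompletedFiber G) z = radius G a.val)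
    (hr : range (fun a : Fiber G => (a : CompletedFiber G)) = {z}ᶜ) {p q : Fiber G}
    {b : Matrix (Fin n) (Fin n) ℝ} (hb : b.IsSymm) (h : q.val = p.val * exp (p.val⁻¹ * b))
    (hπ : Real.pi ≤ angle p.val b) :
    ∃ γ : Path (p : CompletedFiber G) (q : CompletedFiber G),
      (∀ t : unitInterval, (t : ℝ) ≤ 1 / 2 → γ t = rayPoint z p (1 - 2 * t)) ∧
      (∀ t : unitInterval, 1 / 2 ≤ (t : ℝ) → γ t = rayPoint z q (2 * t - 1)) ∧
      IsUniqueMinimal γ := by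
  set g : unitInterval → CompletedFiber G := fun t =>
    if (t : ℝ) ≤ 1 / 2 then rayPoint z p (1 - 2 * t) else rayPoint z q (2 * t - 1) with hg
  have g1 (t : unitInterval) (ht : (t : ℝ) ≤ 1 / 2) : g t = rayPoint z p (1 - 2 * t) := if_pos ht
  have g2 (t : unitInterval) (ht : 1 / 2 ≤ (t : ℝ)) : g t = rayPoint z q (2 * t - 1) := by
    rcases ht.eq_or_lt with h' | h'
    · rw [g1 t h'.ge, ← h']
      norm_num [rayPoint_zero]
    · exact if_neg (not_le.2 h')
  -- A signed radius: negative on the ray of p, zero at the apex, positive on the ray of q. The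
  -- maxima with 0 switch off the inactive ray.
  set f : unitInterval → ℝ := fun t => dilation n (max (2 * t - 1) 0) * radius G q.val -
    dilation n (max (1 - 2 * t) 0) * radius G p.val with hf
  have hRp := radius_pos hn hG p.posDef
  have hRq := radius_pos hn hG q.posDef
  have hm := dilation_strictMonoOn hn
  have hd1 : ∀ s t : unitInterval, s ≤ t → (t : ℝ) ≤ 1 / 2 → dist (g s) (g t) ≤ f t - f s := by
    intro s t hst ht
    have hst' : (s : ℝ) ≤ t := hst
    rw [g1 s (hst'.trans ht), g1 t ht, dist_comm, dist_rayPoint hn hG hz p (by linarith) (by linarith)]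
    simp only [hf]
    rw [max_eq_right (b := (0 : ℝ)) (a := 2 * (t : ℝ) - 1) (by linarith),
      max_eq_left (b := (0 : ℝ)) (a := 1 - 2 * (t : ℝ)) (by linarith),
      max_eq_right (b := (0 : ℝ)) (a := 2 * (s : ℝ) - 1) (by linarith),
      max_eq_left (b := (0 : ℝ)) (a := 1 - 2 * (s : ℝ)) (by linarith)]
    linarith
  have hd2 : ∀ s t : unitInterval, s ≤ t → 1 / 2 ≤ (s : ℝ) → dist (g s) (g t) ≤ f t - f s := by
    intro s t hst hs
    have hst' : (s : ℝ) ≤ t := hst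
    rw [g2 s hs, g2 t (hs.trans hst'), dist_rayPoint hn hG hz q (by linarith) (by linarith)]
    simp only [hf]
    rw [max_eq_left (b := (0 : ℝ)) (a := 2 * (t : ℝ) - 1) (by linarith),
      max_eq_right (b := (0 : ℝ)) (a := 1 - 2 * (t : ℝ)) (by linarith),
      max_eq_left (b := (0 : ℝ)) (a := 2 * (s : ℝ) - 1) (by linarith),
      max_eq_right (b := (0 : ℝ)) (a := 1 - 2 * (s : ℝ)) (by linarith)]
    linarith
  obtain ⟨γ, hγ, hγ'⟩ := exists_isUniqueMinimal (p := (p : CompletedFiber G))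
    (q := (q : CompletedFiber G)) g f
    (by
      have := dilation_continuous (n := n)
      fun_prop)
    (by
      left
      intro s t hst
      have hst' : (s : ℝ) < t := hst
      have e1 := hm.monotoneOn (a := max (2 * (s : ℝ) - 1) 0) (b := max (2 * (t : ℝ) - 1) 0)
        (mem_Ici.2 (le_max_right _ _)) (mem_Ici.2 (le_max_right _ _)) (max_le_max_right _ (by linarith))
      have e2 := hm.monotoneOn (a := max (1 - 2 * (t : ℝ)) 0) (b := max (1 - 2 * (s : ℝ)) 0)
        (mem_Ici.2 (le_max_right _ _)) (mem_Ici.2 (le_max_right _ _)) (max_le_max_right _ (by linarith))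
      simp only [hf]
      rcases lt_or_ge (s : ℝ) (1 / 2) with h' | h'
      · have e3 := hm (a := max (1 - 2 * (t : ℝ)) 0) (b := max (1 - 2 * (s : ℝ)) 0)
          (mem_Ici.2 (le_max_right _ _)) (mem_Ici.2 (le_max_right _ _))
          (max_lt (lt_max_of_lt_left (by linarith)) (lt_max_of_lt_left (by linarith)))
        nlinarith
      · have e3 := hm (a := max (2 * (s : ℝ) - 1) 0) (b := max (2 * (t : ℝ) - 1) 0)
          (mem_Ici.2 (le_max_right _ _)) (mem_Ici.2 (le_max_right _ _))
          (max_lt (lt_max_of_lt_left (by linarith)) (lt_max_of_lt_left (by linarith)))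
        nlinarith)
    (by rw [g1 0 (by norm_num)]; simp [rayPoint_one])
    (by rw [g2 1 (by norm_num)]; norm_num [rayPoint_one])
    (fun s t hst => by
      rcases le_total (t : ℝ) (1 / 2) with ht | ht
      · exact hd1 s t hst ht
      · rcases le_total (s : ℝ) (1 / 2) with hs | hs
        · set c : unitInterval := ⟨1 / 2, by norm_num, by norm_num⟩
          have e1 := hd1 s c hs le_rfl
          have e2 := hd2 c t ht le_rfl
          linarith [dist_triangle (g s) (g c) (g t)]
        · exact hd2 s t hst hs)
    (by
      rw [UniformSpace.Completion.dist_eq, dist_of_le_angle hn hG hb h hπ]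
      simp only [hf]
      norm_num [dilation_zero hn, dilation_one]
      ring)
    (fun m hm => by
      by_cases hmz : m = z
      · refine ⟨⟨1 / 2, by norm_num, by norm_num⟩, ?_⟩
        rw [g1 _ le_rfl, hmz]
        norm_num [rayPoint_zero]
      · have : m ∈ range (fun a : Fiber G => (a : CompletedFiber G)) := by rw [hr]; exact hmz
        obtain ⟨m, rfl⟩ := this
        simp only [UniformSpace.Completion.dist_eq] at hm
        rcases radial_of_dist_add_dist hn hG hb h hπ hm with h' | h'
        · obtain ⟨s, hs, he⟩ := exists_rayPoint_eq hn hG z h'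
          refine ⟨⟨(1 - s) / 2, by linarith [hs.2], by linarith [hs.1]⟩, ?_⟩
          refine (g1 _ ?_).trans ((congrArg (rayPoint z p) ?_).trans he)
          · change (1 - s) / 2 ≤ 1 / 2
            linarith [hs.1]
          · change 1 - 2 * ((1 - s) / 2) = s
            ring
        · obtain ⟨s, hs, he⟩ := exists_rayPoint_eq hn hG z h'
          refine ⟨⟨(1 + s) / 2, by linarith [hs.1], by linarith [hs.2]⟩, ?_⟩
          refine (g2 _ ?_).trans ((congrArg (rayPoint z q) ?_).trans he)
          · change 1 / 2 ≤ (1 + s) / 2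
            linarith [hs.1]
          · change 2 * ((1 + s) / 2) - 1 = s
            ring)
  exact ⟨γ, fun t ht => (hγ t).trans (g1 t ht), fun t ht => (hγ t).trans (g2 t ht), hγ'⟩

theorem exists_eq_rayPoint_of_dist_add_dist (hn : 0 < n) (hG : G.PosDef)
    (hz : ∀ a : Fiber G, dist (a : CompletedFiber G) z = radius G a.val)
    (hr : range (fun a : Fiber G => (a : CompletedFiber G)) = {z}ᶜ) {a : Fiber G}
    {m : CompletedFiber G}
    (hm : dist (a : CompletedFiber G) m + dist m z = dist (a : CompletedFiber G) z) :
    ∃ s ∈ Icc (0 : ℝ) 1, rayPoint z a s = m := by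
  by_cases hmz : m = z
  · exact ⟨0, left_mem_Icc.2 zero_le_one, by rw [rayPoint_zero, hmz]⟩
  · have : m ∈ range (fun a : Fiber G => (a : CompletedFiber G)) := by rw [hr]; exact hmz
    obtain ⟨m, rfl⟩ := this
    simp only [hz, UniformSpace.Completion.dist_eq] at hm
    exact exists_rayPoint_eq hn hG z (by linarith)

theorem exists_isUniqueMinimal_to_origin (hn : 0 < n) (hG : G.PosDef)
    (hz : ∀ a : Fiber G, dist (a : CompletedFiber G) z = radius G a.val)
    (hr : range (fun a : Fiber G => (a : CompletedFiber G)) = {z}ᶜ) (a : Fiber G) :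
    ∃ γ : Path (a : CompletedFiber G) z, (∀ t : unitInterval, γ t = rayPoint z a (1 - t)) ∧
      IsUniqueMinimal γ := by
  have hR := radius_pos hn hG a.posDef
  refine exists_isUniqueMinimal (fun t => rayPoint z a (1 - t))
    (fun t => -(dilation n (1 - t) * radius G a.val)) ?_ (Or.inl ?_) ?_ ?_ ?_ ?_ ?_
  · have := dilation_continuous (n := n)
    fun_prop
  · intro s t hst
    have hst' : (s : ℝ) < t := hst
    have := dilation_strictMonoOn hn (a := 1 - (t : ℝ)) (b := 1 - (s : ℝ))
      (mem_Ici.2 (by linarith [t.2.2])) (mem_Ici.2 (by linarith [s.2.2])) (by linarith)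
    simp only
    nlinarith
  · simp [rayPoint_one]
  · simp [rayPoint_zero]
  · intro s t hst
    have hst' : (s : ℝ) ≤ t := hst
    rw [dist_comm, dist_rayPoint hn hG hz a (by linarith [t.2.2]) (by linarith)]
    linarith
  · rw [hz]
    simp [dilation_zero hn, dilation_one]
  · intro m hm
    obtain ⟨s, hs, he⟩ := exists_eq_rayPoint_of_dist_add_dist hn hG hz hr hm
    exact ⟨⟨1 - s, by linarith [hs.2], by linarith [hs.1]⟩, by simp [he]⟩

theorem exists_isUniqueMinimal_from_origin (hn : 0 < n) (hG : G.PosDef)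
    (hz : ∀ a : Fiber G, dist (a : CompletedFiber G) z = radius G a.val)
    (hr : range (fun a : Fiber G => (a : CompletedFiber G)) = {z}ᶜ) (a : Fiber G) :
    ∃ γ : Path z (a : CompletedFiber G), (∀ t : unitInterval, γ t = rayPoint z a t) ∧
      IsUniqueMinimal γ := by
  have hR := radius_pos hn hG a.posDef
  refine exists_isUniqueMinimal (fun t => rayPoint z a t)
    (fun t => dilation n t * radius G a.val) ?_ (Or.inl ?_) ?_ ?_ ?_ ?_ ?_
  · have := dilation_continuous (n := n)
    fun_prop
  · intro s t hst
    exact mul_lt_mul_of_pos_right (dilation_strictMonoOn hn (mem_Ici.2 s.2.1) (mem_Ici.2 t.2.1) hst)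
      hR
  · simp [rayPoint_zero]
  · simp [rayPoint_one]
  · intro s t hst
    rw [dist_rayPoint hn hG hz a s.2.1 hst]
  · rw [dist_comm, hz]
    simp [dilation_zero hn, dilation_one]
  · intro m hm
    have hm' : dist (a : CompletedFiber G) m + dist m z = dist (a : CompletedFiber G) z := by
      rw [dist_comm _ m, dist_comm m z, dist_comm _ z, add_comm]
      exact hm
    obtain ⟨s, hs, he⟩ := exists_eq_rayPoint_of_dist_add_dist hn hG hz hr hm'
    exact ⟨⟨s, hs⟩, he⟩

theorem isUniqueMinimal_refl {X : Type*} [MetricSpace X] (p : X) :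
    IsUniqueMinimal (Path.refl p) := by
  obtain ⟨γ, hγ, hγ'⟩ := exists_isUniqueMinimal (p := p) (q := p) (fun _ => p) (fun _ => 0)
    continuous_const (Or.inr rfl) rfl rfl (by simp) (by simp) (fun m hm => by
      rw [dist_self] at hm
      have h1 := dist_nonneg (x := p) (y := m)
      have h2 := dist_nonneg (x := m) (y := p)
      exact ⟨0, dist_eq_zero.1 (by linarith)⟩)
  have : γ = Path.refl p := Path.ext (funext fun t => hγ t)
  rwa [← this]

end MetricFiber

end

theorem mainTheorem5 (n : ℕ) (hn : 0 < n) (G : Matrix (Fin n) (Fin n) ℝ) (hG : G.PosDef) :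
    -- the completed fiber is the fiber together with one further point `z = [0]`
    ∃ z : MetricFiber.CompletedFiber G,
      Function.Injective (fun a : MetricFiber.Fiber G => (a : MetricFiber.CompletedFiber G)) ∧
      Set.range (fun a : MetricFiber.Fiber G => (a : MetricFiber.CompletedFiber G)) = {z}ᶜ ∧
      -- existence and uniqueness of minimal paths
      (∀ p q : MetricFiber.CompletedFiber G, ∃ γ : Path p q, MetricFiber.IsUniqueMinimal γ) ∧
      -- two points related by `a₁ = a₀ exp (a₀⁻¹ b)`
      (∀ (a₀ a₁ : MetricFiber.Fiber G) (b : Matrix (Fin n) (Fin n) ℝ), b.IsSymm →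
        a₁.val = a₀.val * NormedSpace.exp (a₀.val⁻¹ * b) →
        (MetricFiber.tr₂ a₀.val (MetricFiber.traceless a₀.val b)
            (MetricFiber.traceless a₀.val b) < (4 * Real.pi) ^ 2 / n →
          ∃ σ : ℝ → Matrix (Fin n) (Fin n) ℝ,
            (MetricFiber.IsRiemannianGeodesic G σ ∧ σ 0 = a₀.val ∧ σ 1 = a₁.val) ∧
            (∀ σ' : ℝ → Matrix (Fin n) (Fin n) ℝ, MetricFiber.IsRiemannianGeodesic G σ' →
              σ' 0 = a₀.val → σ' 1 = a₁.val → Set.EqOn σ' σ (Set.Icc 0 1)) ∧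
            Set.EqOn σ (MetricFiber.geodesicFrom a₀.val (MetricFiber.invExp a₀.val b))
              (Set.Icc 0 1) ∧
            ∃ γ : Path (a₀ : MetricFiber.CompletedFiber G) (a₁ : MetricFiber.CompletedFiber G),
              (∀ t : unitInterval, ∃ c : MetricFiber.Fiber G,
                c.val = σ t ∧ γ t = (c : MetricFiber.CompletedFiber G)) ∧
              MetricFiber.IsUniqueMinimal γ) ∧
        ((4 * Real.pi) ^ 2 / n ≤ MetricFiber.tr₂ a₀.val (MetricFiber.traceless a₀.val b)
            (MetricFiber.traceless a₀.val b) →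
          ∃ γ : Path (a₀ : MetricFiber.CompletedFiber G) (a₁ : MetricFiber.CompletedFiber G),
            (∀ t : unitInterval, (t : ℝ) ≤ 1 / 2 →
              γ t = MetricFiber.rayPoint z a₀ (1 - 2 * t)) ∧
            (∀ t : unitInterval, 1 / 2 ≤ (t : ℝ) →
              γ t = MetricFiber.rayPoint z a₁ (2 * t - 1)) ∧
            MetricFiber.IsUniqueMinimal γ)) ∧
      -- otherwise one of the two points is `[0]`
      (∀ p q : MetricFiber.CompletedFiber G,
        (¬ ∃ (a₀ a₁ : MetricFiber.Fiber G) (b : Matrix (Fin n) (Fin n) ℝ), b.IsSymm ∧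
          p = (a₀ : MetricFiber.CompletedFiber G) ∧ q = (a₁ : MetricFiber.CompletedFiber G) ∧
          a₁.val = a₀.val * NormedSpace.exp (a₀.val⁻¹ * b)) → p = z ∨ q = z) ∧
      -- and the minimal path is the straight segment
      (∀ a : MetricFiber.Fiber G,
        (∃ γ : Path (a : MetricFiber.CompletedFiber G) z,
          (∀ t : unitInterval, γ t = MetricFiber.rayPoint z a (1 - t)) ∧
          MetricFiber.IsUniqueMinimal γ) ∧
        (∃ γ : Path z (a : MetricFiber.CompletedFiber G),
          (∀ t : unitInterval, γ t = MetricFiber.rayPoint z a t) ∧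
          MetricFiber.IsUniqueMinimal γ)) ∧
      MetricFiber.IsUniqueMinimal (Path.refl z) := by
  obtain ⟨z, hz⟩ := MetricFiber.exists_origin hn hG
  have hr := MetricFiber.range_coe hn hG hz
  have hex (p : MetricFiber.CompletedFiber G) (hp : p ≠ z) :
      ∃ a : MetricFiber.Fiber G, (a : MetricFiber.CompletedFiber G) = p := by
    have : p ∈ range (fun a : MetricFiber.Fiber G => (a : MetricFiber.CompletedFiber G)) := by
      rw [hr]; exact hp
    exact this
  refine ⟨z, MetricFiber.coe_injective hn hG, hr, fun p q => ?_, fun a₀ a₁ b hb h => ⟨fun hlt => ?_,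
    fun hge => ?_⟩, fun p q hpq => ?_, fun a =>
      ⟨MetricFiber.exists_isUniqueMinimal_to_origin hn hG hz hr a,
        MetricFiber.exists_isUniqueMinimal_from_origin hn hG hz hr a⟩,
    MetricFiber.isUniqueMinimal_refl z⟩
  · by_cases hp : p = z
    · subst hp
      by_cases hq : q = p
      · subst hq
        exact ⟨_, MetricFiber.isUniqueMinimal_refl _⟩
      · obtain ⟨a, rfl⟩ := hex q hq
        obtain ⟨γ, -, hγ⟩ := MetricFiber.exists_isUniqueMinimal_from_origin hn hG hz hr a
        exact ⟨γ, hγ⟩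
    · obtain ⟨a₀, rfl⟩ := hex p hp
      by_cases hq : q = z
      · subst hq
        obtain ⟨γ, -, hγ⟩ := MetricFiber.exists_isUniqueMinimal_to_origin hn hG hz hr a₀
        exact ⟨γ, hγ⟩
      · obtain ⟨a₁, rfl⟩ := hex q hq
        obtain ⟨b, hb, h⟩ := MetricFiber.exists_eq_mul_exp a₀.posDef a₁.posDef
        rcases lt_or_ge (MetricFiber.angle a₀.val b) Real.pi with hπ | hπ
        · obtain ⟨γ, -, hγ⟩ :=
            MetricFiber.exists_isUniqueMinimal_geodesicFrom hn hG hz hr hb h hπ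
          exact ⟨γ, hγ⟩
        · obtain ⟨γ, -, -, hγ⟩ := MetricFiber.exists_isUniqueMinimal_rays hn hG hz hr hb h hπ
          exact ⟨γ, hγ⟩
  · have hπ := (MetricFiber.angle_lt_pi_iff hn).2 hlt
    obtain ⟨h1, h2, h3, -⟩ := MetricFiber.geodesicFrom_invExp hn hG a₀.posDef hb hπ
    refine ⟨_, ⟨h1, h2, h3.trans h.symm⟩, fun σ hσ hσ0 hσ1 t ht => ?_, fun _ _ => rfl,
      MetricFiber.exists_isUniqueMinimal_geodesicFrom hn hG hz hr hb h hπ⟩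
    -- Any geodesic is the explicit curve of its own initial velocity, and the end point determines
    -- that velocity.
    obtain ⟨e1, e2⟩ := hσ.eq_geodesicFrom hn hG
    have hv := hσ.isCurve.isSymm_velocity (by norm_num) (left_mem_Icc.2 zero_le_one)
    rw [hσ0] at e1 e2
    rw [e2 t ht, MetricFiber.eq_invExp hn a₀.posDef hb hv e1
      ((e2 1 (right_mem_Icc.2 zero_le_one)).symm.trans (hσ1.trans h))]
  · exact MetricFiber.exists_isUniqueMinimal_rays hn hG hz hr hb h
      (not_lt.1 fun hπ => hge.not_gt ((MetricFiber.angle_lt_pi_iff hn).1 hπ))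
  -- Two points other than the apex lie in the fiber, where exponential coordinates always supply a
  -- b.
  · by_contra! hne
    obtain ⟨a₀, rfl⟩ := hex p hne.1
    obtain ⟨a₁, rfl⟩ := hex q hne.2
    obtain ⟨b, hb, h⟩ := MetricFiber.exists_eq_mul_exp a₀.posDef a₁.posDef
    exact hpq ⟨a₀, a₁, b, hb, rfl, rfl, h⟩
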